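/- A *contracted $A_3$ web* is a planar graph drawn in a closed disk, up to isotopy, which is obtained from an $A_3$ web (edges are directed single edges or undirected double edges; every interior vertex is trivalent with one double edge and two single edges, the single edges being both directed inwards or both outwards; boundary vertices are univalent; closed loops without vertices are allowed) by contracting every double edge that neither ends at the boundary nor is a loop. Thus its interior vertices are * tetravalent, with four single edges whose directions in cyclic order are (in, in, out, out), (in, in, in, in) or (out, out, out, out), or * trivalent, on a double edge that ends at the boundary, with two single edges that are both directed inwards or both outwards. By a *polygon face* we mean an interior face (an open disk that does not meet the boundary of the disk) bounded by a closed walk along edges. Consider the following relators, up to lower order terms. * *Reduction relators* apply to an interior face that is the disk inside a single or double loop without vertices, a monogon, a bigon (with parallel or with cyclically directed sides), or a triangle whose sides do not form a directed cycle. Such a face is called *reducible*. * The *horizontal triangle relator* applies to a triangle face whose sides form a directed cycle, and pushes each of the three strands through it across the crossing of the other two. * The *horizontal square relator* applies to a square face whose sides are directed alternately, and reverses its four sides. A web is *reducible* if some finite (possibly empty) sequence of horizontal relators takes it to a web with a reducible face. An *undirected strand* is a path of edges that passes from an edge to the opposite edge at every tetravalent vertex through which it goes, and does not go through other vertices; loops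 without vertices are also (closed) strands. It is a *directed strand* if it follows the directions of its edges (double loops have no direction and are admitted). Two strands *cross* at a vertex if they use edges at that vertex that are neither equal nor opposite; the vertex may be an endpoint of the strands. A *reducible configuration of strands* is one of the following: 1. a closed strand; 2. a strand that intersects itself; 3. two strands that cross in more than one vertex; 4. three strands that cross pairwise, in three different vertices, such that the sides of the triangle that they form do not form a directed cycle. **Theorem.** For a contracted $A_3$ web $w$ the following are equivalent: * $w$ is reducible; * $w$ contains a reducible configuration of directed strands; * $w$ contains a reducible configuration of undirected strands (in particular, an undirected triangle may have any directions on its sides other than a directed cycle). -/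

import Mathlib

/-!
# Contracted A₃ webs, their relators, and configurations of strands

A web drawn in a disk is recorded, up to orientation preserving homeomorphism of the disk, by the
combinatorial map of its half-edges ("darts").  The circle bounding the disk is shrunk to a point,
so that the boundary ends of the web are the darts at one extra vertex of a map on the sphere.
-/

namespace A3

/-- The next dart of the boundary walk of the region on the left of a dart: cross the edge, then
turn to the next dart clockwise (`rot` is the counterclockwise rotation around vertices and `rev`
exchanges the two darts of an edge). -/
def faceWalk {D : Type*} (rot rev : Equiv.Perm D) : Equiv.Perm D := rot⁻¹ * rev

/-- The connected components of the map: orbits of the group generated by `rot` and `rev`. -/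
abbrev Comp {D : Type*} (rot rev : Equiv.Perm D) : Type _ :=
  MulAction.orbitRel.Quotient (Subgroup.closure ({rot, rev} : Set (Equiv.Perm D))) D

/-- The component containing a dart. -/
def comp {D : Type*} (rot rev : Equiv.Perm D) (d : D) : Comp rot rev :=
  Quotient.mk _ d

/-- Number of cycles of a permutation, fixed points included. -/
noncomputable def numCycles {D : Type*} (f : Equiv.Perm D) : ℕ :=
  Nat.card (Quotient (Equiv.Perm.SameCycle.setoid f))

/-- The graph with the components of the map and the regions of its complement as vertices, in
which a component is joined to every region that it borders. -/
def nesting {D F : Type*} (rot rev : Equiv.Perm D) (face : D → F) :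
    SimpleGraph (Comp rot rev ⊕ F) :=
  SimpleGraph.fromRel fun u v =>
    ∃ d : D, u = Sum.inl (comp rot rev d) ∧ v = Sum.inr (face d)

/-- The vertex of `d` is the marker of a closed loop (a circle without vertices is recorded as one
edge with both ends at a vertex of valence two). -/
def IsLoopVertex {D : Type*} (rot rev : Equiv.Perm D) (d : D) : Prop :=
  rot d = rev d ∧ rot (rev d) = d

/-- The vertex of `d` is a contracted double edge: four single edges, where the double edge
separated the darts `e, rot e` (both outwards or both inwards) from the other two (likewise). -/
def IsTetravalent {D : Type*} (rot : Equiv.Perm D) (dbl out : D → Prop) (d : D) : Prop :=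
  ∃ e, rot.SameCycle e d ∧ rot (rot (rot (rot e))) = e ∧ rot (rot e) ≠ e ∧
    (∀ c, rot.SameCycle e c → ¬ dbl c) ∧
    (out e ↔ out (rot e)) ∧ (out (rot (rot e)) ↔ out (rot (rot (rot e))))

/-- The vertex of `d` is a trivalent vertex on a double edge that ends at the boundary: one double
edge, and two single edges that are both directed outwards or both directed inwards. -/
def IsTrivalent {D : Type*} (rot rev : Equiv.Perm D) (dbl out bdry : D → Prop) (d : D) : Prop :=
  ∃ e, rot.SameCycle e d ∧ rot (rot (rot e)) = e ∧ dbl e ∧ bdry (rev e) ∧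
    ¬ dbl (rot e) ∧ ¬ dbl (rot (rot e)) ∧ (out (rot e) ↔ out (rot (rot e)))

/-- A contracted `A₃` web with set of darts `D` and set of complementary regions `F`. -/
structure Web (D F : Type*) where
  /-- next dart counterclockwise at the same vertex -/
  rot : Equiv.Perm D
  /-- the other dart of the same edge -/
  rev : Equiv.Perm D
  /-- the darts of double edges -/
  dbl : D → Prop
  /-- the darts at which a single edge is directed away from the vertex of the dart -/
  out : D → Prop
  /-- the darts based at the boundary of the disk -/
  bdry : D → Prop
  /-- the region on the left of a dart -/
  face : D → F
  /-- the region that touches a chosen base point on the boundary circle -/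
  outer : F
  rev_rev : ∀ d, rev (rev d) = d
  rev_ne : ∀ d, rev d ≠ d
  dbl_rev : ∀ d, dbl (rev d) ↔ dbl d
  out_rev : ∀ d, ¬ dbl d → (out (rev d) ↔ ¬ out d)
  out_dbl : ∀ d, dbl d → ¬ out d
  /-- the boundary ends form one cycle -/
  bdry_cycle : ∀ d, bdry d → ∀ e, bdry e ↔ rot.SameCycle d e
  vertex : ∀ d, ¬ bdry d → IsLoopVertex rot rev d ∨ IsTetravalent rot dbl out d ∨
    IsTrivalent rot rev dbl out bdry d
  face_walk : ∀ d, face (faceWalk rot rev d) = face d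
  /-- every component has genus zero: `V - E + (number of boundary walks) = 2 C` -/
  euler : 2 * (numCycles rot + numCycles (faceWalk rot rev)) =
    Nat.card D + 4 * Nat.card (Comp rot rev)
  /-- different boundary walks of one component lie in different regions -/
  walk_of_face : ∀ d e, comp rot rev d = comp rot rev e → face d = face e →
    (faceWalk rot rev).SameCycle d e
  /-- the components are nested in the regions of each other as on a sphere -/
  nested : (nesting rot rev face).IsTree
  /-- the base region touches the boundary circle -/
  outer_bdry : (∃ d, bdry d) → ∃ d, bdry d ∧ face d = outer

namespace Web

variable {D F : Type*}

/-! ### Faces and relators -/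

/-- The darts `a 0, …, a (k - 1)` are, in this order, the whole boundary of an interior region:
the region has no other boundary component and does not meet the boundary of the disk. -/
def IsPolygon (W : Web D F) {k : ℕ} [NeZero k] (a : Fin k → D) : Prop :=
  Function.Injective a ∧ (∀ i, faceWalk W.rot W.rev (a i) = a (i + 1)) ∧
    (∀ d, W.face d = W.face (a 0) → ∃ i, d = a i) ∧
    W.face (a 0) ≠ W.outer ∧ ∀ i, ¬ W.bdry (a i)

/-- The edges of the polygon form a directed cycle. -/
def IsCyclic (W : Web D F) {k : ℕ} (a : Fin k → D) : Prop :=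
  (∀ i, W.out (a i)) ∨ (∀ i, ¬ W.out (a i))

/-- The web has a face to which a reduction relator applies.  A polygon with one side is the disk
in a single or double loop or in a monogon; a polygon with two sides is a bigon, whose sides run
in parallel or form a directed cycle; the last case is a triangle that is not a directed cycle. -/
def HasReducibleFace (W : Web D F) : Prop :=
  (∃ a : Fin 1 → D, W.IsPolygon a) ∨ (∃ a : Fin 2 → D, W.IsPolygon a) ∨
    (∃ a : Fin 3 → D, W.IsPolygon a ∧ ¬ W.IsCyclic a)

/-- The horizontal square relator, up to lower order terms: reverse the sides of a square face
whose sides are directed alternately. -/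
def SquareMove (W W' : Web D F) : Prop :=
  ∃ a : Fin 4 → D, W.IsPolygon a ∧ (∀ i, W.out (a (i + 1)) ↔ ¬ W.out (a i)) ∧
    W'.rot = W.rot ∧ W'.rev = W.rev ∧ W'.dbl = W.dbl ∧ W'.bdry = W.bdry ∧
    W'.face = W.face ∧ W'.outer = W.outer ∧
    ∀ d, W'.out d ↔ Xor (W.out d) (∃ i, d = a i ∨ d = W.rev (a i))

/-- The horizontal triangle relator, up to lower order terms: flip a triangle face that is a
directed cycle.  All edges are kept.  The vertex between the sides `i` and `i - 1` has the darts
`a i, rev (a (i - 1)), x i, y i` in counterclockwise order, where `x i = rot (rot (a i))` continues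
side `i` and `y i = rot (rot (rot (a i)))` continues side `i - 1`.  After the flip the same two
strands cross in a vertex with the darts `rev (a i), a (i - 1), y (i + 1), x (i - 1)`.  The new
triangle is on the left of the darts `rev (a i)`, and `a i` has on its left the region that was
opposite to the side `i` at the vertex between the other two sides. -/
def TriangleMove (W W' : Web D F) : Prop :=
  ∃ a x y : Fin 3 → D, W.IsPolygon a ∧ W.IsCyclic a ∧
    (∀ i, x i = W.rot (W.rot (a i))) ∧ (∀ i, y i = W.rot (W.rot (W.rot (a i)))) ∧
    W'.rev = W.rev ∧ W'.dbl = W.dbl ∧ W'.out = W.out ∧ W'.bdry = W.bdry ∧ W'.outer = W.outer ∧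
    (∀ i, W'.rot (W.rev (a i)) = a (i - 1) ∧ W'.rot (a (i - 1)) = y (i + 1) ∧
      W'.rot (y (i + 1)) = x (i - 1) ∧ W'.rot (x (i - 1)) = W.rev (a i)) ∧
    (∀ d, (∀ i, ¬ W.rot.SameCycle (a i) d) → W'.rot d = W.rot d) ∧
    (∀ i, W'.face (W.rev (a i)) = W.face (a 0) ∧ W'.face (a i) = W.face (x (i - 1))) ∧
    (∀ d, (∀ i, d ≠ a i ∧ d ≠ W.rev (a i)) → W'.face d = W.face d)

/-- One web is obtained from the other by a horizontal relator, up to lower order terms. -/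
def HorizontalMove (W W' : Web D F) : Prop :=
  W.SquareMove W' ∨ W.TriangleMove W'

/-- A web is reducible if a sequence of horizontal relators takes it to a web to which a
reduction relator applies. -/
def Reducible (W : Web D F) : Prop :=
  ∃ W' : Web D F, Relation.ReflTransGen HorizontalMove W W' ∧ W'.HasReducibleFace

/-! ### Strands -/

/-- A strand that traverses the edge of `d` away from the vertex of `d` goes on along `e`: it
passes to the opposite edge at a tetravalent vertex, and goes around a loop. -/
def Step (W : Web D F) (d e : D) : Prop :=
  (IsTetravalent W.rot W.dbl W.out (W.rev d) ∧ ¬ W.bdry (W.rev d) ∧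
    e = W.rot (W.rot (W.rev d))) ∨
  (IsLoopVertex W.rot W.rev (W.rev d) ∧ ¬ W.bdry (W.rev d) ∧ e = W.rot (W.rev d))

/-- The edge of `d` may be traversed away from the vertex of `d` (double edges have no
direction). -/
def Forward (W : Web D F) (d : D) : Prop := W.dbl d ∨ W.out d

/-- An undirected strand leaves the vertex of `d` along `d` and ends with the edge of `e`,
traversed away from the vertex of `e`. -/
def Seg (W : Web D F) (d e : D) : Prop := Relation.ReflTransGen W.Step d e

/-- The same for a strand that is traversed along its direction. -/
def ForwardSeg (W : Web D F) (d e : D) : Prop :=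
  W.Forward d ∧ Relation.ReflTransGen (fun b c => W.Step b c ∧ W.Forward c) d e

/-- The same for a directed strand, traversed along or against its direction. -/
def DirSeg (W : Web D F) (d e : D) : Prop :=
  W.ForwardSeg d e ∨ W.ForwardSeg (W.rev e) (W.rev d)

/-- The single darts `d` and `e` belong to two strands that cross in an interior vertex of the
disk: they are adjacent, not opposite, at an interior vertex of the web. -/
def Cross (W : Web D F) (d e : D) : Prop :=
  (W.rot d = e ∨ W.rot e = d) ∧ ¬ W.bdry d ∧ ¬ W.dbl d ∧ ¬ W.dbl e ∧ W.rot (W.rot d) ≠ d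

/-- A closed undirected strand. -/
def HasClosedStrand (W : Web D F) : Prop := ∃ d, Relation.TransGen W.Step d d

/-- A closed directed strand (or a double loop). -/
def HasClosedDirectedStrand (W : Web D F) : Prop :=
  ∃ d, Relation.TransGen (fun b c => W.Step b c ∧ W.Forward c) d d

/-- A strand that intersects itself, where `S` says which strands are allowed. -/
def HasMonogon (W : Web D F) (S : D → D → Prop) : Prop :=
  ∃ d e, S d e ∧ W.Cross d (W.rev e)

/-- Two strands that cross in two different vertices. -/
def HasBigon (W : Web D F) (S : D → D → Prop) : Prop :=
  ∃ d e d' e', S d e ∧ S d' e' ∧ W.Cross d d' ∧ W.Cross (W.rev e) (W.rev e') ∧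
    ¬ W.rot.SameCycle d (W.rev e)

/-- Three strands that cross pairwise, in three different vertices, so that the triangle they form
is not a directed cycle: side `i` starts with `a i` and ends with `e i`. -/
def HasTriangle (W : Web D F) (S : D → D → Prop) : Prop :=
  ∃ a e : Fin 3 → D, (∀ i, S (a i) (e i)) ∧ (∀ i, W.Cross (a (i + 1)) (W.rev (e i))) ∧
    (∀ i j, W.rot.SameCycle (a i) (a j) → i = j) ∧
    ¬ (∀ i, W.ForwardSeg (a i) (e i)) ∧ ¬ (∀ i, W.ForwardSeg (W.rev (e i)) (W.rev (a i)))

/-- The web contains a reducible configuration of directed strands. -/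
def HasDirectedConfiguration (W : Web D F) : Prop :=
  W.HasClosedDirectedStrand ∨ W.HasMonogon W.DirSeg ∨ W.HasBigon W.DirSeg ∨
    W.HasTriangle W.DirSeg

/-- The web contains a reducible configuration of undirected strands. -/
def HasUndirectedConfiguration (W : Web D F) : Prop :=
  W.HasClosedStrand ∨ W.HasMonogon W.Seg ∨ W.HasBigon W.Seg ∨ W.HasTriangle W.Seg

end Web

end A3

namespace A3

namespace Web

section

variable {D F : Type*}

/-! ### The Jordan curve theorem for webs -/

/-! All three conditions are shown to be equivalent to the existence of a bad curve. A polygon is a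
simple closed curve made of `n` arcs of strands (`IsPoly`; for `n = 1` the strand may close up
smoothly). It is bad (`IsBad`) if `n ≤ 2`, or if `n = 3` and its edges do not form a directed cycle.

Configurations and bad curves. Cutting strands at their first coincidence of vertices turns an
undirected configuration into a bad curve (`exists_isBad`). Conversely, Euler's formula and the
nesting tree give a Jordan curve theorem (`IsCycle.exists_inner`), so a bad curve with the fewest
regions inside can be chosen (`exists_isMin`). A strand that enters its inside must leave it again
without cutting off a bad curve. Hence a minimal curve with at most two sides bounds a reducible
face (`face_of_one`, `face_of_two`), the corners of a minimal triangle are convex, and every chord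
of it cuts off a directed triangle at a corner (`chord_signs`). With the pattern of directions at a
tetravalent vertex this forces the sides of a minimal triangle to be directed strands (`out_side`).
So a bad curve yields a directed configuration (`IsBad.directed`).

Bad curves give reducibility. In a minimal bad triangle two sides have one direction and the third
the other; chords join only the first two, so the third is a single edge. If there are chords, the
one nearest to the third side is a single edge that cuts off an alternating square
(`structure_of_three`). The square relator reverses that chord but not the sides that remain, so the
rest of the triangle becomes a bad curve with fewer regions inside, and induction applies
(`reducible_of_isInner`).

Reducibility gives bad curves. A reducible face yields a bad curve, so it suffices that horizontal
relators do not create bad curves. The square relator keeps the underlying map. A minimal bad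
triangle that became directed would have its single-edge side on the square, and prolonging the
other two sides across the square gives a triangle that is bad after the move (`bad_of_squareMove`).
The triangle relator keeps all strands as sequences of darts and moves three crossings along them.
Sliding corners back turns a triangle of the new web into one of the old web, unless the triangle is
the flipped face itself, which is a directed cycle (`TriFlip.cyc_of_corners`). -/

lemma face_rev_rot (W : Web D F) (x : D) : W.face (W.rev (W.rot x)) = W.face x := by
  have h := W.face_walk (W.rev (W.rot x))
  simp only [faceWalk, Equiv.Perm.mul_apply, W.rev_rev, Equiv.Perm.inv_def, Equiv.symm_apply_apply] at h
  exact h.symm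

lemma comp_rot (W : Web D F) (x : D) : comp W.rot W.rev (W.rot x) = comp W.rot W.rev x :=
  Quotient.sound ⟨⟨W.rot, Subgroup.subset_closure (by simp)⟩, rfl⟩

lemma comp_rev (W : Web D F) (x : D) : comp W.rot W.rev (W.rev x) = comp W.rot W.rev x :=
  Quotient.sound ⟨⟨W.rev, Subgroup.subset_closure (by simp)⟩, rfl⟩

lemma eq_of_comp_eq (W : Web D F) {α : Sort*} (f : D → α) (h₁ : ∀ d, f (W.rot d) = f d)
    (h₂ : ∀ d, f (W.rev d) = f d) {d e : D} (h : comp W.rot W.rev d = comp W.rot W.rev e) :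
    f d = f e := by
  obtain ⟨⟨g, hg⟩, rfl⟩ := Quotient.exact h
  change f (g e) = f e
  induction hg using Subgroup.closure_induction generalizing e with
  | mem x hx =>
    rcases hx with rfl | rfl
    exacts [h₁ _, h₂ _]
  | one => rfl
  | mul x y _ _ hx hy =>
    rw [Equiv.Perm.mul_apply, hx (Quotient.sound (MulAction.mem_orbit _ (⟨x, by assumption⟩ :
      Subgroup.closure ({W.rot, W.rev} : Set (Equiv.Perm D))))),
      hy (Quotient.sound (MulAction.mem_orbit _ (⟨y, by assumption⟩ :
      Subgroup.closure ({W.rot, W.rev} : Set (Equiv.Perm D)))))]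
  | inv x hx' hx =>
    have h := hx (e := x⁻¹ e) (Quotient.sound (MulAction.mem_orbit _ (⟨x, by assumption⟩ :
      Subgroup.closure ({W.rot, W.rev} : Set (Equiv.Perm D)))))
    rw [Equiv.Perm.inv_def, Equiv.apply_symm_apply] at h
    exact h.symm

lemma nesting_adj (W : Web D F) (d : D) :
    (nesting W.rot W.rev W.face).Adj (Sum.inl (comp W.rot W.rev d)) (Sum.inr (W.face d)) := by
  simp only [nesting, SimpleGraph.fromRel_adj]
  exact ⟨by simp, Or.inl ⟨d, rfl, rfl⟩⟩

lemma exists_of_nesting_adj (W : Web D F) {u v} (h : (nesting W.rot W.rev W.face).Adj u v) :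
    ∃ d, (u = Sum.inl (comp W.rot W.rev d) ∧ v = Sum.inr (W.face d)) ∨
      (v = Sum.inl (comp W.rot W.rev d) ∧ u = Sum.inr (W.face d)) := by
  simp only [nesting, SimpleGraph.fromRel_adj] at h
  rcases h.2 with ⟨d, hd⟩ | ⟨d, hd⟩
  exacts [⟨d, Or.inl hd⟩, ⟨d, Or.inr hd⟩]

/-- A function of the regions that does not jump across edges is constant. -/
lemma const_of_no_jump (W : Web D F) {α : Sort*} (u : F → α)
    (h : ∀ d, u (W.face d) = u (W.face (W.rev d))) (r r' : F) : u r = u r' := by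
  have hc : ∀ d e, comp W.rot W.rev d = comp W.rot W.rev e → u (W.face d) = u (W.face e) := by
    intro d e hde
    refine W.eq_of_comp_eq (fun d => u (W.face d)) (fun d => ?_) (fun d => (h d).symm) hde
    rw [h, face_rev_rot]
  let P : Comp W.rot W.rev ⊕ F → Prop := Sum.elim
    (fun c => ∀ d, comp W.rot W.rev d = c → u (W.face d) = u r') (fun s => u s = u r')
  have step : ∀ a b, (nesting W.rot W.rev W.face).Adj a b → P a → P b := by
    intro a b hab ha
    obtain ⟨d, ⟨rfl, rfl⟩ | ⟨rfl, rfl⟩⟩ := W.exists_of_nesting_adj hab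
    · exact ha d rfl
    · intro e he
      exact (hc e d he).trans ha
  have hr := W.nested.1.preconnected (Sum.inr r') (Sum.inr r)
  rw [SimpleGraph.reachable_iff_reflTransGen] at hr
  have : ∀ a, Relation.ReflTransGen (nesting W.rot W.rev W.face).Adj (Sum.inr r') a → P a := by
    intro a ha
    induction ha with
    | refl => exact rfl
    | tail _ hab ih => exact step _ _ hab ih
  exact this _ hr

/-- The indicator of a region without darts jumps across no edge, hence is constant, so that region
is the only one. -/
lemma face_surjective (W : Web D F) (r : F) : r = W.outer ∨ ∃ d, W.face d = r := by
  classical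
  by_contra hr
  push Not at hr
  have := W.const_of_no_jump (fun s => s = r)
    (fun d => by simp [hr.2]) r W.outer
  simp only [true_iff, eq_iff_iff] at this
  exact hr.1 this.symm

lemma finite_regions [Finite D] (W : Web D F) : Finite F := by
  have : (Set.range W.face ∪ {W.outer} : Set F) = Set.univ := by
    ext r
    rcases W.face_surjective r with h | ⟨d, h⟩
    · simp [h]
    · simp only [Set.mem_union, Set.mem_range, Set.mem_univ, iff_true]
      exact Or.inl ⟨d, h⟩
  exact Set.finite_univ_iff.mp (this ▸ (Set.finite_range _).union (Set.finite_singleton _))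

/-- By `walk_of_face` a boundary walk is determined by its component and its region, that is, by an
edge of the nesting graph. -/
lemma card_edges_nesting (W : Web D F) :
    Nat.card (nesting W.rot W.rev W.face).edgeSet = numCycles (faceWalk W.rot W.rev) := by
  symm
  have hsame : ∀ d e, (faceWalk W.rot W.rev).SameCycle d e →
      comp W.rot W.rev d = comp W.rot W.rev e ∧ W.face d = W.face e := by
    rintro d e ⟨k, rfl⟩
    have hstep : ∀ y, comp W.rot W.rev (faceWalk W.rot W.rev y) = comp W.rot W.rev y ∧
        W.face (faceWalk W.rot W.rev y) = W.face y := by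
      intro y
      refine ⟨?_, W.face_walk y⟩
      rw [← comp_rev W y, ← comp_rot W (faceWalk W.rot W.rev y)]
      simp [faceWalk]
    induction k using Int.induction_on with
    | zero => simp
    | succ i ih =>
      rw [add_comm, zpow_add, zpow_one, Equiv.Perm.mul_apply, (hstep _).1, (hstep _).2]
      exact ih
    | pred i ih =>
      have := hstep (((faceWalk W.rot W.rev) ^ (-(i : ℤ) - 1)) d)
      rw [← Equiv.Perm.mul_apply, ← zpow_one_add, add_sub_cancel] at this
      rw [← this.1, ← this.2]
      exact ih
  refine Nat.card_congr (Equiv.ofBijective (fun q => Quotient.liftOn q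
    (fun d => (⟨s(Sum.inl (comp W.rot W.rev d), Sum.inr (W.face d)), W.nesting_adj d⟩ :
      (nesting W.rot W.rev W.face).edgeSet)) ?_) ⟨?_, ?_⟩)
  · intro d e hde
    refine Subtype.ext ?_
    change s(Sum.inl (comp W.rot W.rev d), Sum.inr (W.face d)) =
      s(Sum.inl (comp W.rot W.rev e), Sum.inr (W.face e))
    rw [(hsame d e hde).1, (hsame d e hde).2]
  · rintro ⟨d⟩ ⟨e⟩ hde
    have h := congrArg Subtype.val hde
    change s(Sum.inl (comp W.rot W.rev d), Sum.inr (W.face d)) =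
      s(Sum.inl (comp W.rot W.rev e), Sum.inr (W.face e)) at h
    simp only [Sym2.eq_iff, Sum.inl.injEq, Sum.inr.injEq, reduceCtorEq, and_self, or_false] at h
    exact Quotient.sound (W.walk_of_face d e h.1 h.2)
  · rintro ⟨e, he⟩
    induction e using Sym2.ind with
    | _ a b =>
      obtain ⟨d, ⟨rfl, rfl⟩ | ⟨rfl, rfl⟩⟩ := W.exists_of_nesting_adj he
      · exact ⟨Quotient.mk _ d, rfl⟩
      · refine ⟨Quotient.mk _ d, Subtype.ext ?_⟩
        exact Sym2.eq_swap

/-- A tree has one more vertex than it has edges. -/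
lemma card_regions [Finite D] (W : Web D F) :
    Nat.card F + Nat.card (Comp W.rot W.rev) = numCycles (faceWalk W.rot W.rev) + 1 := by
  have := W.finite_regions
  have : Finite (Comp W.rot W.rev) := Quotient.finite _
  have h := (SimpleGraph.isTree_iff_connected_and_card.mp W.nested).2
  rw [card_edges_nesting, Nat.card_sum] at h
  omega

/-! ### Cycles of the map are boundaries: a dimension count -/

section Potential

variable (W : Web D F)

/-- The vertices of the map. -/
abbrev Vert : Type _ := Quotient (Equiv.Perm.SameCycle.setoid W.rot)

/-- The vertex of a dart. -/
def vert (d : D) : W.Vert := Quotient.mk _ d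

lemma vert_eq_iff {d e : D} : W.vert d = W.vert e ↔ W.rot.SameCycle d e :=
  ⟨fun h => Quotient.exact h, fun h => Quotient.sound h⟩

/-- The difference of a function of the vertices along the darts. -/
def vertDiff : (W.Vert → ℝ) →ₗ[ℝ] (D → ℝ) where
  toFun g d := g (W.vert (W.rev d)) - g (W.vert d)
  map_add' g h := by ext d; simp; ring
  map_smul' t g := by ext d; simp; ring

/-- The jump of a function of the regions across the darts, from right to left. -/
def faceDiff : (F → ℝ) →ₗ[ℝ] (D → ℝ) where
  toFun f d := f (W.face d) - f (W.face (W.rev d))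
  map_add' g h := by ext d; simp; ring
  map_smul' t g := by ext d; simp; ring

/-- The one-chains of the map. -/
def chains : Submodule ℝ (D → ℝ) where
  carrier := {c | ∀ d, c (W.rev d) = -c d}
  add_mem' h₁ h₂ d := by simp [h₁ d, h₂ d]; ring
  zero_mem' d := by simp
  smul_mem' t c h d := by simp [h d]

variable [Finite D]

/-- A numbering of the darts orients every edge by a sign `σ`. Multiplication by `σ` turns
antisymmetric functions into symmetric ones, and only zero is both. -/
lemma two_mul_finrank_chains : 2 * Module.finrank ℝ W.chains ≤ Nat.card D := by
  classical
  have := Fintype.ofFinite D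
  let enc : D ≃ Fin (Fintype.card D) := Fintype.equivFin D
  let σ : D → ℝ := fun d => if enc d < enc (W.rev d) then 1 else -1
  have hσ : ∀ d, σ (W.rev d) = -σ d := by
    intro d
    simp only [σ, W.rev_rev]
    have hne : enc (W.rev d) ≠ enc d := fun h => W.rev_ne d (enc.injective h)
    rcases lt_or_gt_of_ne hne with h | h
    · rw [if_pos h, if_neg (not_lt.mpr h.le)]; simp
    · rw [if_neg (not_lt.mpr h.le), if_pos h]
  have hσ2 : ∀ d, σ d * σ d = 1 := by
    intro d; simp only [σ]; split_ifs <;> norm_num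
  let M : (D → ℝ) →ₗ[ℝ] (D → ℝ) :=
    { toFun := fun c d => σ d * c d
      map_add' := fun g h => by ext d; simp; ring
      map_smul' := fun t g => by ext d; simp; ring }
  have hM : Function.Injective M := by
    intro c c' h
    ext d
    have := congrFun h d
    simp only [M, LinearMap.coe_mk, AddHom.coe_mk] at this
    have h3 : σ d * (σ d * c d) = σ d * (σ d * c' d) := by rw [this]
    rwa [← mul_assoc, ← mul_assoc, hσ2, one_mul, one_mul] at h3
  have hdisj : Disjoint W.chains (W.chains.map M) := by
    rw [Submodule.disjoint_def]
    rintro c hc ⟨c', hc', rfl⟩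
    ext d
    have h1 := hc d
    simp only [M, LinearMap.coe_mk, AddHom.coe_mk, hσ, hc' d] at h1
    simp only [M, LinearMap.coe_mk, AddHom.coe_mk, Pi.zero_apply]
    linarith
  have h := Submodule.finrank_add_finrank_le_of_disjoint hdisj
  rw [← (Submodule.equivMapOfInjective M hM W.chains).finrank_eq] at h
  simp only [Module.finrank_fintype_fun_eq_card] at h
  rw [Nat.card_eq_fintype_card]
  omega

/-- By `const_of_no_jump` the kernel consists of the constants. -/
lemma finrank_faceDiff : Nat.card F ≤ Module.finrank ℝ (LinearMap.range W.faceDiff) + 1 := by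
  have := W.finite_regions
  have := Fintype.ofFinite F
  have h := LinearMap.finrank_range_add_finrank_ker W.faceDiff
  rw [Module.finrank_fintype_fun_eq_card, ← Nat.card_eq_fintype_card] at h
  have hk : Module.finrank ℝ (LinearMap.ker W.faceDiff) ≤ 1 := by
    refine finrank_le_one (⟨fun _ => 1, ?_⟩) ?_
    · ext d; simp [faceDiff]
    · rintro ⟨f, hf⟩
      refine ⟨f W.outer, ?_⟩
      ext r
      simp only [SetLike.val_smul, Pi.smul_apply, smul_eq_mul, mul_one]
      refine W.const_of_no_jump f (fun d => ?_) _ _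
      have := congrFun hf d
      simp only [faceDiff, LinearMap.coe_mk, AddHom.coe_mk, Pi.zero_apply] at this
      linarith
  omega

/-- A function in the kernel is constant on every component, so its values at one dart of each
component determine it. -/
lemma finrank_vertDiff : numCycles W.rot ≤
    Module.finrank ℝ (LinearMap.range W.vertDiff) + Nat.card (Comp W.rot W.rev) := by
  classical
  have : Finite (Comp W.rot W.rev) := Quotient.finite _
  have : Finite W.Vert := Quotient.finite _
  have := Fintype.ofFinite W.Vert
  have := Fintype.ofFinite (Comp W.rot W.rev)
  have h := LinearMap.finrank_range_add_finrank_ker W.vertDiff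
  rw [Module.finrank_fintype_fun_eq_card, ← Nat.card_eq_fintype_card] at h
  have hk : Module.finrank ℝ (LinearMap.ker W.vertDiff) ≤ Nat.card (Comp W.rot W.rev) := by
    let B : LinearMap.ker W.vertDiff →ₗ[ℝ] (Comp W.rot W.rev → ℝ) :=
      { toFun := fun g c => g.1 (W.vert c.out)
        map_add' := fun g h => by ext c; simp
        map_smul' := fun t g => by ext c; simp }
    have hB : Function.Injective B := by
      rw [← LinearMap.ker_eq_bot, LinearMap.ker_eq_bot']
      rintro ⟨g, hg⟩ h0
      ext v
      induction v using Quotient.inductionOn with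
      | _ d =>
        have h1 := congrFun h0 (comp W.rot W.rev d)
        simp only [B, LinearMap.coe_mk, AddHom.coe_mk, Pi.zero_apply] at h1
        rw [Submodule.coe_zero, Pi.zero_apply, ← h1]
        refine W.eq_of_comp_eq (fun d => g (W.vert d)) (fun d => ?_) (fun d => ?_)
          (Quotient.out_eq _).symm
        · congr 1
          rw [vert_eq_iff]
          exact (Equiv.Perm.sameCycle_apply_left).mpr (Equiv.Perm.SameCycle.refl _ _)
        · have := congrFun hg d
          simp only [vertDiff, LinearMap.coe_mk, AddHom.coe_mk, Pi.zero_apply] at this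
          linarith
    have := LinearMap.finrank_le_finrank_of_injective hB
    rwa [Module.finrank_fintype_fun_eq_card, ← Nat.card_eq_fintype_card] at this
  have : numCycles W.rot = Nat.card W.Vert := rfl
  omega

/-- Every cycle of the map is a boundary. -/
theorem exists_potential [Fintype D] (c : D → ℝ) (hc : ∀ d, c (W.rev d) = -c d)
    (hg : ∀ g : W.Vert → ℝ, ∑ d, c d * (g (W.vert (W.rev d)) - g (W.vert d)) = 0) :
    ∃ u : F → ℝ, ∀ d, u (W.face d) - u (W.face (W.rev d)) = c d := by
  have hV : LinearMap.range W.vertDiff ≤ W.chains := by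
    rintro _ ⟨g, rfl⟩ d
    simp [vertDiff, W.rev_rev]
  let Z : Submodule ℝ (D → ℝ) := 
    { carrier := {c | (∀ d, c (W.rev d) = -c d) ∧ ∀ g : W.Vert → ℝ, 
        ∑ d, c d * (g (W.vert (W.rev d)) - g (W.vert d)) = 0}
      add_mem' := by
        rintro a b ⟨ha, ha'⟩ ⟨hb, hb'⟩
        refine ⟨fun d => by simp [ha d, hb d]; ring, fun g => ?_⟩
        simp only [Pi.add_apply, add_mul, Finset.sum_add_distrib, ha', hb', add_zero]
      zero_mem' := by simp
      smul_mem' := by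
        rintro t a ⟨ha, ha'⟩
        refine ⟨fun d => by simp [ha d], fun g => ?_⟩
        simp only [Pi.smul_apply, smul_eq_mul, mul_assoc, ← Finset.mul_sum, ha', mul_zero] }
  have hZ : Z ≤ W.chains := fun c h => h.1
  have hF : LinearMap.range W.faceDiff ≤ Z := by
    rintro _ ⟨f, rfl⟩
    refine ⟨fun d => by simp [faceDiff, W.rev_rev], fun g => ?_⟩
    have h1 : ∑ d, f (W.face d) * g (W.vert (W.rev d)) = 
        ∑ d, f (W.face (W.rev d)) * g (W.vert d) := by
      rw [← Equiv.sum_comp W.rev]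
      simp [W.rev_rev]
    -- The region on the right of `rot d` is the one on the left of `d`, and both darts have the
    -- same vertex, so reindexing by `rot` matches the sums.
    have h2 : ∑ d, f (W.face (W.rev d)) * g (W.vert d) = ∑ d, f (W.face d) * g (W.vert d) := by
      rw [← Equiv.sum_comp W.rot]
      refine Finset.sum_congr rfl fun d _ => ?_
      rw [face_rev_rot]
      congr 2
      rw [vert_eq_iff]
      exact (Equiv.Perm.sameCycle_apply_left).mpr (Equiv.Perm.SameCycle.refl _ _)
    have h3 : ∑ d, f (W.face (W.rev d)) * g (W.vert (W.rev d)) = 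
        ∑ d, f (W.face d) * g (W.vert d) := 
      Equiv.sum_comp W.rev (fun d => f (W.face d) * g (W.vert d))
    simp only [faceDiff, LinearMap.coe_mk, AddHom.coe_mk, sub_mul, mul_sub, Finset.sum_sub_distrib]
    rw [h1, h2, h3]
    ring
  -- Testing a vertex difference that lies in `Z` against its own potential gives a vanishing sum of
  -- squares.
  have hdisj : Disjoint (LinearMap.range W.vertDiff) Z := by
    rw [Submodule.disjoint_def]
    rintro _ ⟨g, rfl⟩ ⟨_, h⟩
    have := h g
    simp only [vertDiff, LinearMap.coe_mk, AddHom.coe_mk] at this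
    rw [Finset.sum_eq_zero_iff_of_nonneg (fun _ _ => mul_self_nonneg _)] at this
    ext d
    have := this d (Finset.mem_univ d)
    simpa [vertDiff] using this
  have h1 := Submodule.finrank_add_finrank_le_of_disjoint 
    (s := (LinearMap.range W.vertDiff).comap W.chains.subtype) (t := Z.comap W.chains.subtype) 
    (by
      rw [Submodule.disjoint_def] at hdisj ⊢
      exact fun x hx hx' => Subtype.ext (hdisj x hx hx'))
  rw [(Submodule.comapSubtypeEquivOfLe hV).finrank_eq,
    (Submodule.comapSubtypeEquivOfLe hZ).finrank_eq] at h1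
  have h2 := W.two_mul_finrank_chains
  have h3 := W.finrank_vertDiff
  have h4 := W.finrank_faceDiff
  have h5 := W.card_regions
  have h6 := W.euler
  -- With `V` vertices, `n` boundary walks, `c` components and `f` regions: `dim Z ≤ |D|/2 - (V - c)
  -- = n - c = f - 1 ≤ dim (range faceDiff)`, by `euler` and `card_regions`.
  have := Submodule.eq_of_le_of_finrank_le hF (by omega)
  have hcZ : c ∈ Z := ⟨hc, hg⟩
  rw [← this] at hcZ
  obtain ⟨u, hu⟩ := hcZ
  exact ⟨u, fun d => congrFun hu d⟩

end Potential

end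

section

variable {D F : Type*}

/-! ### Simple closed curves and the regions inside them -/

lemma sameCycle_induction [Finite D] {f : Equiv.Perm D} {x y : D} (h : f.SameCycle x y)
    (P : D → Prop) (hx : P x) (hf : ∀ z, P z → P (f z)) : P y := by
  obtain ⟨n, rfl⟩ := h.exists_nat_pow_eq
  induction n with
  | zero => exact hx
  | succ n ih =>
    rw [pow_succ', Equiv.Perm.mul_apply]
    exact hf _ (ih ⟨n, by simp⟩)

/-- Used for turning around a vertex from one dart of a curve to the other: `Q` is constant on the
orbit from `x` up to the dart `z` just before the first visit to `y`. -/
lemma iff_of_walk [Finite D] {f : Equiv.Perm D} {x y : D} (h : f.SameCycle x y) (hxy : x ≠ y)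
    (Q : D → Prop) (hQ : ∀ z, f z ≠ x → f z ≠ y → f.SameCycle x z → (Q (f z) ↔ Q z)) {z : D}
    (hz : f z = y) : Q x ↔ Q z := by
  classical
  have hex := h.exists_nat_pow_eq
  set k := Nat.find hex with hk
  have hky : (f ^ k) x = y := Nat.find_spec hex
  have hmin : ∀ j < k, (f ^ j) x ≠ y := fun j hj => Nat.find_min hex hj
  have hall : ∀ j < k, (Q x ↔ Q ((f ^ j) x)) := by
    intro j
    induction j with
    | zero => simp
    | succ j ih =>
      intro hj
      rw [ih (by omega), pow_succ', Equiv.Perm.mul_apply]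
      refine (hQ _ ?_ ?_ ⟨j, by simp⟩).symm
      -- A return to `x` after `j + 1` steps would bring the first visit to `y` forward by `j + 1`
      -- steps.
      · intro he
        refine hmin (k - (j + 1)) (by omega) ?_
        rw [← hky]
        conv_rhs => rw [show k = k - (j + 1) + (j + 1) by omega, pow_add, Equiv.Perm.mul_apply,
          pow_succ' f j, Equiv.Perm.mul_apply, he]
      · rw [← Equiv.Perm.mul_apply, ← pow_succ']
        exact hmin _ hj
  have hk0 : k ≠ 0 := by
    intro h0
    rw [h0] at hky
    exact hxy hky
  have : z = (f ^ (k - 1)) x := by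
    apply f.injective
    rw [hz, ← hky, ← Equiv.Perm.mul_apply, ← pow_succ', Nat.sub_add_cancel (by omega)]
  rw [this]
  exact hall _ (by omega)

/-- The darts of a simple closed curve, directed along the curve. -/
structure IsCycle (W : Web D F) (C : Set D) : Prop where
  nonempty : C.Nonempty
  succ : ∀ d ∈ C, ∃ e ∈ C, W.rot.SameCycle (W.rev d) e ∧ e ≠ W.rev d
  tail_inj : ∀ d ∈ C, ∀ e ∈ C, W.rot.SameCycle d e → d = e
  conn : ∀ S ⊆ C, S.Nonempty → (∀ d ∈ S, ∀ e ∈ C, W.rot.SameCycle (W.rev d) e → e ∈ S) → S = C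

/-- `Ω` consists of the regions inside a curve that is directed counterclockwise. -/
structure IsInner (W : Web D F) (C : Set D) (Ω : Set F) : Prop where
  outer : W.outer ∉ Ω
  left : ∀ d ∈ C, W.face d ∈ Ω
  right : ∀ d ∈ C, W.face (W.rev d) ∉ Ω
  off : ∀ d, d ∉ C → W.rev d ∉ C → (W.face d ∈ Ω ↔ W.face (W.rev d) ∈ Ω)

/-- A dart with both sides in `Ω`. -/
def Ins (W : Web D F) (Ω : Set F) (x : D) : Prop := W.face x ∈ Ω ∧ W.face (W.rev x) ∈ Ω

/-- The vertex of the dart `x` lies on the curve. -/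
def On (W : Web D F) (C : Set D) (x : D) : Prop := ∃ e ∈ C, W.rot.SameCycle e x

variable {W : Web D F} {C : Set D} {Ω : Set F}

lemma Ins.rev {x : D} (h : W.Ins Ω x) : W.Ins Ω (W.rev x) :=
  ⟨h.2, by rw [W.rev_rev]; exact h.1⟩

/-- The darts of `C` that have a predecessor are closed under succession, so `conn` makes them all
of `C`. -/
lemma IsCycle.pred (hC : W.IsCycle C) {e : D} (he : e ∈ C) :
    ∃ d ∈ C, W.rot.SameCycle (W.rev d) e := by
  have h := hC.conn {e | e ∈ C ∧ ∃ d ∈ C, W.rot.SameCycle (W.rev d) e} (fun e h => h.1) ?_ ?_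
  · exact (h.ge he).2
  · obtain ⟨d, hd⟩ := hC.nonempty
    obtain ⟨e, he, h1, _⟩ := hC.succ d hd
    exact ⟨e, he, d, hd, h1⟩
  · intro d hd e he hde
    exact ⟨he, d, hd.1, hde⟩

lemma IsCycle.rev_notMem (hC : W.IsCycle C) {d : D} (hd : d ∈ C) : W.rev d ∉ C := by
  intro h
  obtain ⟨e, he, h1, h2⟩ := hC.succ d hd
  exact h2 (hC.tail_inj _ h _ he h1).symm

lemma not_on_mem (hC : W.IsCycle C) {x : D} (hx : ¬ W.On C x) : x ∉ C ∧ W.rev x ∉ C := by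
  refine ⟨fun h => hx ⟨x, h, Equiv.Perm.SameCycle.refl _ _⟩, fun h => ?_⟩
  obtain ⟨e, he, h1, _⟩ := hC.succ _ h
  rw [W.rev_rev] at h1
  exact hx ⟨e, he, h1.symm⟩

lemma On.congr {x y : D} (h : W.On C x) (hxy : W.rot.SameCycle x y) : W.On C y := by
  obtain ⟨e, he, h1⟩ := h
  exact ⟨e, he, h1.trans hxy⟩

lemma face_rot_inv (x z : D) (h : W.rot z = x) : W.face (W.rev x) = W.face z := by
  rw [← h, face_rev_rot]

variable [Finite D]

/-- The successor map of `C` is onto by `pred`, hence one-to-one since `C` is finite. -/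
lemma IsCycle.head_inj (hC : W.IsCycle C) {d d' : D} (hd : d ∈ C) (hd' : d' ∈ C)
    (h : W.rot.SameCycle (W.rev d) (W.rev d')) : d = d' := by
  choose! s hs using hC.succ
  let f : C → C := fun x => ⟨s x, (hs x x.2).1⟩
  have hf : Function.Surjective f := by
    rintro ⟨e, he⟩
    obtain ⟨d, hd, hde⟩ := hC.pred he
    exact ⟨⟨d, hd⟩, Subtype.ext (hC.tail_inj _ (hs d hd).1 _ he ((hs d hd).2.1.symm.trans hde))⟩
  have hi := Finite.injective_iff_surjective.mpr hf
  have : f ⟨d, hd⟩ = f ⟨d', hd'⟩ := Subtype.ext (hC.tail_inj _ (hs d hd).1 _ (hs d' hd').1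
    ((hs d hd).2.1.symm.trans (h.trans (hs d' hd').2.1)))
  exact congrArg Subtype.val (hi this)

/-- Turning around the common vertex from the outgoing dart `e` to the incoming `rev d`, or from
there back to `e`, crosses only edges off the curve, where `H` does not jump. -/
lemma IsCycle.sides (hC : W.IsCycle C) {H : Set F}
    (hH : ∀ d, d ∉ C → W.rev d ∉ C → (W.face d ∈ H ↔ W.face (W.rev d) ∈ H)) {d e : D}
    (hd : d ∈ C) (he : e ∈ C) (hde : W.rot.SameCycle (W.rev d) e) :
    (W.face d ∈ H ↔ W.face e ∈ H) ∧ (W.face (W.rev d) ∈ H ↔ W.face (W.rev e) ∈ H) := by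
  have hne : e ≠ W.rev d := fun h => hC.rev_notMem hd (h ▸ he)
  have key : ∀ z, W.rot z ≠ e → W.rot z ≠ W.rev d → W.rot.SameCycle e z →
      (W.face (W.rot z) ∈ H ↔ W.face z ∈ H) := by
    intro z h1 h2 h3
    have h4 : W.rot.SameCycle e (W.rot z) := h3.apply_right
    rw [hH _ (fun h => h1 (hC.tail_inj _ h _ he h4.symm)) (fun h => h2 ?_), face_rev_rot]
    rw [← W.rev_rev (W.rot z)]
    congr 1
    refine hC.head_inj h hd ?_
    rw [W.rev_rev]
    exact h4.symm.trans hde.symm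
  constructor
  · have h := iff_of_walk hde.symm hne (fun z => W.face z ∈ H) key
      (z := W.rot.symm (W.rev d)) (by simp)
    rw [h, ← face_rot_inv _ _ (W.rot.apply_symm_apply (W.rev d)), W.rev_rev]
  · have h := iff_of_walk hde hne.symm (fun z => W.face z ∈ H)
      (fun z h1 h2 h3 => key z h2 h1 (hde.symm.trans h3)) (z := W.rot.symm e) (by simp)
    rw [h, ← face_rot_inv _ _ (W.rot.apply_symm_apply e)]

lemma IsCycle.sides_const (hC : W.IsCycle C) {H : Set F}
    (hH : ∀ d, d ∉ C → W.rev d ∉ C → (W.face d ∈ H ↔ W.face (W.rev d) ∈ H)) {d e : D}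
    (hd : d ∈ C) (he : e ∈ C) :
    (W.face d ∈ H ↔ W.face e ∈ H) ∧ (W.face (W.rev d) ∈ H ↔ W.face (W.rev e) ∈ H) := by
  have h := hC.conn {e | e ∈ C ∧ ((W.face d ∈ H ↔ W.face e ∈ H) ∧
    (W.face (W.rev d) ∈ H ↔ W.face (W.rev e) ∈ H))} (fun e h => h.1) ⟨d, hd, Iff.rfl, Iff.rfl⟩ ?_
  · exact (h.ge he).2
  · rintro x ⟨hx, h1, h2⟩ y hy hxy
    have := hC.sides hH hx hy hxy
    exact ⟨hy, h1.trans this.1, h2.trans this.2⟩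

/-- The Jordan curve theorem. -/
theorem IsCycle.exists_inner (hC : W.IsCycle C) :
    ∃ Ω, W.IsInner C Ω ∨ W.IsInner {d | W.rev d ∈ C} Ω := by
  classical
  have := Fintype.ofFinite D
  -- The curve as a one-chain. Its boundary vanishes because the successor map permutes its darts,
  -- so it is the jump of a potential `u`.
  let c : D → ℝ := fun d => (if d ∈ C then 1 else 0) - (if W.rev d ∈ C then 1 else 0)
  obtain ⟨u, hu⟩ := W.exists_potential c (fun d => by simp [c, W.rev_rev]) (by
    intro g
    choose! s hs using hC.succ
    let f : C → C := fun x => ⟨s x, (hs x x.2).1⟩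
    have hf : Function.Injective f := by
      rintro ⟨d, hd⟩ ⟨d', hd'⟩ h
      have h' := congrArg Subtype.val h
      change s d = s d' at h'
      refine Subtype.ext (hC.head_inj hd hd' ((hs d hd).2.1.trans ?_))
      rw [h']
      exact (hs d' hd').2.1.symm
    have hf' := Finite.injective_iff_bijective.mp hf
    have h0 : ∑ d : C, (g (W.vert (W.rev d)) - g (W.vert d)) = 0 := by
      rw [Finset.sum_sub_distrib, sub_eq_zero,
        ← Equiv.sum_comp (Equiv.ofBijective f hf') (fun d : C => g (W.vert d))]
      refine Finset.sum_congr rfl fun d _ => ?_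
      congr 1
      rw [vert_eq_iff]
      exact (hs d d.2).2.1
    have h1 : ∑ d, (if d ∈ C then 1 else 0) * (g (W.vert (W.rev d)) - g (W.vert d)) = 0 := by
      simp only [ite_mul, one_mul, zero_mul]
      rw [← Finset.sum_filter, ← h0]
      exact (Finset.sum_subtype _ (by simp) _)
    have h2 : ∑ d, (if W.rev d ∈ C then 1 else 0) * (g (W.vert (W.rev d)) - g (W.vert d)) = 0 := by
      rw [← Equiv.sum_comp W.rev]
      simp only [W.rev_rev]
      rw [← neg_eq_zero, ← Finset.sum_neg_distrib]
      refine Eq.trans (Finset.sum_congr rfl fun d _ => ?_) h1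
      ring
    simp only [c, sub_mul, Finset.sum_sub_distrib, h1, h2, sub_zero])
  obtain ⟨d₀, hd₀⟩ := hC.nonempty
  have hoff : ∀ d, d ∉ C → W.rev d ∉ C → u (W.face d) = u (W.face (W.rev d)) := by
    intro d h1 h2
    have := hu d
    simp only [c, if_neg h1, if_neg h2] at this
    linarith
  -- The level set of `u` that contains the left side of the curve; across the curve `u` drops by
  -- one.
  set Ω : Set F := {r | u r = u (W.face d₀)} with hΩ
  have hoff' : ∀ d, d ∉ C → W.rev d ∉ C → (W.face d ∈ Ω ↔ W.face (W.rev d) ∈ Ω) := by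
    intro d h1 h2
    simp only [hΩ, Set.mem_ofPred_eq, hoff d h1 h2]
  have hl : ∀ d ∈ C, W.face d ∈ Ω := fun d hd =>
    ((hC.sides_const hoff' hd₀ hd).1).mp rfl
  have hr : ∀ d ∈ C, W.face (W.rev d) ∉ Ω := by
    intro d hd h
    have h1 := hu d
    have h2 : u (W.face d) = u (W.face d₀) := hl d hd
    have h3 : u (W.face (W.rev d)) = u (W.face d₀) := h
    simp only [c, if_pos hd, if_neg (hC.rev_notMem hd)] at h1
    linarith
  -- If the base region lies on the left, the curve runs clockwise, and the complement of `Ω` is the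
  -- inside of the reversed curve.
  by_cases ho : W.outer ∈ Ω
  · refine ⟨Ωᶜ, Or.inr ⟨fun h => h ho, fun d hd => ?_, fun d hd h => h (hl _ hd), fun d h1 h2 => ?_⟩⟩
    · have := hr _ hd
      rwa [W.rev_rev] at this
    · have h1 : W.rev d ∉ C := h1
      have h2 : W.rev (W.rev d) ∉ C := h2
      rw [W.rev_rev] at h2
      rw [Set.mem_compl_iff, Set.mem_compl_iff, hoff' d h2 h1]
  · exact ⟨Ω, Or.inl ⟨ho, hl, hr, hoff'⟩⟩

/-- A curve inside another curve encloses less. -/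
lemma IsInner.subset (hC : W.IsCycle C) (hΩ : W.IsInner C Ω) {C' : Set D} {Ω' : Set F}
    (hΩ' : W.IsInner C' Ω') (h : ∀ d ∈ C', W.face d ∈ Ω ∨ W.face (W.rev d) ∈ Ω) : Ω' ⊆ Ω := by
  -- Off `C` the set `H` does not jump: an edge there has both sides in `Ω`, or neither, and in the
  -- latter case it is not an edge of `C'`.
  set H : Set F := Ω' \ Ω with hH
  have hoff : ∀ d, d ∉ C → W.rev d ∉ C → (W.face d ∈ Ω ∨ W.face (W.rev d) ∈ Ω) ∨
      ((W.face d ∉ Ω ∧ W.face (W.rev d) ∉ Ω) ∧ (W.face d ∈ Ω' ↔ W.face (W.rev d) ∈ Ω')) := by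
    intro d h1 h2
    by_cases h3 : W.face d ∈ Ω ∨ W.face (W.rev d) ∈ Ω
    · exact Or.inl h3
    · push Not at h3
      refine Or.inr ⟨h3, hΩ'.off d (fun h4 => ?_) (fun h4 => ?_)⟩
      · have := h d h4; tauto
      · have := h _ h4
        rw [W.rev_rev] at this
        tauto
  have hHoff : ∀ d, d ∉ C → W.rev d ∉ C → (W.face d ∈ H ↔ W.face (W.rev d) ∈ H) := by
    intro d h1 h2
    have h3 := hoff d h1 h2
    have h4 := hΩ.off d h1 h2
    simp only [hH, Set.mem_sdiff]
    tauto
  obtain ⟨d₀, hd₀⟩ := hC.nonempty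
  have hleft : ∀ d ∈ C, W.face d ∉ H := fun d hd h => h.2 (hΩ.left d hd)
  have hjump : ∀ G : Set F, (∀ d, d ∉ C → W.rev d ∉ C → (W.face d ∈ G ↔ W.face (W.rev d) ∈ G)) →
      (∀ d ∈ C, (W.face d ∈ G ↔ W.face (W.rev d) ∈ G)) → W.outer ∉ G → G = ∅ := by
    intro G h1 h2 h3
    by_contra h4
    obtain ⟨r, hr⟩ := Set.nonempty_iff_ne_empty.mpr h4
    have := W.const_of_no_jump (fun r => r ∈ G) (fun d => propext ?_) r W.outer
    · exact h3 (this ▸ hr)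
    · by_cases h5 : d ∈ C
      · exact h2 d h5
      · by_cases h6 : W.rev d ∈ C
        · have := h2 _ h6
          rw [W.rev_rev] at this
          exact this.symm
        · exact h1 d h5 h6
  have hHempty : H = ∅ := by
    -- The left sides of `C` are not in `H`. If the right sides are, then `H ∪ Ω` has no jump at
    -- all; otherwise `H` has none. A set of regions without jumps that omits the base region is
    -- empty.
    by_cases h5 : W.face (W.rev d₀) ∈ H
    · have : H ∪ Ω = ∅ := by
        refine hjump _ (fun d h1 h2 => ?_) (fun d hd => ?_) ?_
        · have := hHoff d h1 h2
          have := hΩ.off d h1 h2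
          simp only [Set.mem_union]
          tauto
        · exact iff_of_true (Or.inr (hΩ.left d hd))
            (Or.inl (((hC.sides_const hHoff hd₀ hd).2).mp h5))
        · rintro (h | h)
          exacts [hΩ'.outer h.1, hΩ.outer h]
      rw [Set.union_empty_iff] at this
      exact this.1
    · refine hjump _ hHoff (fun d hd => iff_of_false (hleft d hd) fun h => h5 ?_)
        fun h => hΩ'.outer h.1
      exact ((hC.sides_const hHoff hd₀ hd).2).mpr h
  exact Set.sdiff_eq_empty.mp hHempty

lemma IsInner.ssubset (hC : W.IsCycle C) (hΩ : W.IsInner C Ω) {C' : Set D} {Ω' : Set F}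
    (hΩ' : W.IsInner C' Ω') (h : ∀ d ∈ C', W.face d ∈ Ω ∨ W.face (W.rev d) ∈ Ω)
    (h' : ∃ d ∈ C', W.Ins Ω d) : Ω' ⊂ Ω := by
  refine (hΩ.subset hC hΩ' h).ssubset_of_ne ?_
  rintro rfl
  obtain ⟨d, hd, h1⟩ := h'
  exact hΩ'.right d hd h1.2

/-- At a vertex off the curve the rotation never crosses the curve. -/
lemma IsInner.face_iff (hC : W.IsCycle C) (hΩ : W.IsInner C Ω) {x y : D} (hx : ¬ W.On C x)
    (hxy : W.rot.SameCycle x y) : W.face x ∈ Ω ↔ W.face y ∈ Ω := by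
  refine (sameCycle_induction hxy (fun y => (W.face x ∈ Ω ↔ W.face y ∈ Ω) ∧ ¬ W.On C y)
    ⟨Iff.rfl, hx⟩ ?_).1
  rintro z ⟨h1, h2⟩
  have h3 : ¬ W.On C (W.rot z) := fun h => h2 (h.congr (Equiv.Perm.SameCycle.refl _ _).apply_left)
  refine ⟨?_, h3⟩
  obtain ⟨h4, h5⟩ := not_on_mem hC h3
  rw [h1, hΩ.off _ h4 h5, face_rev_rot]

/-- The sector on the left of the outgoing dart `e` is inside, so the dart that ends this sector
enters the inside unless it is the incoming dart of the curve. This is where strands inside a curve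
start. -/
lemma IsInner.ins_rot (hC : W.IsCycle C) (hΩ : W.IsInner C Ω) {d e : D} (hd : d ∈ C) (he : e ∈ C)
    (hde : W.rot.SameCycle (W.rev d) e) (h : W.rot e ≠ W.rev d) : W.Ins Ω (W.rot e) := by
  have h2 : W.face (W.rev (W.rot e)) ∈ Ω := by
    rw [face_rev_rot]
    exact hΩ.left e he
  refine ⟨(hΩ.off _ (fun h3 => ?_) (fun h3 => h ?_)).mpr h2, h2⟩
  · have := hΩ.right _ h3
    contradiction
  · rw [← W.rev_rev (W.rot e)]
    congr 1
    refine hC.head_inj h3 hd ?_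
    rw [W.rev_rev]
    exact (Equiv.Perm.SameCycle.refl _ _).apply_left.trans hde.symm

end

section

variable {D F : Type*}

/-! ### The vertices of a web -/

/-- The vertex of `d` is an interior vertex of valence four. -/
def IsT (W : Web D F) (d : D) : Prop :=
  ¬ W.bdry d ∧ W.rot (W.rot (W.rot (W.rot d))) = d ∧ W.rot (W.rot d) ≠ d

/-- The vertex of `d` is the interior marker of a loop. -/
def IsL (W : Web D F) (d : D) : Prop := ¬ W.bdry d ∧ IsLoopVertex W.rot W.rev d

/-- Strands pass through the vertex of `d`. -/
def Pass (W : Web D F) (d : D) : Prop := W.IsT d ∨ W.IsL d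

open Classical in
/-- The dart opposite to `d` at its vertex. -/
noncomputable def opp (W : Web D F) (d : D) : D :=
  if W.IsT d then W.rot (W.rot d) else if W.IsL d then W.rot d else d

/-- The next dart of the strand along `d`. -/
noncomputable def nxt (W : Web D F) (d : D) : D := W.opp (W.rev d)

variable {W : Web D F}

lemma same_rot (x : D) : W.rot.SameCycle x (W.rot x) :=
  (Equiv.Perm.SameCycle.refl _ _).apply_right

lemma bdry_congr {d e : D} (h : W.rot.SameCycle d e) : W.bdry d ↔ W.bdry e :=
  ⟨fun hd => (W.bdry_cycle d hd e).mpr h, fun he => (W.bdry_cycle e he d).mpr h.symm⟩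

lemma IsT.rot {d : D} (h : W.IsT d) : W.IsT (W.rot d) := by
  obtain ⟨h1, h2, h3⟩ := h
  exact ⟨fun h => h1 ((bdry_congr (same_rot d)).mpr h), by rw [h2],
    fun h => h3 (W.rot.injective h)⟩

lemma IsL.ne_T {d : D} (h : W.IsL d) : ¬ W.IsT d := by
  rintro ⟨_, _, h3⟩
  rw [h.2.1, h.2.2] at h3
  exact h3 rfl

lemma IsL.rot {d : D} (h : W.IsL d) : W.IsL (W.rot d) := by
  refine ⟨fun h' => h.1 ((bdry_congr (same_rot d)).mpr h'), ?_, ?_⟩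
  · rw [h.2.1, h.2.2, W.rev_rev]
  · rw [h.2.1, W.rev_rev, h.2.1]

lemma IsL.rev {d : D} (h : W.IsL d) : W.IsL (W.rev d) := h.2.1 ▸ h.rot

lemma opp_of_isT {d : D} (h : W.IsT d) : W.opp d = W.rot (W.rot d) := if_pos h

lemma opp_of_isL {d : D} (h : W.IsL d) : W.opp d = W.rev d := by
  rw [opp, if_neg h.ne_T, if_pos h, h.2.1]

lemma opp_of_not_pass {d : D} (h : ¬ W.Pass d) : W.opp d = d := by
  rw [opp, if_neg fun h' => h (Or.inl h'), if_neg fun h' => h (Or.inr h')]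

/-- The default value `opp d = d` where strands stop makes `opp` an involution everywhere, so that
strands can be read backwards without case distinctions. -/
lemma opp_opp (d : D) : W.opp (W.opp d) = d := by
  by_cases h : W.Pass d
  · rcases h with h | h
    · rw [opp_of_isT h, opp_of_isT h.rot.rot, h.2.1]
    · rw [opp_of_isL h, opp_of_isL h.rev, W.rev_rev]
  · rw [opp_of_not_pass h, opp_of_not_pass h]

lemma same_opp (d : D) : W.rot.SameCycle d (W.opp d) := by
  by_cases h : W.Pass d
  · rcases h with h | h
    · rw [opp_of_isT h]; exact (same_rot d).trans (same_rot _)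
    · rw [opp_of_isL h, ← h.2.1]; exact same_rot d
  · rw [opp_of_not_pass h]

lemma Pass.opp {d : D} (h : W.Pass d) : W.Pass (W.opp d) := by
  rcases h with h | h
  · rw [opp_of_isT h]; exact Or.inl h.rot.rot
  · rw [opp_of_isL h]; exact Or.inr h.rev

lemma Pass.not_bdry {d : D} (h : W.Pass d) : ¬ W.bdry d := h.elim (·.1) (·.1)

lemma Pass.opp_ne {d : D} (h : W.Pass d) : W.opp d ≠ d := by
  rcases h with h | h
  · rw [opp_of_isT h]; exact h.2.2
  · rw [opp_of_isL h]; exact W.rev_ne d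

lemma same_nxt (d : D) : W.rot.SameCycle (W.rev d) (W.nxt d) := same_opp _

lemma nxt_rev_nxt (d : D) : W.nxt (W.rev (W.nxt d)) = W.rev d := by
  rw [nxt, W.rev_rev, nxt, opp_opp]

lemma nxt_ne_rev {d : D} (h : W.Pass (W.rev d)) : W.nxt d ≠ W.rev d := h.opp_ne

lemma nxt_of_isL {d : D} (h : W.IsL (W.rev d)) : W.nxt d = d := by
  rw [nxt, opp_of_isL h, W.rev_rev]

lemma nxt_iterate_rev (d : D) (m : ℕ) : W.nxt^[m] (W.rev (W.nxt^[m] d)) = W.rev d := by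
  induction m with
  | zero => rfl
  | succ m ih => rw [Function.iterate_succ_apply, Function.iterate_succ_apply', nxt_rev_nxt, ih]

lemma nxt_iterate_rev_of_le (d : D) {m j : ℕ} (h : j ≤ m) :
    W.nxt^[j] (W.rev (W.nxt^[m] d)) = W.rev (W.nxt^[m - j] d) := by
  have := nxt_iterate_rev (W := W) (W.nxt^[m - j] d) j
  rwa [← Function.iterate_add_apply, Nat.add_sub_cancel' h] at this

variable [Finite D]

lemma IsT.congr {d e : D} (h : W.IsT d) (hde : W.rot.SameCycle d e) : W.IsT e :=
  sameCycle_induction hde _ h fun _ h => h.rot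

lemma IsL.congr {d e : D} (h : W.IsL d) (hde : W.rot.SameCycle d e) : W.IsL e :=
  sameCycle_induction hde _ h fun _ h => h.rot

lemma Pass.congr {d e : D} (h : W.Pass d) (hde : W.rot.SameCycle d e) : W.Pass e :=
  h.imp (·.congr hde) (·.congr hde)

lemma IsT.cases {d e : D} (h : W.IsT d) (hde : W.rot.SameCycle d e) :
    e = d ∨ e = W.rot d ∨ e = W.rot (W.rot d) ∨ e = W.rot (W.rot (W.rot d)) := by
  refine sameCycle_induction hde (fun e => e = d ∨ e = W.rot d ∨ e = W.rot (W.rot d) ∨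
    e = W.rot (W.rot (W.rot d))) (Or.inl rfl) ?_
  rintro z (rfl | rfl | rfl | rfl)
  · simp
  · simp
  · simp
  · exact Or.inl h.2.1

lemma IsL.cases {d e : D} (h : W.IsL d) (hde : W.rot.SameCycle d e) : e = d ∨ e = W.rev d := by
  refine sameCycle_induction hde (fun e => e = d ∨ e = W.rev d) (Or.inl rfl) ?_
  rintro z (rfl | rfl)
  · exact Or.inr h.2.1
  · exact Or.inl h.2.2

/-- The axiom `vertex` supplies the directions, so the order of the rotation alone tells tetravalent
vertices from loop markers and trivalent vertices. -/
lemma isTetravalent_iff {d : D} (hd : ¬ W.bdry d) :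
    IsTetravalent W.rot W.dbl W.out d ↔ W.IsT d := by
  constructor
  · rintro ⟨e, h1, h2, h3, _⟩
    have he : W.IsT e := ⟨fun h => hd ((bdry_congr h1).mp h), h2, h3⟩
    exact he.congr h1
  · intro h
    rcases W.vertex d hd with h1 | h1 | ⟨e, h1, h2, _⟩
    · exact absurd h (IsL.ne_T ⟨hd, h1⟩)
    · exact h1
    · have he := h.congr h1.symm
      have h3 := he.2.1
      rw [h2] at h3
      have := he.2.2
      rw [h3] at this
      exact absurd h3 this

lemma step_iff {d e : D} : W.Step d e ↔ W.Pass (W.rev d) ∧ e = W.nxt d := by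
  constructor
  · rintro (⟨h1, h2, rfl⟩ | ⟨h1, h2, rfl⟩)
    · rw [isTetravalent_iff h2] at h1
      exact ⟨Or.inl h1, (opp_of_isT h1).symm⟩
    · have h3 : W.IsL (W.rev d) := ⟨h2, h1⟩
      refine ⟨Or.inr h3, ?_⟩
      rw [nxt, opp_of_isL h3, h3.2.1]
  · rintro ⟨h1 | h1, rfl⟩
    · exact Or.inl ⟨(isTetravalent_iff h1.1).mpr h1, h1.1, opp_of_isT h1⟩
    · refine Or.inr ⟨h1.2, h1.1, ?_⟩
      rw [nxt, opp_of_isL h1, h1.2.1]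

lemma IsT.not_dbl {d : D} (h : W.IsT d) : ¬ W.dbl d := by
  obtain ⟨e, h1, -, -, h2, -⟩ := (isTetravalent_iff h.1).mpr h
  exact h2 d h1

/-- The contracted double edge separated either `d, rot d` or `rot d, rot (rot d)` from the other
two darts. In particular, directions never alternate around the vertex. -/
lemma IsT.pattern {d : D} (h : W.IsT d) :
    ((W.out d ↔ W.out (W.rot d)) ∧
      (W.out (W.rot (W.rot d)) ↔ W.out (W.rot (W.rot (W.rot d))))) ∨
    ((W.out (W.rot d) ↔ W.out (W.rot (W.rot d))) ∧
      (W.out (W.rot (W.rot (W.rot d))) ↔ W.out d)) := by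
  obtain ⟨e, h1, h0, -, -, h2, h3⟩ := (isTetravalent_iff h.1).mpr h
  rcases (h.congr h1.symm).cases h1 with rfl | rfl | rfl | rfl
  · exact Or.inl ⟨h2, h3⟩
  · rw [h0]; exact Or.inr ⟨h3, h2⟩
  · rw [h0]; exact Or.inl ⟨h3, h2⟩
  · rw [h0]; exact Or.inr ⟨h2, h3⟩

lemma isTrivalent_of_not_pass {d : D} (hd : ¬ W.bdry d) (h : ¬ W.Pass d) :
    ∃ e, W.rot.SameCycle e d ∧ W.rot (W.rot (W.rot e)) = e ∧ W.dbl e ∧ W.bdry (W.rev e) ∧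
      ¬ W.dbl (W.rot e) ∧ ¬ W.dbl (W.rot (W.rot e)) ∧
      (W.out (W.rot e) ↔ W.out (W.rot (W.rot e))) ∧
      ∀ x, W.rot.SameCycle x d → x = e ∨ x = W.rot e ∨ x = W.rot (W.rot e) := by
  rcases W.vertex d hd with h1 | h1 | ⟨e, h1, h2, h3, h4, h5, h6, h7⟩
  · exact absurd (Or.inr ⟨hd, h1⟩) h
  · exact absurd (Or.inl ((isTetravalent_iff hd).mp h1)) h
  · refine ⟨e, h1, h2, h3, h4, h5, h6, h7, fun x hx => ?_⟩
    refine sameCycle_induction (h1.trans hx.symm)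
      (fun x => x = e ∨ x = W.rot e ∨ x = W.rot (W.rot e)) (Or.inl rfl) ?_
    rintro z (rfl | rfl | rfl)
    · simp
    · simp
    · exact Or.inl h2

lemma dbl_nxt {d : D} (h : W.Pass (W.rev d)) : W.dbl (W.nxt d) ↔ W.dbl d := by
  rcases h with h | h
  · refine iff_of_false (h.congr (same_nxt d)).not_dbl ?_
    rw [← W.dbl_rev]
    exact h.not_dbl
  · rw [nxt_of_isL h]

/-! ### Crossings -/

omit [Finite D] in
lemma Cross.same {d e : D} (h : W.Cross d e) : W.rot.SameCycle d e := by
  rcases h.1 with h | h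
  · exact h ▸ same_rot d
  · exact (h ▸ same_rot e : W.rot.SameCycle e d).symm

lemma isT_cross {d : D} (h : W.IsT d) : W.Cross d (W.rot d) :=
  ⟨Or.inl rfl, h.1, h.not_dbl, h.rot.not_dbl, h.2.2⟩

omit [Finite D] in
lemma Cross.isT_or {d e : D} (h : W.Cross d e) : W.IsT d ∨ ¬ W.Pass d := by
  by_cases h1 : W.IsT d
  · exact Or.inl h1
  · refine Or.inr ?_
    rintro (h2 | h2)
    · exact h1 h2
    · apply h.2.2.2.2
      rw [h2.2.1, h2.2.2]

lemma cross_of_not_pass {d e : D} (hd : ¬ W.bdry d) (h : ¬ W.Pass d) (hde : W.rot.SameCycle d e)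
    (hne : d ≠ e) (h1 : ¬ W.dbl d) (h2 : ¬ W.dbl e) : W.Cross d e := by
  obtain ⟨z, h3, h4, h5, h6, h7, h8, -, h9⟩ := isTrivalent_of_not_pass hd h
  have hz : W.rot z ≠ z := fun h => h7 (h.symm ▸ h5)
  have hz2 : W.rot (W.rot z) ≠ z := fun h => h8 (h.symm ▸ h5)
  rcases h9 d (Equiv.Perm.SameCycle.refl _ _) with rfl | rfl | rfl
  · exact absurd h5 h1
  · refine ⟨?_, hd, h1, h2, ?_⟩
    · rcases h9 e hde.symm with rfl | rfl | rfl
      · exact absurd h5 h2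
      · exact absurd rfl hne
      · exact Or.inl rfl
    · rw [h4]; exact hz.symm
  · refine ⟨?_, hd, h1, h2, ?_⟩
    · rcases h9 e hde.symm with rfl | rfl | rfl
      · exact absurd h5 h2
      · exact Or.inr rfl
      · exact absurd rfl hne
    · rw [h4]; exact fun h => hz (W.rot.injective h.symm)

omit [Finite D] in
lemma Cross.symm {d e : D} (h : W.Cross d e) : W.Cross e d := by
  refine ⟨h.1.symm, fun hb => h.2.1 ((bdry_congr h.same).mpr hb), h.2.2.2.1, h.2.2.1, ?_⟩
  rcases h.1 with rfl | rfl
  · exact fun h' => h.2.2.2.2 (W.rot.injective h')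
  · exact fun h' => h.2.2.2.2 (by rw [h'])

omit [Finite D] in
lemma Cross.ne {d e : D} (h : W.Cross d e) : d ≠ e := by
  rintro rfl
  rcases h.1 with h1 | h1 <;> exact h.2.2.2.2 (by rw [h1, h1])

omit [Finite D] in
lemma Cross.opp_ne {d e : D} (h : W.Cross d e) : W.opp d ≠ e := by
  rintro rfl
  rcases h.isT_or with h1 | h1
  · rw [opp_of_isT h1] at h
    rcases h.1 with h2 | h2
    · exact h1.2.2 (W.rot.injective (by rw [← h2, ← h2]))
    · have h3 := h1.2.1
      rw [h2] at h3
      exact h1.2.2 (by rw [h3, h3])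
  · rw [opp_of_not_pass h1] at h
    exact h.ne rfl

lemma cross_or_opp {d e : D} (h : W.IsT d) (hde : W.rot.SameCycle d e) (hne : d ≠ e) :
    W.Cross d e ∨ e = W.opp d := by
  rcases h.cases hde with rfl | rfl | rfl | rfl
  · exact absurd rfl hne
  · exact Or.inl (isT_cross h)
  · exact Or.inr (opp_of_isT h).symm
  · refine Or.inl ?_
    have := (isT_cross h.rot.rot.rot).symm
    rwa [h.2.1] at this

lemma Cross.opp_left {d e : D} (h : W.Cross d e) (hT : W.IsT d) : W.Cross (W.opp d) e := by
  rcases cross_or_opp (hT.congr (same_opp d)) ((same_opp d).symm.trans h.same) h.opp_ne with h1 | h1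
  · exact h1
  · rw [opp_opp] at h1
    exact absurd h1.symm h.ne

lemma Cross.opp_right {d e : D} (h : W.Cross d e) (hT : W.IsT d) : W.Cross d (W.opp e) :=
  (h.symm.opp_left (hT.congr h.same)).symm

lemma cross_or_opp_of_not_dbl {d e : D} (hd : ¬ W.bdry d) (hL : ¬ W.IsL d)
    (hde : W.rot.SameCycle d e) (hne : d ≠ e) (h1 : ¬ W.dbl d) (h2 : ¬ W.dbl e) :
    W.Cross d e ∨ (W.IsT d ∧ e = W.opp d) := by
  by_cases h : W.IsT d
  · exact (cross_or_opp h hde hne).imp_right fun h' => ⟨h, h'⟩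
  · exact Or.inl (cross_of_not_pass hd (fun h' => h'.elim h hL) hde hne h1 h2)

/-! ### Paths along strands -/

/-- The strand that starts with the dart `d` has at least `m` more darts. -/
def IsPath (W : Web D F) (d : D) (m : ℕ) : Prop := ∀ i < m, W.Pass (W.rev (W.nxt^[i] d))

omit [Finite D] in
lemma IsPath.mono {d : D} {m k : ℕ} (h : W.IsPath d m) (hk : k ≤ m) : W.IsPath d k :=
  fun i hi => h i (by omega)

omit [Finite D] in
lemma IsPath.shift {d : D} {m : ℕ} (h : W.IsPath d m) (i k : ℕ) (hk : i + k ≤ m) :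
    W.IsPath (W.nxt^[i] d) k := by
  intro j hj
  rw [← Function.iterate_add_apply]
  exact h _ (by omega)

omit [Finite D] in
lemma IsPath.append {d : D} {m k : ℕ} (h : W.IsPath d m) (h' : W.IsPath (W.nxt^[m] d) k) :
    W.IsPath d (m + k) := by
  intro i hi
  by_cases him : i < m
  · exact h i him
  · have := h' (i - m) (by omega)
    rwa [← Function.iterate_add_apply, Nat.sub_add_cancel (by omega)] at this

lemma IsPath.pass {d : D} {m i : ℕ} (h : W.IsPath d m) (hi : 0 < i) (him : i ≤ m) :
    W.Pass (W.nxt^[i] d) := by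
  obtain ⟨i, rfl⟩ := Nat.exists_eq_add_of_le' hi
  rw [Function.iterate_succ_apply']
  exact (h i (by omega)).congr (same_nxt _)

lemma IsPath.rev {d : D} {m : ℕ} (h : W.IsPath d m) : W.IsPath (W.rev (W.nxt^[m] d)) m := by
  intro i hi
  rw [nxt_iterate_rev_of_le d hi.le, W.rev_rev]
  exact h.pass (by omega) (by omega)

-- Dart number `i` ends at the vertex of `nxt^[i + 1] d` even if the strand stops there. Hence a
-- path with darts `0, …, m` has vertices `0, …, m + 1`.
omit [Finite D] in
lemma same_rev_iterate (d : D) (i : ℕ) :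
    W.rot.SameCycle (W.rev (W.nxt^[i] d)) (W.nxt^[i + 1] d) := by
  rw [Function.iterate_succ_apply']
  exact same_nxt _

lemma IsPath.not_dbl {d : D} {m : ℕ} (h : W.IsPath d m) (hd : ¬ W.dbl d) {i : ℕ} (hi : i ≤ m) :
    ¬ W.dbl (W.nxt^[i] d) := by
  induction i with
  | zero => exact hd
  | succ i ih =>
    rw [Function.iterate_succ_apply', dbl_nxt (h i (by omega))]
    exact ih (by omega)

lemma seg_iff {d e : D} : W.Seg d e ↔ ∃ m, W.IsPath d m ∧ W.nxt^[m] d = e := by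
  constructor
  · intro h
    induction h with
    | refl => exact ⟨0, fun i hi => absurd hi (by omega), rfl⟩
    | tail _ hst ih =>
      obtain ⟨m, hm, rfl⟩ := ih
      obtain ⟨h1, rfl⟩ := step_iff.mp hst
      refine ⟨m + 1, fun i hi => ?_, Function.iterate_succ_apply' _ _ _⟩
      rcases Nat.lt_succ_iff_lt_or_eq.mp hi with h | rfl
      exacts [hm i h, h1]
  · rintro ⟨m, hm, rfl⟩
    induction m with
    | zero => exact Relation.ReflTransGen.refl
    | succ m ih =>
      refine (ih (hm.mono (by omega))).tail (step_iff.mpr ⟨hm m (by omega), ?_⟩)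
      exact Function.iterate_succ_apply' _ _ _

end

section

variable {D F : Type*}

/-! ### Polygons formed by strands -/

/-- A simple closed curve with `n` sides: side `i` is the strand that starts with the dart `a i`
and has `m i` more darts.  If `n = 1`, the strand may also close up smoothly. -/
structure IsPoly (W : Web D F) (n : ℕ) [NeZero n] (a : Fin n → D) (m : Fin n → ℕ) : Prop where
  path : ∀ i, W.IsPath (a i) (m i)
  head : ∀ i, W.rot.SameCycle (W.nxt^[m i + 1] (a i)) (a (i + 1))
  inj : ∀ i i' j j', j ≤ m i → j' ≤ m i' →
    W.rot.SameCycle (W.nxt^[j] (a i)) (W.nxt^[j'] (a i')) → i = i' ∧ j = j'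
  corner : n ≠ 1 → ∀ i, W.Cross (a (i + 1)) (W.rev (W.nxt^[m i] (a i)))
  not_bdry : ∀ i, ¬ W.bdry (a i)

/-- The darts of a polygon. -/
def darts (W : Web D F) {n : ℕ} (a : Fin n → D) (m : Fin n → ℕ) : Set D :=
  {d | ∃ i j, j ≤ m i ∧ d = W.nxt^[j] (a i)}

/-- The sides of the polygon form a directed cycle. -/
def Cyc (W : Web D F) {n : ℕ} (a : Fin n → D) (m : Fin n → ℕ) : Prop :=
  (∀ i j, j ≤ m i → W.out (W.nxt^[j] (a i))) ∨ (∀ i j, j ≤ m i → ¬ W.out (W.nxt^[j] (a i)))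

/-- The curve is a polygon with at most two sides. -/
def IsSmall (W : Web D F) (C : Set D) : Prop :=
  (∃ (a : Fin 1 → D) (m : Fin 1 → ℕ), W.IsPoly 1 a m ∧ C = W.darts a m) ∨
    (∃ (a : Fin 2 → D) (m : Fin 2 → ℕ), W.IsPoly 2 a m ∧ C = W.darts a m)

/-- The curve is a polygon with at most two sides, or a triangle that is not a directed cycle. -/
def IsBad (W : Web D F) (C : Set D) : Prop :=
  W.IsSmall C ∨ ∃ (a : Fin 3 → D) (m : Fin 3 → ℕ), W.IsPoly 3 a m ∧ ¬ W.Cyc a m ∧ C = W.darts a m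

variable {W : Web D F}

lemma mem_darts {n : ℕ} {a : Fin n → D} {m : Fin n → ℕ} {i : Fin n} {j : ℕ} (h : j ≤ m i) :
    W.nxt^[j] (a i) ∈ W.darts a m := ⟨i, j, h, rfl⟩

lemma mem_darts_zero {n : ℕ} {a : Fin n → D} {m : Fin n → ℕ} (i : Fin n) :
    a i ∈ W.darts a m := ⟨i, 0, Nat.zero_le _, rfl⟩

variable [Finite D]

omit [Finite D] in
open Fin.NatCast Fin.CommRing in
lemma IsPoly.isCycle {n : ℕ} [NeZero n] {a : Fin n → D} {m : Fin n → ℕ} (h : W.IsPoly n a m) :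
    W.IsCycle (W.darts a m) where
  nonempty := ⟨a 0, mem_darts_zero 0⟩
  succ := by
    rintro _ ⟨i, j, hj, rfl⟩
    rcases hj.lt_or_eq with hj | rfl
    · refine ⟨W.nxt^[j + 1] (a i), mem_darts hj, same_rev_iterate _ _, ?_⟩
      rw [Function.iterate_succ_apply']
      exact nxt_ne_rev (h.path i j hj)
    · refine ⟨a (i + 1), mem_darts_zero _, (same_rev_iterate _ _).trans (h.head i), ?_⟩
      -- A polygon with one side has no corner condition; that it does not turn back along its first
      -- edge follows from the injectivity of its vertices.
      by_cases hn : n = 1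
      · subst hn
        obtain rfl : i = 0 := Subsingleton.elim _ _
        intro he
        simp only [Subsingleton.elim ((0 : Fin 1) + 1) 0] at he
        rcases Nat.eq_zero_or_pos (m 0) with h0 | h0
        · rw [h0] at he
          exact W.rev_ne _ he.symm
        · have h1 := nxt_iterate_rev_of_le (W := W) (a 0) h0
          rw [← he] at h1
          have h2 := h.inj 0 0 1 (m 0) h0 le_rfl (by
            rw [h1]
            have := same_rev_iterate (W := W) (a 0) (m 0 - 1)
            rwa [Nat.sub_add_cancel h0] at this)
          rw [← h2.2] at h1
          exact nxt_ne_rev (h.path 0 0 h0) h1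
      · exact (h.corner hn i).ne
  tail_inj := by
    rintro _ ⟨i, j, hj, rfl⟩ _ ⟨i', j', hj', rfl⟩ hs
    obtain ⟨rfl, rfl⟩ := h.inj i i' j j' hj hj' hs
    rfl
  conn := by
    rintro S hS ⟨_, hd⟩ hcl
    obtain ⟨i₀, j₀, hj₀, rfl⟩ := hS hd
    have hside : ∀ i j k, j + k ≤ m i → W.nxt^[j] (a i) ∈ S → W.nxt^[j + k] (a i) ∈ S := by
      intro i j k
      induction k with
      | zero => intro _ h; exact h
      | succ k ih =>
        intro hk hj
        exact hcl _ (ih (by omega) hj) _ (mem_darts (by omega)) (same_rev_iterate _ _)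
    have hnext : ∀ i j, j ≤ m i → W.nxt^[j] (a i) ∈ S → a (i + 1) ∈ S := by
      intro i j hj hm
      have := hside i j (m i - j) (by omega) hm
      rw [Nat.add_sub_cancel' hj] at this
      exact hcl _ this _ (mem_darts_zero _) ((same_rev_iterate _ _).trans (h.head i))
    have hall : ∀ k : ℕ, a (i₀ + 1 + (k : Fin n)) ∈ S := by
      intro k
      induction k with
      | zero => simpa using hnext i₀ j₀ hj₀ hd
      | succ k ih =>
        have := hnext _ 0 (Nat.zero_le _) ih
        rwa [add_assoc, ← Nat.cast_succ] at this
    refine Set.Subset.antisymm hS ?_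
    rintro _ ⟨i, j, hj, rfl⟩
    have := hall (i - (i₀ + 1)).val
    rw [Fin.cast_val_eq_self, add_sub_cancel] at this
    simpa using hside i 0 j (by omega) this

lemma IsPoly.reverse {n : ℕ} [NeZero n] {a : Fin n → D} {m : Fin n → ℕ} (h : W.IsPoly n a m) :
    W.IsPoly n (fun i => W.rev (W.nxt^[m (-i)] (a (-i)))) (fun i => m (-i)) := by
  have hneg : ∀ i : Fin n, -(i + 1) + 1 = -i := fun i => by rw [neg_add, neg_add_cancel_right]
  -- Vertex `j` of the reversed side is vertex `m - j + 1` of the old side `-i`, except that its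
  -- starting vertex is counted in the old polygon as the start of side `-i + 1`.
  have hv : ∀ (i : Fin n) (j : ℕ), j ≤ m (-i) → ∃ (i' : Fin n) (j' : ℕ),
      W.rot.SameCycle (W.nxt^[j] (W.rev (W.nxt^[m (-i)] (a (-i))))) (W.nxt^[j'] (a i')) ∧
      j' ≤ m i' ∧ ((j = 0 ∧ i' = -i + 1 ∧ j' = 0) ∨ (0 < j ∧ i' = -i ∧ j' = m (-i) - j + 1)) := by
    intro i j hj
    rw [nxt_iterate_rev_of_le _ hj]
    rcases Nat.eq_zero_or_pos j with rfl | h0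
    · exact ⟨-i + 1, 0, (same_rev_iterate _ _).trans (h.head _), Nat.zero_le _,
        Or.inl ⟨rfl, rfl, rfl⟩⟩
    · exact ⟨-i, m (-i) - j + 1, same_rev_iterate _ _, by omega, Or.inr ⟨h0, rfl, rfl⟩⟩
  refine ⟨fun i => (h.path _).rev, fun i => ?_, fun i i' j j' hj hj' hs => ?_, fun hn i => ?_,
    fun i => ?_⟩
  · have h1 := same_rev_iterate (W := W) (W.rev (W.nxt^[m (-i)] (a (-i)))) (m (-i))
    rw [nxt_iterate_rev, W.rev_rev] at h1
    refine h1.symm.trans ?_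
    have h2 := h.head (-(i + 1))
    rw [hneg] at h2
    exact h2.symm.trans (same_rev_iterate _ _).symm
  · obtain ⟨i₁, j₁, h1, h2, h3⟩ := hv i j hj
    obtain ⟨i₂, j₂, h4, h5, h6⟩ := hv i' j' hj'
    obtain ⟨rfl, rfl⟩ := h.inj _ _ _ _ h2 h5 (h1.symm.trans (hs.trans h4))
    rcases h3 with ⟨h3, h7, h8⟩ | ⟨h3, h7, h8⟩ <;> rcases h6 with ⟨h6, h9, h10⟩ | ⟨h6, h9, h10⟩
    · rw [h7] at h9
      exact ⟨neg_injective (add_right_cancel h9), by omega⟩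
    · omega
    · omega
    · obtain rfl : i = i' := neg_injective (h7.symm.trans h9)
      exact ⟨rfl, by omega⟩
  · have := h.corner hn (-(i + 1))
    rw [hneg] at this
    rw [nxt_iterate_rev, W.rev_rev]
    exact this.symm
  · have h1 := (same_rev_iterate (W := W) (a (-i)) _).trans (h.head (-i))
    exact fun hb => h.not_bdry _ ((bdry_congr h1).mp hb)

omit [Finite D] in
lemma darts_reverse {n : ℕ} [NeZero n] (a : Fin n → D) (m : Fin n → ℕ) :
    W.darts (fun i => W.rev (W.nxt^[m (-i)] (a (-i)))) (fun i => m (-i)) =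
      {d | W.rev d ∈ W.darts a m} := by
  ext d
  constructor
  · rintro ⟨i, j, hj, rfl⟩
    refine ⟨-i, m (-i) - j, by omega, ?_⟩
    rw [nxt_iterate_rev_of_le _ hj, W.rev_rev]
  · rintro ⟨i, j, hj, h⟩
    refine ⟨-i, m i - j, by simp, ?_⟩
    simp only [neg_neg]
    rw [nxt_iterate_rev_of_le _ (by omega), Nat.sub_sub_self hj, ← h, W.rev_rev]

lemma IsPoly.not_dbl {n : ℕ} [NeZero n] {a : Fin n → D} {m : Fin n → ℕ} (h : W.IsPoly n a m)
    (hn : n ≠ 1) {i : Fin n} {j : ℕ} (hj : j ≤ m i) : ¬ W.dbl (W.nxt^[j] (a i)) := by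
  refine (h.path i).not_dbl ?_ hj
  have := (h.corner hn (i - 1)).2.2.1
  rwa [sub_add_cancel] at this

lemma IsPoly.cyc_reverse {n : ℕ} [NeZero n] {a : Fin n → D} {m : Fin n → ℕ} (h : W.IsPoly n a m)
    (hn : n ≠ 1)
    (hc : W.Cyc (fun i => W.rev (W.nxt^[m (-i)] (a (-i)))) (fun i => m (-i))) : W.Cyc a m := by
  have key : ∀ i j, j ≤ m i → W.nxt^[m i - j] (W.rev (W.nxt^[m (- -i)] (a (- -i)))) =
      W.rev (W.nxt^[j] (a i)) := by
    intro i j hj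
    simp only [neg_neg]
    rw [nxt_iterate_rev_of_le _ (by omega), Nat.sub_sub_self hj]
  rcases hc with hc | hc
  · refine Or.inr fun i j hj => ?_
    have := hc (-i) (m i - j) (by simp)
    rw [key i j hj] at this
    rwa [W.out_rev _ (h.not_dbl hn hj)] at this
  · refine Or.inl fun i j hj => ?_
    have := hc (-i) (m i - j) (by simp)
    rw [key i j hj, W.out_rev _ (h.not_dbl hn hj)] at this
    exact not_not.mp this

omit [Finite D] in
lemma isPoly_one {d : D} {m : ℕ} (h1 : W.IsPath d m) (h2 : W.rot.SameCycle (W.nxt^[m + 1] d) d)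
    (h3 : ∀ x y, x < y → y ≤ m → ¬ W.rot.SameCycle (W.nxt^[x] d) (W.nxt^[y] d))
    (h4 : ¬ W.bdry d) : W.IsPoly 1 (fun _ => d) (fun _ => m) := by
  refine ⟨fun _ => h1, fun _ => h2, fun i i' j j' hj hj' hs => ⟨Subsingleton.elim _ _, ?_⟩,
    fun h => absurd rfl h, fun _ => h4⟩
  rcases lt_trichotomy j j' with h | h | h
  exacts [absurd hs (h3 _ _ h hj'), h, absurd hs.symm (h3 _ _ h hj)]

omit [Finite D] in
lemma isPoly_two {d e : D} {m k : ℕ} (hd : W.IsPath d m) (he : W.IsPath e k)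
    (h1 : W.Cross e (W.rev (W.nxt^[m] d))) (h2 : W.Cross d (W.rev (W.nxt^[k] e)))
    (h3 : ∀ x y, x < y → y ≤ m → ¬ W.rot.SameCycle (W.nxt^[x] d) (W.nxt^[y] d))
    (h4 : ∀ x y, x < y → y ≤ k → ¬ W.rot.SameCycle (W.nxt^[x] e) (W.nxt^[y] e))
    (h5 : ∀ x y, x ≤ m → y ≤ k → ¬ W.rot.SameCycle (W.nxt^[x] d) (W.nxt^[y] e)) :
    W.IsPoly 2 ![d, e] ![m, k] := by
  refine ⟨?_, ?_, ?_, fun _ => ?_, ?_⟩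
  · rw [Fin.forall_fin_two]; exact ⟨hd, he⟩
  · rw [Fin.forall_fin_two]
    exact ⟨(same_rev_iterate _ _).symm.trans h1.same.symm,
      (same_rev_iterate _ _).symm.trans h2.same.symm⟩
  · rw [Fin.forall_fin_two, Fin.forall_fin_two, Fin.forall_fin_two]
    refine ⟨⟨fun j j' hj hj' hs => ⟨rfl, ?_⟩, fun j j' hj hj' hs => absurd hs (h5 _ _ hj hj')⟩,
      ⟨fun j j' hj hj' hs => absurd hs.symm (h5 _ _ hj' hj), fun j j' hj hj' hs => ⟨rfl, ?_⟩⟩⟩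
    · rcases lt_trichotomy j j' with h | h | h
      exacts [absurd hs (h3 _ _ h hj'), h, absurd hs.symm (h3 _ _ h hj)]
    · rcases lt_trichotomy j j' with h | h | h
      exacts [absurd hs (h4 _ _ h hj'), h, absurd hs.symm (h4 _ _ h hj)]
  · rw [Fin.forall_fin_two]; exact ⟨h1, h2⟩
  · rw [Fin.forall_fin_two]; exact ⟨h2.2.1, h1.2.1⟩

omit [Finite D] in
lemma isPoly_three {a : Fin 3 → D} {m : Fin 3 → ℕ} (h1 : ∀ i, W.IsPath (a i) (m i))
    (h2 : ∀ i, W.Cross (a (i + 1)) (W.rev (W.nxt^[m i] (a i))))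
    (h3 : ∀ i x y, x < y → y ≤ m i → ¬ W.rot.SameCycle (W.nxt^[x] (a i)) (W.nxt^[y] (a i)))
    (h4 : ∀ i x y, x ≤ m i → y ≤ m (i + 1) →
      ¬ W.rot.SameCycle (W.nxt^[x] (a i)) (W.nxt^[y] (a (i + 1)))) :
    W.IsPoly 3 a m := by
  refine ⟨h1, fun i => (same_rev_iterate _ _).symm.trans (h2 i).same.symm, ?_, fun _ => h2,
    fun i => ?_⟩
  · intro i i' j j' hj hj' hs
    have hi : i' = i ∨ i' = i + 1 ∨ i = i' + 1 := by clear hs hj hj'; revert i i'; decide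
    rcases hi with rfl | rfl | rfl
    · rcases lt_trichotomy j j' with h | h | h
      exacts [absurd hs (h3 _ _ _ h hj'), ⟨rfl, h⟩, absurd hs.symm (h3 _ _ _ h hj)]
    · exact absurd hs (h4 _ _ _ hj hj')
    · exact absurd hs.symm (h4 _ _ _ hj' hj)
  · have := (h2 (i - 1)).2.1
    rwa [sub_add_cancel] at this

/-- The earliest vertex that repeats a previous one closes a simple curve. -/
lemma exists_isPoly_one {d : D} {m i j : ℕ} (h : W.IsPath d m) (hij : i < j) (hj : j ≤ m + 1)
    (hs : W.rot.SameCycle (W.nxt^[i] d) (W.nxt^[j] d)) (hb : ¬ W.bdry (W.nxt^[i] d)) :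
    ∃ x k, x + k ≤ m ∧ W.IsPoly 1 (fun _ => W.nxt^[x] d) (fun _ => k) := by
  classical
  have hex : ∃ j, ∃ i, i < j ∧ j ≤ m + 1 ∧ W.rot.SameCycle (W.nxt^[i] d) (W.nxt^[j] d) ∧
    ¬ W.bdry (W.nxt^[i] d) := ⟨j, i, hij, hj, hs, hb⟩
  obtain ⟨i, h1, h2, h3, h4⟩ := Nat.find_spec hex
  have hmin := fun y hy => Nat.find_min (H := hex) (m := y) hy
  set j := Nat.find hex
  refine ⟨i, j - i - 1, by omega, isPoly_one (h.shift _ _ (by omega)) ?_ ?_ h4⟩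
  · rw [← Function.iterate_add_apply, show j - i - 1 + 1 + i = j by omega]
    exact h3.symm
  · intro x y hxy hy hs
    rw [← Function.iterate_add_apply, ← Function.iterate_add_apply] at hs
    refine hmin (y + i) (by omega) ⟨x + i, by omega, by omega, hs, fun hb => ?_⟩
    exact (h.pass (i := y + i) (by omega) (by omega)).not_bdry ((bdry_congr hs).mp hb)

/-- Two strands that cross and meet again form a polygon. -/
lemma exists_isSmall {d d' : D} {k k' : ℕ} (hd : W.IsPath d k) (hd' : W.IsPath d' k')
    (hc : W.Cross d d')
    (hs : ∀ x y, x < y → y ≤ k + 1 → ¬ W.rot.SameCycle (W.nxt^[x] d) (W.nxt^[y] d))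
    (hs' : ∀ x y, x < y → y ≤ k' + 1 → ¬ W.rot.SameCycle (W.nxt^[x] d') (W.nxt^[y] d'))
    (hdj : ∀ x y, 0 < x → x ≤ k → 0 < y → y ≤ k' →
      ¬ W.rot.SameCycle (W.nxt^[x] d) (W.nxt^[y] d'))
    (he : W.rot.SameCycle (W.nxt^[k + 1] d) (W.nxt^[k' + 1] d'))
    (hb : ¬ W.bdry (W.nxt^[k + 1] d)) :
    ∃ C, W.IsSmall C ∧ (∀ x ∈ C, (∃ t ≤ k, x = W.nxt^[t] d) ∨ ∃ t ≤ k', x = W.rev (W.nxt^[t] d')) ∧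
      (∀ t ≤ k, W.nxt^[t] d ∈ C) := by
  set p := W.rev (W.nxt^[k] d) with hp
  set q := W.rev (W.nxt^[k'] d') with hq
  have hvp : W.rot.SameCycle p (W.nxt^[k + 1] d) := same_rev_iterate _ _
  have hvq : W.rot.SameCycle q (W.nxt^[k' + 1] d') := same_rev_iterate _ _
  have hpq : W.rot.SameCycle p q := hvp.trans (he.trans hvq.symm)
  have hpb : ¬ W.bdry p := fun h => hb ((bdry_congr hvp).mp h)
  have hqt : ∀ t ≤ k', W.nxt^[t] q = W.rev (W.nxt^[k' - t] d') :=
    fun t ht => nxt_iterate_rev_of_le _ ht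
  have hqv : ∀ t ≤ k', W.rot.SameCycle (W.nxt^[t] q) (W.nxt^[k' - t + 1] d') := fun t ht => by
    rw [hqt t ht]; exact same_rev_iterate _ _
  have hdj' : ∀ x y, x ≤ k → y ≤ k' → ¬ W.rot.SameCycle (W.nxt^[x] d) (W.nxt^[y + 1] d') := by
    intro x y hx hy h
    rcases hy.lt_or_eq with hy | rfl
    · rcases Nat.eq_zero_or_pos x with rfl | hx0
      · exact hs' 0 (y + 1) (by omega) (by omega) (hc.same.symm.trans h)
      · exact hdj x (y + 1) hx0 hx (by omega) (by omega) h
    · exact hs x (k + 1) (by omega) le_rfl (h.trans he.symm)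
  have hne : p ≠ q := by
    intro h
    have h1 : W.nxt^[k] d = W.nxt^[k'] d' := W.rev.injective h
    rcases Nat.eq_zero_or_pos k with rfl | hk
    · rcases Nat.eq_zero_or_pos k' with rfl | hk'
      · exact hc.ne h1
      · refine hs' 0 k' hk' (by omega) ?_
        rw [← h1]
        exact hc.same.symm
    · rcases Nat.eq_zero_or_pos k' with rfl | hk'
      · refine hs 0 k hk (by omega) ?_
        rw [h1]
        exact hc.same
      · exact hdj k k' hk le_rfl hk' le_rfl (h1 ▸ Equiv.Perm.SameCycle.refl _ _)
  have hL : ¬ W.IsL p := by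
    intro h
    have h1 := (h.rev.cases (e := p) (by rw [← h.2.1]; exact (same_rot p).symm))
    refine hs k (k + 1) (by omega) le_rfl ?_
    rw [← W.rev_rev (W.nxt^[k] d)]
    refine Equiv.Perm.SameCycle.trans ?_ hvp
    rw [← hp, ← h.2.1]
    exact (same_rot p).symm
  -- At the meeting point the two strands either cross, which gives a bigon, or continue each other,
  -- and then they form a single strand that returns to the crossing of `d` and `d'`, a monogon.
  rcases cross_or_opp_of_not_dbl hpb hL hpq hne
    (by rw [hp, W.dbl_rev]; exact hd.not_dbl hc.2.2.1 le_rfl)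
    (by rw [hq, W.dbl_rev]; exact hd'.not_dbl hc.2.2.2.1 le_rfl) with h | ⟨hT, h⟩
  · refine ⟨_, Or.inr ⟨![d, q], ![k, k'], isPoly_two hd hd'.rev h.symm ?_ ?_ ?_ ?_, rfl⟩, ?_, ?_⟩
    · rw [hq, nxt_iterate_rev, W.rev_rev]; exact hc
    · exact fun x y hxy hy => hs x y hxy (by omega)
    · intro x y hxy hy h
      exact hs' (k' - y + 1) (k' - x + 1) (by omega) (by omega)
        ((hqv y hy).symm.trans (h.symm.trans (hqv x (by omega))))
    · intro x y hx hy h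
      exact hdj' x _ hx (by omega) (h.trans (hqv y hy))
    · rintro x ⟨i, j, hj, rfl⟩
      revert j
      revert i
      rw [Fin.forall_fin_two]
      refine ⟨fun j hj => Or.inl ⟨j, hj, rfl⟩, fun j hj => Or.inr ⟨k' - j, by omega, ?_⟩⟩
      exact hqt j hj
    · exact fun t ht => ⟨0, t, ht, rfl⟩
  · have hk1 : W.nxt^[k + 1] d = q := by
      rw [Function.iterate_succ_apply', nxt, ← hp, h]
    have hk2 : ∀ t ≤ k', W.nxt^[t + (k + 1)] d = W.rev (W.nxt^[k' - t] d') := by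
      intro t ht
      rw [Function.iterate_add_apply, hk1, hqt t ht]
    have hpath : W.IsPath d (k + 1 + k') := by
      refine (IsPath.append hd (k := 1) ?_).append ?_
      · intro i hi
        obtain rfl : i = 0 := by omega
        exact Or.inl hT
      · rw [hk1]; exact hd'.rev
    refine ⟨_, Or.inl ⟨_, _, isPoly_one hpath ?_ ?_ hc.2.1, rfl⟩, ?_, ?_⟩
    · refine (same_rev_iterate _ _).symm.trans ?_
      rw [add_comm, hk2 k' le_rfl, W.rev_rev, Nat.sub_self]
      exact hc.same.symm
    · intro x y hxy hy h
      by_cases hx : x ≤ k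
      · by_cases hy' : y ≤ k + 1
        · exact hs x y hxy hy' h
        · obtain ⟨t, rfl⟩ := Nat.exists_eq_add_of_le (show k + 1 ≤ y by omega)
          rw [add_comm (k + 1), Function.iterate_add_apply, hk1] at h
          exact hdj' x _ hx (by omega) (h.trans (hqv t (by omega)))
      · obtain ⟨t, rfl⟩ := Nat.exists_eq_add_of_le (show k + 1 ≤ y by omega)
        obtain ⟨s, rfl⟩ := Nat.exists_eq_add_of_le (show k + 1 ≤ x by omega)
        rw [add_comm (k + 1) s, add_comm (k + 1) t, Function.iterate_add_apply _ s,
          Function.iterate_add_apply _ t, hk1] at h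
        exact hs' (k' - t + 1) (k' - s + 1) (by omega) (by omega)
          ((hqv t (by omega)).symm.trans (h.symm.trans (hqv s (by omega))))
    · rintro x ⟨i, j, hj, rfl⟩
      change j ≤ k + 1 + k' at hj
      by_cases hjk : j ≤ k
      · exact Or.inl ⟨j, hjk, rfl⟩
      · refine Or.inr ⟨k' - (j - (k + 1)), by omega, ?_⟩
        rw [← hk2 _ (by omega), Nat.sub_add_cancel (by omega)]
    · exact fun t ht => ⟨0, t, show t ≤ k + 1 + k' by omega, rfl⟩

lemma IsPath.inj_of_no_small (hno : ∀ C, ¬ W.IsSmall C) {d : D} {m i j : ℕ} (h : W.IsPath d m)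
    (hij : i < j) (hj : j ≤ m + 1) (hb : ¬ W.bdry (W.nxt^[i] d)) :
    ¬ W.rot.SameCycle (W.nxt^[i] d) (W.nxt^[j] d) := by
  intro hs
  obtain ⟨x, k, -, h1⟩ := exists_isPoly_one h hij hj hs hb
  exact hno _ (Or.inl ⟨_, _, h1, rfl⟩)

/-- For the first vertex of the second strand that meets the first strand again, the two arcs are
disjoint, and `exists_isSmall` applies. -/
lemma Cross.no_second_crossing (hno : ∀ C, ¬ W.IsSmall C) {d d' : D} {k k' x y : ℕ}
    (hc : W.Cross d d') (hd : W.IsPath d k) (hd' : W.IsPath d' k') (hx0 : 0 < x) (hx : x ≤ k + 1)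
    (hy0 : 0 < y) (hy : y ≤ k' + 1) (hb : ¬ W.bdry (W.nxt^[x] d)) :
    ¬ W.rot.SameCycle (W.nxt^[x] d) (W.nxt^[y] d') := by
  classical
  intro h
  have hex : ∃ y, 0 < y ∧ y ≤ k' + 1 ∧ ∃ x, 0 < x ∧ x ≤ k + 1 ∧
      ¬ W.bdry (W.nxt^[x] d) ∧ W.rot.SameCycle (W.nxt^[x] d) (W.nxt^[y] d') :=
    ⟨y, hy0, hy, x, hx0, hx, hb, h⟩
  obtain ⟨hy0, hy, x, hx0, hx, hb, h⟩ := Nat.find_spec hex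
  have hmin := fun y hy => Nat.find_min (H := hex) (m := y) hy
  set y := Nat.find hex
  have hnb : ∀ (d : D) (k i : ℕ), ¬ W.bdry d → W.IsPath d k → i ≤ k → ¬ W.bdry (W.nxt^[i] d) := by
    intro d k i h1 h2 h3
    rcases Nat.eq_zero_or_pos i with rfl | h0
    exacts [h1, (h2.pass h0 h3).not_bdry]
  have hx1 : x - 1 + 1 = x := Nat.sub_add_cancel hx0
  have hy1 : y - 1 + 1 = y := Nat.sub_add_cancel hy0
  obtain ⟨C, hC, -⟩ := exists_isSmall (hd.mono (k := x - 1) (by omega))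
    (hd'.mono (k := y - 1) (by omega)) hc
    (fun u v huv hv => hd.inj_of_no_small hno huv (by omega) (hnb _ _ _ hc.2.1 hd (by omega)))
    (fun u v huv hv => hd'.inj_of_no_small hno huv (by omega)
      (hnb _ _ _ hc.symm.2.1 hd' (by omega)))
    (fun u v hu0 hu hv0 hv huv => hmin v (by omega) ⟨hv0, by omega, u, hu0, by omega,
      hnb _ _ _ hc.2.1 hd (by omega), huv⟩)
    (by rw [hx1, hy1]; exact h) (by rw [hx1]; exact hb)
  exact hno C hC

lemma forwardSeg_of_isPath {d : D} {m : ℕ} (h : W.IsPath d m)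
    (hf : ∀ j ≤ m, W.Forward (W.nxt^[j] d)) : W.ForwardSeg d (W.nxt^[m] d) := by
  refine ⟨hf 0 (Nat.zero_le _), ?_⟩
  induction m with
  | zero => exact Relation.ReflTransGen.refl
  | succ m ih =>
    refine (ih (h.mono (by omega)) fun j hj => hf j (by omega)).tail ⟨step_iff.mpr
      ⟨h m (by omega), ?_⟩, hf _ le_rfl⟩
    exact Function.iterate_succ_apply' _ _ _

lemma forwardSeg_rev_of_isPath {d : D} {m : ℕ} (h : W.IsPath d m) (hd : ¬ W.dbl d)
    (hf : ∀ j ≤ m, ¬ W.out (W.nxt^[j] d)) : W.ForwardSeg (W.rev (W.nxt^[m] d)) (W.rev d) := by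
  have := forwardSeg_of_isPath h.rev (fun j hj => Or.inr ?_)
  · rwa [nxt_iterate_rev] at this
  · rw [nxt_iterate_rev_of_le _ hj, W.out_rev _ (h.not_dbl hd (by omega))]
    exact hf _ (by omega)

/-- Without small polygons no strand meets itself and no two strands meet twice, so three arcs with
crossings at the corners form a simple curve. -/
lemma isPoly_three_of_no_small (hno : ∀ C, ¬ W.IsSmall C) {a : Fin 3 → D} {m : Fin 3 → ℕ}
    (hm : ∀ i, W.IsPath (a i) (m i))
    (hc : ∀ i, W.Cross (a (i + 1)) (W.rev (W.nxt^[m i] (a i)))) : W.IsPoly 3 a m := by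
  have hnb : ∀ i, ¬ W.bdry (a i) := fun i => by
    have := (hc (i - 1)).2.1
    rwa [sub_add_cancel] at this
  have hnb' : ∀ i j, j ≤ m i → ¬ W.bdry (W.nxt^[j] (a i)) := by
    intro i j hj
    rcases Nat.eq_zero_or_pos j with rfl | h0
    exacts [hnb i, ((hm i).pass h0 hj).not_bdry]
  refine isPoly_three hm hc (fun i x y hxy hy => ?_) (fun i x y hx hy hs => ?_)
  · exact (hm i).inj_of_no_small hno hxy (by omega) (hnb' i x (by omega))
  · rcases Nat.eq_zero_or_pos y with rfl | h0
    · refine (hm i).inj_of_no_small hno (i := x) (j := m i + 1) (by omega) le_rfl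
        (hnb' i x hx) ?_
      exact hs.trans ((hc i).same.trans (same_rev_iterate _ _))
    · refine (hc i).no_second_crossing hno (hm (i + 1)) (hm i).rev h0 (by omega)
        (y := m i - x + 1) (by omega) (by omega) (hnb' _ _ hy) ?_
      refine hs.symm.trans ((?_ : W.rot.SameCycle _ _).trans (same_rev_iterate _ _))
      rw [nxt_iterate_rev_of_le _ (by omega), W.rev_rev, Nat.sub_sub_self hx]

/-- If no polygon with at most two sides exists, strands have no coincidences that would allow the
first three configurations, and a triangle is a simple curve with the same directions. -/
theorem exists_isBad (h : W.HasUndirectedConfiguration) : ∃ C, W.IsBad C := by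
  by_contra hbad
  push Not at hbad
  have hno : ∀ C, ¬ W.IsSmall C := fun C hC => hbad C (Or.inl hC)
  rcases h with ⟨d, hd⟩ | ⟨d, e, hde, hc⟩ | ⟨d, e, d', e', h1, h2, h3, h4, -⟩ |
    ⟨a, e, h1, h2, h3, h4, h5⟩
  · obtain ⟨c, hdc, hcd⟩ := Relation.TransGen.head'_iff.mp hd
    obtain ⟨hp, rfl⟩ := step_iff.mp hdc
    obtain ⟨m, hm, hmd⟩ := seg_iff.mp hcd
    have h1 : W.IsPath d (1 + m) := IsPath.append (fun i hi => by
      obtain rfl : i = 0 := by omega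
      exact hp) hm
    rw [← Function.iterate_succ_apply] at hmd
    refine h1.inj_of_no_small hno (i := 0) (j := m + 1) (by omega) (by omega) ?_ ?_
    · have := (h1.pass (i := m + 1) (by omega) (by omega)).not_bdry
      rwa [hmd] at this
    · rw [hmd]; rfl
  · obtain ⟨m, hm, rfl⟩ := seg_iff.mp hde
    exact hm.inj_of_no_small hno (i := 0) (Nat.succ_pos m) le_rfl hc.2.1
      (hc.same.trans (same_rev_iterate _ _))
  · obtain ⟨m, hm, rfl⟩ := seg_iff.mp h1
    obtain ⟨m', hm', rfl⟩ := seg_iff.mp h2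
    refine h3.no_second_crossing hno hm hm' (Nat.succ_pos m) le_rfl (Nat.succ_pos m') le_rfl
      (fun hb => h4.2.1 ((bdry_congr (same_rev_iterate _ _)).mpr hb)) ?_
    exact (same_rev_iterate _ _).symm.trans (h4.same.trans (same_rev_iterate _ _))
  · choose m hm using fun i => seg_iff.mp (h1 i)
    have hem : ∀ i, e i = W.nxt^[m i] (a i) := fun i => (hm i).2.symm
    have hc : ∀ i, W.Cross (a (i + 1)) (W.rev (W.nxt^[m i] (a i))) := fun i => by
      rw [← hem]; exact h2 i
    have hnd : ∀ i, ¬ W.dbl (a i) := fun i => by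
      have := (h2 (i - 1)).2.2.1
      rwa [sub_add_cancel] at this
    have hpoly := isPoly_three_of_no_small hno (fun i => (hm i).1) hc
    refine hbad _ (Or.inr ⟨a, m, hpoly, ?_, rfl⟩)
    rintro (hcyc | hcyc)
    · refine h4 fun i => ?_
      rw [hem]
      exact forwardSeg_of_isPath (hm i).1 fun j hj => Or.inr (hcyc i j hj)
    · refine h5 fun i => ?_
      rw [hem]
      exact forwardSeg_rev_of_isPath (hm i).1 (hnd i) fun j hj => hcyc i j hj

end

section

variable {D F : Type*}

/-! ### Minimal bad curves -/

/-- No bad curve runs properly inside `C`. -/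
structure IsMin (W : Web D F) (C : Set D) (Ω : Set F) : Prop where
  cycle : W.IsCycle C
  inner : W.IsInner C Ω
  not_bdry : ∀ d ∈ C, ¬ W.bdry d
  min : ∀ C', W.IsBad C' → (∀ d ∈ C', W.face d ∈ Ω ∨ W.face (W.rev d) ∈ Ω) →
    (∃ d ∈ C', W.Ins Ω d) → False

/-- The strand of the dart `x` reaches the curve after `n` more darts. -/
structure Exit (W : Web D F) (C : Set D) (Ω : Set F) (x : D) (n : ℕ) : Prop where
  path : W.IsPath x n
  ins : ∀ k ≤ n, W.Ins Ω (W.nxt^[k] x)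
  not_on : ∀ k, 0 < k → k ≤ n → ¬ W.On C (W.nxt^[k] x)
  on : W.On C (W.nxt^[n + 1] x)
  inj : ∀ i j, i < j → j ≤ n + 1 → ¬ W.rot.SameCycle (W.nxt^[i] x) (W.nxt^[j] x)

lemma fin_two_cases : ∀ i j : Fin 2, j = i ∨ j = i + 1 := by decide

lemma fin_three_cases : ∀ i j : Fin 3, j = i ∨ j = i + 1 ∨ j = i + 1 + 1 := by decide

lemma fin_three_add : ∀ i : Fin 3, i + 1 + 1 + 1 = i := by decide

variable [Finite D] {W : Web D F} {C : Set D} {Ω : Set F}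

omit [Finite D] in
lemma rev_eq_opp {d : D} {j : ℕ} : W.rev (W.nxt^[j] d) = W.opp (W.nxt^[j + 1] d) := by
  rw [Function.iterate_succ_apply', nxt, opp_opp]

lemma IsPoly.not_bdry_of_mem {n : ℕ} [NeZero n] {a : Fin n → D} {m : Fin n → ℕ}
    (h : W.IsPoly n a m) {d : D} (hd : d ∈ W.darts a m) : ¬ W.bdry d := by
  obtain ⟨i, j, hj, rfl⟩ := hd
  rcases Nat.eq_zero_or_pos j with rfl | h0
  exacts [h.not_bdry i, ((h.path i).pass h0 hj).not_bdry]

omit [Finite D] in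
lemma IsBad.isCycle (h : W.IsBad C) : W.IsCycle C := by
  rcases h with (⟨a, m, h, rfl⟩ | ⟨a, m, h, rfl⟩) | ⟨a, m, h, -, rfl⟩ <;> exact h.isCycle

lemma IsBad.not_bdry (h : W.IsBad C) {d : D} (hd : d ∈ C) : ¬ W.bdry d := by
  rcases h with (⟨a, m, h, rfl⟩ | ⟨a, m, h, rfl⟩) | ⟨a, m, h, -, rfl⟩ <;>
  exact h.not_bdry_of_mem hd

lemma IsBad.reverse (h : W.IsBad C) : W.IsBad {d | W.rev d ∈ C} := by
  rcases h with (⟨a, m, h, rfl⟩ | ⟨a, m, h, rfl⟩) | ⟨a, m, h, h', rfl⟩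
  · exact Or.inl (Or.inl ⟨_, _, h.reverse, (darts_reverse a m).symm⟩)
  · exact Or.inl (Or.inr ⟨_, _, h.reverse, (darts_reverse a m).symm⟩)
  · exact Or.inr ⟨_, _, h.reverse, fun hc => h' (h.cyc_reverse (by decide) hc),
      (darts_reverse a m).symm⟩

/-- A bad curve with the fewest regions inside is minimal; a competitor may have either orientation
because bad curves can be reversed. The bound `N` is carried along for the induction over webs. -/
lemma exists_isMin {N : ℕ} (h : ∃ C Ω, W.IsBad C ∧ W.IsInner C Ω ∧ Ω.ncard ≤ N) :
    ∃ C Ω, W.IsBad C ∧ W.IsMin C Ω ∧ Ω.ncard ≤ N := by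
  classical
  have := W.finite_regions
  have hex : ∃ k C Ω, W.IsBad C ∧ W.IsInner C Ω ∧ Ω.ncard = k := by
    obtain ⟨C, Ω, h1, h2, -⟩ := h
    exact ⟨_, C, Ω, h1, h2, rfl⟩
  obtain ⟨C, Ω, h1, h2, h3⟩ := Nat.find_spec hex
  have hmin := fun y hy => Nat.find_min (H := hex) (m := y) hy
  refine ⟨C, Ω, h1, ⟨h1.isCycle, h2, fun d hd => h1.not_bdry hd, ?_⟩, ?_⟩
  · have key : ∀ C', W.IsBad C' → (∀ d ∈ C', W.face d ∈ Ω ∨ W.face (W.rev d) ∈ Ω) →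
        (∃ d ∈ C', W.Ins Ω d) → ∀ Ω', ¬ W.IsInner C' Ω' := by
      intro C' h4 h5 h6 Ω' h7
      refine hmin Ω'.ncard ?_ ⟨C', Ω', h4, h7, rfl⟩
      rw [← h3]
      exact Set.ncard_lt_ncard (h2.ssubset h1.isCycle h7 h5 h6)
    intro C' h4 h5 h6
    obtain ⟨Ω', h7 | h7⟩ := h4.isCycle.exists_inner
    · exact key C' h4 h5 h6 Ω' h7
    · refine key _ h4.reverse (fun d hd => ?_) ?_ Ω' h7
      · have := h5 _ hd
        rw [W.rev_rev] at this
        exact this.symm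
      · obtain ⟨d, hd, h8⟩ := h6
        refine ⟨W.rev d, ?_, h8.rev⟩
        change W.rev (W.rev d) ∈ C'
        rwa [W.rev_rev]
  · obtain ⟨C', Ω', h4, h5, h6⟩ := h
    rw [h3]
    by_contra hlt
    exact hmin Ω'.ncard (by omega) ⟨C', Ω', h4, h5, rfl⟩

lemma IsBad.exists_inner (h : W.IsBad C) :
    ∃ C Ω, W.IsBad C ∧ W.IsInner C Ω := by
  obtain ⟨Ω, h1 | h1⟩ := h.isCycle.exists_inner
  exacts [⟨C, Ω, h, h1⟩, ⟨_, Ω, h.reverse, h1⟩]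

namespace IsMin

variable (hM : W.IsMin C Ω)

include hM

omit [Finite D] in
lemma not_bdry_of_on {x : D} (h : W.On C x) : ¬ W.bdry x := by
  obtain ⟨e, he, h1⟩ := h
  exact fun hb => hM.not_bdry e he ((bdry_congr h1).mpr hb)

/-- The boundary vertex touches the base region, which is outside, while all regions around a vertex
off the curve lie on the same side of it. -/
lemma not_bdry_of_not_on {x : D} (h : ¬ W.On C x) (hx : W.face x ∈ Ω) : ¬ W.bdry x := by
  intro hb
  obtain ⟨b, h1, h2⟩ := W.outer_bdry ⟨x, hb⟩
  refine hM.inner.outer ?_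
  rw [← h2]
  exact (hM.inner.face_iff hM.cycle h ((W.bdry_cycle x hb b).mp h1)).mp hx

/-- A trivalent vertex inside would be joined to the boundary by its double edge. -/
lemma pass_of_not_on {x : D} (h : ¬ W.On C x) (hx : W.face x ∈ Ω) : W.Pass x := by
  by_contra hp
  obtain ⟨e, h1, -, -, h2, -⟩ := isTrivalent_of_not_pass (hM.not_bdry_of_not_on h hx) hp
  have h3 : ¬ W.On C e := fun h' => h (h'.congr h1)
  have h4 := not_on_mem hM.cycle h3
  have h5 := (hM.inner.face_iff hM.cycle h h1.symm).mp hx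
  rw [hM.inner.off _ h4.1 h4.2] at h5
  exact hM.not_bdry_of_not_on (fun h' => hM.not_bdry_of_on h' h2) h5 h2

omit [Finite D] in
lemma ins_of_not_on {x : D} (h : ¬ W.On C x) (hx : W.face x ∈ Ω) : W.Ins Ω x := by
  have h4 := not_on_mem hM.cycle h
  exact ⟨hx, (hM.inner.off _ h4.1 h4.2).mp hx⟩

lemma ins_nxt {x : D} (hx : W.Ins Ω x) (h : ¬ W.On C (W.nxt x)) :
    W.Pass (W.rev x) ∧ W.Ins Ω (W.nxt x) := by
  have h1 : ¬ W.On C (W.rev x) := fun h' => h (h'.congr (same_nxt x))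
  refine ⟨hM.pass_of_not_on h1 hx.2, hM.ins_of_not_on h ?_⟩
  exact (hM.inner.face_iff hM.cycle h1 (same_nxt x)).mp hx.2

lemma path_of_not_on {x : D} (hx : W.Ins Ω x) {n : ℕ}
    (h : ∀ k, 0 < k → k ≤ n → ¬ W.On C (W.nxt^[k] x)) :
    W.IsPath x n ∧ ∀ k ≤ n, W.Ins Ω (W.nxt^[k] x) := by
  have h2 : ∀ k ≤ n, W.Ins Ω (W.nxt^[k] x) := by
    intro k
    induction k with
    | zero => exact fun _ => hx
    | succ k ih =>
      intro hk
      have := h (k + 1) (by omega) hk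
      rw [Function.iterate_succ_apply'] at this ⊢
      exact (hM.ins_nxt (ih (by omega)) this).2
  refine ⟨fun k hk => ?_, h2⟩
  have := h (k + 1) (by omega) hk
  rw [Function.iterate_succ_apply'] at this
  exact (hM.ins_nxt (h2 k hk.le) this).1

/-- A strand inside that meets itself would cut off a smaller polygon with one side. -/
lemma inj_of_ins {x : D} {n : ℕ} (hp : W.IsPath x n) (h : ∀ k ≤ n, W.Ins Ω (W.nxt^[k] x)) {i j : ℕ}
    (hij : i < j) (hj : j ≤ n + 1) : ¬ W.rot.SameCycle (W.nxt^[i] x) (W.nxt^[j] x) := by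
  intro hs
  have hnb : ¬ W.bdry (W.nxt^[i] x) := by
    intro hb
    by_cases h3 : W.On C (W.nxt^[i] x)
    · exact hM.not_bdry_of_on h3 hb
    · exact hM.not_bdry_of_not_on h3 (h i (by omega)).1 hb
  obtain ⟨y, k, h1, h2⟩ := exists_isPoly_one hp hij hj hs hnb
  refine hM.min _ (Or.inl (Or.inl ⟨_, _, h2, rfl⟩)) ?_ ⟨_, mem_darts_zero 0, h _ (by omega)⟩
  rintro _ ⟨_, t, ht, rfl⟩
  rw [← Function.iterate_add_apply]
  change t ≤ k at ht
  exact Or.inl (h _ (by omega)).1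

/-- A strand inside the curve reaches the curve. -/
lemma exists_exit {x : D} (hx : W.Ins Ω x) : ∃ n, W.Exit C Ω x n := by
  classical
  have hex : ∃ n, W.On C (W.nxt^[n + 1] x) := by
    by_contra hno
    push Not at hno
    -- A strand that never reached the curve would repeat a dart, since there are finitely many, and
    -- so would meet itself inside.
    obtain ⟨i, j, hij, h⟩ := Finite.exists_ne_map_eq_of_infinite (fun k : ℕ => W.nxt^[k] x)
    have key : ∀ i j, i < j → W.nxt^[i] x ≠ W.nxt^[j] x := by
      intro i j hij h
      have hall := hM.path_of_not_on hx (n := j) (fun k hk _ => by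
        obtain ⟨k, rfl⟩ := Nat.exists_eq_add_of_le' hk
        exact hno k)
      refine hM.inj_of_ins hall.1 hall.2 hij (by omega) ?_
      rw [h]
    rcases lt_or_gt_of_ne hij with h1 | h1
    exacts [key i j h1 h, key j i h1 h.symm]
  have hno : ∀ k, 0 < k → k ≤ Nat.find hex → ¬ W.On C (W.nxt^[k] x) := by
    intro k h0 hk
    obtain ⟨k, rfl⟩ := Nat.exists_eq_add_of_le' h0
    exact Nat.find_min hex (by omega)
  have hall := hM.path_of_not_on hx hno
  exact ⟨Nat.find hex, hall.1, hall.2, hno, Nat.find_spec hex, fun i j hij hj =>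
    hM.inj_of_ins hall.1 hall.2 hij hj⟩

/-- A strand inside the curve does not leave and reach again a strand along the curve. -/
lemma no_return {x b : D} {n k : ℕ} (hx : W.Exit C Ω x n) (hc : W.Cross x b) (hb : W.IsPath b k)
    (hside : ∀ t ≤ k, W.face (W.nxt^[t] b) ∈ Ω ∨ W.face (W.rev (W.nxt^[t] b)) ∈ Ω)
    (hon : ∀ t, 0 < t → t ≤ k → W.On C (W.nxt^[t] b))
    (hinj : ∀ u v, u < v → v ≤ k + 1 → ¬ W.rot.SameCycle (W.nxt^[u] b) (W.nxt^[v] b))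
    (he : W.rot.SameCycle (W.nxt^[n + 1] x) (W.nxt^[k + 1] b)) : False := by
  obtain ⟨C', h1, h2, h3⟩ := exists_isSmall hx.path hb hc hx.inj hinj
    (fun u v hu0 hu hv0 hv h => hx.not_on u hu0 hu ((hon v hv0 hv).congr h.symm)) he
    (hM.not_bdry_of_on hx.on)
  refine hM.min C' (Or.inl h1) (fun d hd => ?_) ⟨x, h3 0 (Nat.zero_le _), hx.ins 0 (Nat.zero_le _)⟩
  rcases h2 d hd with ⟨t, ht, rfl⟩ | ⟨t, ht, rfl⟩
  · exact Or.inl (hx.ins t ht).1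
  · rw [W.rev_rev]
    exact (hside t ht).symm

/-- The vertex has two darts on the curve and a third one inside. If it were trivalent, one of them
would be the double edge to the boundary, which neither the curve nor its inside meets. -/
lemma isT_of_ins_rot {b p : D} (hb : b ∈ C) (hp : p ∈ C) (hpb : W.rot.SameCycle (W.rev p) b)
    (hx : W.Ins Ω (W.rot b)) : W.IsT b := by
  by_contra hT
  have hbC := hM.not_bdry b hb
  have hbp : b ≠ W.rev p := fun h => hM.cycle.rev_notMem hp (h ▸ hb)
  have hxb : W.rot b ≠ b := fun h => hM.inner.right b hb (h ▸ hx).2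
  have hxp : W.rot b ≠ W.rev p := fun h => hM.inner.right p hp (h ▸ hx).1
  by_cases hL : W.IsL b
  · refine hM.inner.right b hb ?_
    have := hx.1
    rwa [hL.2.1] at this
  · obtain ⟨e, h1, h2, -, h4, -, -, -, h5⟩ := isTrivalent_of_not_pass hbC (fun h => h.elim hT hL)
    have he : e = b ∨ e = W.rot b ∨ e = W.rev p := by
      have h6 := h5 b (Equiv.Perm.SameCycle.refl _ _)
      have h7 := h5 (W.rev p) hpb
      by_contra hne
      push Not at hne
      rcases h6 with h6 | h6 | h6
      · exact hne.1 h6.symm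
      · rcases h7 with h7 | h7 | h7
        · exact hne.2.2 h7.symm
        · exact hbp (h6.trans h7.symm)
        · exact hxp (by rw [h6, h7])
      · exact hne.2.1 (by rw [h6, h2])
    rcases he with rfl | rfl | rfl
    · obtain ⟨c, hc, h6, -⟩ := hM.cycle.succ _ hb
      exact hM.not_bdry c hc ((bdry_congr h6).mp h4)
    · exact hM.not_bdry_of_not_on (fun h' => hM.not_bdry_of_on h' h4) hx.2 h4
    · rw [W.rev_rev] at h4
      exact hM.not_bdry p hp h4

lemma comp_eq_of_mem {c c' : D} (hc : c ∈ C) (hc' : c' ∈ C) :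
    comp W.rot W.rev c = comp W.rot W.rev c' := by
  have hs : ∀ x y, W.rot.SameCycle x y → comp W.rot W.rev x = comp W.rot W.rev y := fun x y h =>
    sameCycle_induction h (fun y => comp W.rot W.rev x = comp W.rot W.rev y) rfl
      fun z hz => hz.trans (comp_rot W z).symm
  have h := hM.cycle.conn {e | e ∈ C ∧ comp W.rot W.rev c = comp W.rot W.rev e} (fun e h => h.1)
    ⟨c, hc, rfl⟩ ?_
  · exact (h.ge hc').2
  · rintro d ⟨_, hd⟩ e he hde
    exact ⟨he, hd.trans ((comp_rev W d).symm.trans (hs _ _ hde))⟩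

/-- A closed boundary walk inside the curve bounds a face. -/
lemma isPolygon {k : ℕ} [NeZero k] {A : Fin k → D} (hA : Function.Injective A)
    (hw : ∀ i, W.rot (A (i + 1)) = W.rev (A i)) (hΩ : W.face (A 0) ∈ Ω) (hA0 : A 0 ∈ C)
    (hb : ∀ i, ¬ W.bdry (A i)) : W.IsPolygon A := by
  have hw' : ∀ i, faceWalk W.rot W.rev (A i) = A (i + 1) := fun i => by
    rw [faceWalk, Equiv.Perm.mul_apply, ← hw i, Equiv.Perm.inv_def, Equiv.symm_apply_apply]
  refine ⟨hA, hw', fun d hd => ?_, fun h => hM.inner.outer (h ▸ hΩ), hb⟩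
  have hs : ∀ x y, W.rot.SameCycle x y → comp W.rot W.rev x = comp W.rot W.rev y := fun x y h =>
    sameCycle_induction h (fun y => comp W.rot W.rev x = comp W.rot W.rev y) rfl
      fun z hz => hz.trans (comp_rot W z).symm
  by_cases hc : comp W.rot W.rev d = comp W.rot W.rev (A 0)
  · refine sameCycle_induction (W.walk_of_face _ _ hc hd).symm (fun d => ∃ i, d = A i) ⟨0, rfl⟩ ?_
    rintro _ ⟨i, rfl⟩
    exact ⟨i + 1, hw' i⟩
  -- A second boundary component of the region would lie inside the curve, but a strand of it
  -- reaches the curve, so it belongs to the component of the curve.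
  · exfalso
    have hon : ∀ e, W.On C e → comp W.rot W.rev e = comp W.rot W.rev (A 0) := by
      rintro e ⟨c, hcC, hce⟩
      exact (hs c e hce).symm.trans (hM.comp_eq_of_mem hcC hA0)
    have hno : ¬ W.On C d := fun h => hc (hon d h)
    obtain ⟨n, hn⟩ := hM.exists_exit (hM.ins_of_not_on hno (hd ▸ hΩ))
    have h1 : ∀ j, comp W.rot W.rev (W.nxt^[j] d) = comp W.rot W.rev d := by
      intro j
      induction j with
      | zero => rfl
      | succ j ih => rw [← ih, ← comp_rev W (W.nxt^[j] d)]; exact (hs _ _ (same_rev_iterate _ _)).symm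
    exact hc ((h1 _).symm.trans (hon _ hn.on))

end IsMin

/-! ### Chords of a minimal polygon -/

namespace IsMin

variable {n : ℕ} [NeZero n] {a : Fin n → D} {m : Fin n → ℕ} (hM : W.IsMin (W.darts a m) Ω)
  (hP : W.IsPoly n a m)

include hM hP

omit hM in
lemma _root_.A3.Web.IsPoly.isT {i : Fin n} {j : ℕ} (h0 : 0 < j) (hj : j ≤ m i) :
    W.IsT (W.nxt^[j] (a i)) := by
  rcases (hP.path i).pass h0 hj with h | h
  · exact h
  · obtain ⟨j, rfl⟩ := Nat.exists_eq_add_of_le' h0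
    have h1 := hP.inj i i j (j + 1) (by omega) hj (by
      rw [Function.iterate_succ_apply'] at h ⊢
      rw [nxt_of_isL (h.congr (same_nxt _).symm)])
    omega

lemma ins_straight {i : Fin n} {j : ℕ} (h0 : 0 < j) (hj : j ≤ m i) :
    W.Ins Ω (W.rot (W.nxt^[j] (a i))) := by
  have hT := hP.isT h0 hj
  obtain ⟨j, rfl⟩ := Nat.exists_eq_add_of_le' h0
  refine hM.inner.ins_rot hM.cycle (mem_darts (show j ≤ m i by omega)) (mem_darts hj)
    (same_rev_iterate _ _) fun h => ?_
  rw [rev_eq_opp, opp_of_isT hT] at h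
  exact hT.rot.2.2 (by rw [← h, ← h])

omit [Finite D] [NeZero n] hP in
lemma side {i : Fin n} {j : ℕ} (hj : j ≤ m i) :
    W.face (W.nxt^[j] (a i)) ∈ Ω := hM.inner.left _ (mem_darts hj)

omit [Finite D] [NeZero n] hM hP in
lemma on_side {i : Fin n} {j : ℕ} (hj : j ≤ m i) : W.On (W.darts a m) (W.nxt^[j] (a i)) :=
  ⟨_, mem_darts hj, Equiv.Perm.SameCycle.refl _ _⟩

/-- The chord and the arc of the side between its ends would form a smaller polygon with at most two
sides. -/
lemma no_chord_same_side {i : Fin n} {j j' s : ℕ} (hj : j ≤ m i) (hj' : j' ≤ m i)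
    (hT : W.IsT (W.nxt^[j] (a i))) (hx : W.Exit (W.darts a m) Ω (W.rot (W.nxt^[j] (a i))) s)
    (he : W.rot.SameCycle (W.nxt^[s + 1] (W.rot (W.nxt^[j] (a i)))) (W.nxt^[j'] (a i))) : False := by
  rcases lt_trichotomy j j' with h | h | h
  · have key : ∀ t, W.nxt^[t] (W.nxt^[j] (a i)) = W.nxt^[t + j] (a i) :=
      fun t => (Function.iterate_add_apply _ _ _ _).symm
    refine hM.no_return hx (isT_cross hT).symm ((hP.path i).shift j (j' - j - 1) (by omega))
      (fun t ht => ?_) (fun t h0 ht => ?_) (fun u v huv hv hs => ?_) ?_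
    · rw [key]; exact Or.inl (hM.side (by omega))
    · rw [key]; exact on_side (by omega)
    · rw [key, key] at hs
      have := (hP.inj i i _ _ (by omega) (by omega) hs).2
      omega
    · rw [key, show j' - j - 1 + 1 + j = j' by omega]
      exact he
  · subst h
    exact hx.inj 0 (s + 1) (by omega) le_rfl ((same_rot _).symm.trans he.symm)
  · obtain ⟨j, rfl⟩ := Nat.exists_eq_add_of_le' (show 0 < j by omega)
    have key : ∀ t ≤ j, W.nxt^[t] (W.rev (W.nxt^[j] (a i))) = W.rev (W.nxt^[j - t] (a i)) :=
      fun t ht => nxt_iterate_rev_of_le _ ht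
    have key' : ∀ t ≤ j + 1, W.rot.SameCycle (W.nxt^[t] (W.rev (W.nxt^[j] (a i))))
        (W.nxt^[j + 1 - t] (a i)) := by
      intro t ht
      rcases ht.lt_or_eq with ht | rfl
      · rw [key t (by omega), show j + 1 - t = j - t + 1 by omega]
        exact same_rev_iterate _ _
      · refine (same_rev_iterate _ _).symm.trans ?_
        rw [nxt_iterate_rev, W.rev_rev, Nat.sub_self]
        rfl
    refine hM.no_return hx (b := W.rev (W.nxt^[j] (a i))) (k := j - j') ?_
      (((hP.path i).mono (show j ≤ m i by omega)).rev.mono (by omega))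
      (fun t ht => ?_) (fun t h0 ht => ?_) (fun u v huv hv hs => ?_) ?_
    · rw [rev_eq_opp]
      exact (isT_cross hT).symm.opp_right hT.rot
    · rw [key t (by omega), W.rev_rev]; exact Or.inr (hM.side (by omega))
    · exact (on_side (show j + 1 - t ≤ m i by omega)).congr (key' t (by omega)).symm
    · have := (hP.inj i i _ _ (by omega) (by omega)
        ((key' u (by omega)).symm.trans (hs.trans (key' v (by omega))))).2
      omega
    · refine he.trans ?_
      have := key' (j - j' + 1) (by omega)
      rw [show j + 1 - (j - j' + 1) = j' by omega] at this
      exact this.symm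

omit [Finite D] hM in
lemma _root_.A3.Web.IsPoly.inj_head (hn : n ≠ 1) {i : Fin n} {u v : ℕ} (huv : u < v)
    (hv : v ≤ m i + 1) : ¬ W.rot.SameCycle (W.nxt^[u] (a i)) (W.nxt^[v] (a i)) := by
  intro hs
  rcases hv.lt_or_eq with h | rfl
  · have := (hP.inj i i u v (by omega) (by omega) hs).2
    omega
  · have := (hP.inj i (i + 1) u 0 (by omega) (by omega) (hs.trans (hP.head i))).1
    have h1 : (1 : Fin n) = 0 := left_eq_add.mp this
    have h2 := congrArg Fin.val h1
    have h3 : 1 < n := by have := NeZero.ne n; omega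
    rw [Fin.val_one', Fin.val_zero, Nat.mod_eq_of_lt h3] at h2
    omega

/-- The same argument, with the arc running up to the corner at the end of the side. -/
lemma no_chord_to_head (hn : n ≠ 1) {i : Fin n} {j s : ℕ} (hj : j ≤ m i)
    (hT : W.IsT (W.nxt^[j] (a i))) (hx : W.Exit (W.darts a m) Ω (W.rot (W.nxt^[j] (a i))) s)
    (he : W.rot.SameCycle (W.nxt^[s + 1] (W.rot (W.nxt^[j] (a i)))) (a (i + 1))) : False := by
  have key : ∀ t, W.nxt^[t] (W.nxt^[j] (a i)) = W.nxt^[t + j] (a i) :=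
    fun t => (Function.iterate_add_apply _ _ _ _).symm
  refine hM.no_return hx (isT_cross hT).symm ((hP.path i).shift j (m i - j) (by omega))
    (fun t ht => ?_) (fun t h0 ht => ?_) (fun u v huv hv hs => ?_) ?_
  · rw [key]; exact Or.inl (hM.side (by omega))
  · rw [key]; exact on_side (by omega)
  · rw [key, key] at hs
    exact hP.inj_head hn (by omega) (by omega) hs
  · rw [key, show m i - j + 1 + j = m i + 1 by omega]
    exact he.trans (hP.head i).symm

/-- The corners of a minimal polygon are convex. -/
lemma convex (hn : n ≤ 3) (hn1 : n ≠ 1) (i : Fin n) :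
    W.rot (a (i + 1)) = W.rev (W.nxt^[m i] (a i)) := by
  by_contra hne
  set p := W.nxt^[m i] (a i) with hp
  have hpC : p ∈ W.darts a m := mem_darts le_rfl
  have hpb : W.rot.SameCycle (W.rev p) (a (i + 1)) := (same_rev_iterate _ _).trans (hP.head i)
  have hx := hM.inner.ins_rot hM.cycle hpC (mem_darts_zero (i + 1)) hpb hne
  have hT := hM.isT_of_ins_rot (mem_darts_zero (i + 1)) hpC hpb hx
  set x := W.rot (a (i + 1)) with hxdef
  obtain ⟨s, hs⟩ := hM.exists_exit hx
  -- At a reflex corner the strand of side `i` goes on into the inside, along `x`.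
  have hxp : W.nxt p = x := by
    have h1 : W.rot (W.rev p) = a (i + 1) := by
      rcases (hP.corner hn1 i).1 with h | h
      exacts [absurd h hne, h]
    rw [nxt, opp_of_isT (hT.congr hpb.symm), h1]
  have hxt : ∀ t, W.nxt^[t + (m i + 1)] (a i) = W.nxt^[t] x := by
    intro t
    rw [Function.iterate_add_apply, Function.iterate_succ_apply' _ (m i), ← hp, hxp]
  have hpath : W.IsPath (a i) (m i + 1 + s) := by
    refine (IsPath.append (hP.path i) (k := 1) ?_).append ?_
    · intro t ht
      obtain rfl : t = 0 := by omega
      exact Or.inl (hT.congr hpb.symm)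
    · have := hxt 0
      rw [zero_add] at this
      rw [this]
      exact hs.path
  have hxon : W.rot.SameCycle x (a (i + 1)) := (same_rot _).symm
  have hi1 : i ≠ i + 1 := by
    intro h
    have h1 : (1 : Fin n) = 0 := left_eq_add.mp h
    have h2 := congrArg Fin.val h1
    have h3 : 1 < n := by have := NeZero.ne n; omega
    rw [Fin.val_one', Fin.val_zero, Nat.mod_eq_of_lt h3] at h2
    omega
  have hdist : ∀ u v, u < v → v ≤ m i + 1 + s →
      ¬ W.rot.SameCycle (W.nxt^[u] (a i)) (W.nxt^[v] (a i)) := by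
    intro u v huv hv h
    by_cases hv1 : v ≤ m i + 1
    · exact hP.inj_head hn1 huv hv1 h
    · obtain ⟨t, rfl⟩ := Nat.exists_eq_add_of_le (show m i + 1 ≤ v by omega)
      rw [add_comm (m i + 1) t, hxt] at h
      by_cases hu1 : u ≤ m i
      · exact hs.not_on t (by omega) (by omega) ((on_side hu1).congr h)
      · obtain ⟨w, rfl⟩ := Nat.exists_eq_add_of_le (show m i + 1 ≤ u by omega)
        rw [add_comm (m i + 1) w, hxt] at h
        exact hs.inj w t (by omega) (by omega) h
  obtain ⟨_, ⟨i', j', hj', rfl⟩, hQ⟩ := hs.on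
  have hQ' : ∀ u, u ≤ m i + 1 + s → ¬ W.rot.SameCycle (W.nxt^[u] (a i)) (W.nxt^[s + 1] x) ∨
      (u ≤ m i ∧ i' = i) := by
    intro u hu
    by_cases hu1 : u ≤ m i
    · by_cases hii : i' = i
      · exact Or.inr ⟨hu1, hii⟩
      · exact Or.inl fun h => hii (hP.inj i i' u j' hu1 hj' (h.trans hQ.symm)).1.symm
    · left
      obtain ⟨w, rfl⟩ := Nat.exists_eq_add_of_le (show m i + 1 ≤ u by omega)
      rw [add_comm (m i + 1) w, hxt]
      exact hs.inj w (s + 1) (by omega) le_rfl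
  have hface : ∀ u ≤ m i + 1 + s, W.face (W.nxt^[u] (a i)) ∈ Ω := by
    intro u hu
    by_cases hu1 : u ≤ m i
    · exact hM.side hu1
    · obtain ⟨w, rfl⟩ := Nat.exists_eq_add_of_le (show m i + 1 ≤ u by omega)
      rw [add_comm (m i + 1) w, hxt]
      exact (hs.ins w (by omega)).1
  -- The prolonged side `i` may end on side `i + 1`, as a chord from the corner back to that side;
  -- on side `i`, closing a monogon there; or, in a triangle, on the third side. Each case gives a
  -- smaller polygon with at most two sides.
  by_cases h1 : i' = i + 1
  · subst h1
    exact hM.no_chord_same_side hP (j := 0) (Nat.zero_le _) hj' hT hs hQ.symm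
  by_cases h2 : i' = i
  · subst h2
    have h3 : W.IsPoly 1 (fun _ => W.nxt^[j'] (a i')) (fun _ => m i' + 1 + s - j') := by
      refine isPoly_one (hpath.shift j' _ (by omega)) ?_ ?_ (hP.not_bdry_of_mem (mem_darts hj'))
      · rw [← Function.iterate_add_apply,
          show m i' + 1 + s - j' + 1 + j' = s + 1 + (m i' + 1) by omega, hxt]
        exact hQ.symm
      · intro u v huv hv
        rw [← Function.iterate_add_apply, ← Function.iterate_add_apply]
        exact hdist _ _ (by omega) (by omega)
    refine hM.min _ (Or.inl (Or.inl ⟨_, _, h3, rfl⟩)) ?_ ⟨x, ⟨0, m i' + 1 - j', ?_, ?_⟩, hx⟩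
    · rintro _ ⟨_, t, ht, rfl⟩
      change t ≤ m i' + 1 + s - j' at ht
      rw [← Function.iterate_add_apply]
      exact Or.inl (hface _ (by omega))
    · change m i' + 1 - j' ≤ m i' + 1 + s - j'
      omega
    · have := hxt 0
      rw [← Function.iterate_add_apply, show m i' + 1 - j' + j' = 0 + (m i' + 1) by omega, this]
      rfl
  obtain rfl : n = 3 := by
    have h3 : n ≠ 2 := by
      rintro rfl
      exact (fin_two_cases i i').elim h2 h1
    have := NeZero.ne n
    omega
  obtain rfl : i' = i + 1 + 1 := ((fin_three_cases i i').resolve_left h2).resolve_left h1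
  -- The start of the third side is the corner at the end of side `i + 1`.
  rcases Nat.eq_zero_or_pos j' with rfl | h0
  · exact hM.no_chord_to_head hP hn1 (j := 0) (i := i + 1) (Nat.zero_le _) hT hs hQ.symm
  set q := W.nxt^[m (i + 1 + 1)] (a (i + 1 + 1)) with hq
  have hi3 : i + 1 + 1 + 1 = i := fin_three_add i
  have hqt : ∀ t ≤ m (i + 1 + 1), W.nxt^[t] (W.rev q) =
      W.rev (W.nxt^[m (i + 1 + 1) - t] (a (i + 1 + 1))) := fun t ht => nxt_iterate_rev_of_le _ ht
  have hqv : ∀ t ≤ m (i + 1 + 1), W.rot.SameCycle (W.nxt^[t] (W.rev q))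
      (W.nxt^[m (i + 1 + 1) - t + 1] (a (i + 1 + 1))) := fun t ht => by
    rw [hqt t ht]; exact same_rev_iterate _ _
  have hcr := hP.corner hn1 (i + 1 + 1)
  rw [hi3] at hcr
  have hend : W.rot.SameCycle (W.nxt^[s + 1] x)
      (W.nxt^[m (i + 1 + 1) - j' + 1] (W.rev q)) := by
    rw [Function.iterate_succ_apply' _ (m (i + 1 + 1) - j'), hqt _ (by omega),
      Nat.sub_sub_self hj']
    refine hQ.symm.trans ?_
    have := same_nxt (W := W) (W.rev (W.nxt^[j'] (a (i + 1 + 1))))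
    rwa [W.rev_rev] at this
  have hsx : W.nxt^[m i + 1 + s + 1] (a i) = W.nxt^[s + 1] x := by
    rw [← hxt, show m i + 1 + s + 1 = s + 1 + (m i + 1) by omega]
  have hd1 : ∀ u v, u < v → v ≤ m i + 1 + s + 1 →
      ¬ W.rot.SameCycle (W.nxt^[u] (a i)) (W.nxt^[v] (a i)) := by
    intro u v huv hv h
    rcases hv.lt_or_eq with hv | rfl
    · exact hdist u v huv (by omega) h
    · rw [hsx] at h
      rcases hQ' u (by omega) with h' | ⟨-, h'⟩
      exacts [h' h, h2 h']
  have hd2 : ∀ u v, u < v → v ≤ m (i + 1 + 1) - j' + 1 →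
      ¬ W.rot.SameCycle (W.nxt^[u] (W.rev q)) (W.nxt^[v] (W.rev q)) := by
    intro u v huv hv h
    exact hP.inj_head hn1 (u := m (i + 1 + 1) - v + 1) (v := m (i + 1 + 1) - u + 1) (by omega)
      (by omega) ((hqv v (by omega)).symm.trans (h.symm.trans (hqv u (by omega))))
  have hd3 : ∀ u v, 0 < u → u ≤ m i + 1 + s → 0 < v → v ≤ m (i + 1 + 1) - j' →
      ¬ W.rot.SameCycle (W.nxt^[u] (a i)) (W.nxt^[v] (W.rev q)) := by
    intro u v hu0 hu hv0 hv h
    have h6 := h.trans (hqv v (by omega))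
    have h7 : m (i + 1 + 1) - v + 1 ≤ m (i + 1 + 1) := by omega
    by_cases hu1 : u ≤ m i
    · exact h2 (hP.inj _ _ _ _ hu1 h7 h6).1.symm
    · obtain ⟨w, rfl⟩ := Nat.exists_eq_add_of_le (show m i + 1 ≤ u by omega)
      rw [add_comm (m i + 1) w, hxt] at h6
      rcases Nat.eq_zero_or_pos w with rfl | hw
      · exact h1 (hP.inj (i + 1) _ 0 _ (Nat.zero_le _) h7 (hxon.symm.trans h6)).1.symm
      · exact hs.not_on w hw (by omega) ((on_side h7).congr h6.symm)
  -- The prolonged side `i` and the third side read backwards cross at the corner `a i` and meet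
  -- again where the prolongation reaches the third side.
  obtain ⟨C', h3, h4, h5⟩ := exists_isSmall hpath
    ((hP.path (i + 1 + 1)).rev.mono (k := m (i + 1 + 1) - j') (by omega)) hcr hd1 hd2 hd3
    (by rw [hsx]; exact hend) (by rw [hsx]; exact hM.not_bdry_of_on hs.on)
  refine hM.min C' (Or.inl h3) (fun d hd => ?_) ⟨x, ?_, hx⟩
  · rcases h4 d hd with ⟨t, ht, rfl⟩ | ⟨t, ht, rfl⟩
    · exact Or.inl (hface t ht)
    · rw [← hq, hqt t (by omega), W.rev_rev]
      exact Or.inl (hM.side (by omega))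
  · have := h5 (0 + (m i + 1)) (by omega)
    rwa [hxt] at this

end IsMin

end

/-! ### Chords that cut off triangles; minimal monogons and bigons -/

section

variable {D F : Type*}

lemma forall_fin_three {P : Fin 3 → Prop} : (∀ i, P i) ↔ P 0 ∧ P 1 ∧ P 2 := by
  refine ⟨fun h => ⟨h 0, h 1, h 2⟩, fun h i => ?_⟩
  fin_cases i
  exacts [h.1, h.2.1, h.2.2]

lemma isPoly_triple {W : Web D F} {d₀ d₁ d₂ : D} {m₀ m₁ m₂ : ℕ}
    (p₀ : W.IsPath d₀ m₀) (p₁ : W.IsPath d₁ m₁) (p₂ : W.IsPath d₂ m₂)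
    (c₀ : W.Cross d₁ (W.rev (W.nxt^[m₀] d₀))) (c₁ : W.Cross d₂ (W.rev (W.nxt^[m₁] d₁)))
    (c₂ : W.Cross d₀ (W.rev (W.nxt^[m₂] d₂)))
    (h₀ : ∀ x y, x < y → y ≤ m₀ → ¬ W.rot.SameCycle (W.nxt^[x] d₀) (W.nxt^[y] d₀))
    (h₁ : ∀ x y, x < y → y ≤ m₁ → ¬ W.rot.SameCycle (W.nxt^[x] d₁) (W.nxt^[y] d₁))
    (h₂ : ∀ x y, x < y → y ≤ m₂ → ¬ W.rot.SameCycle (W.nxt^[x] d₂) (W.nxt^[y] d₂))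
    (k₀ : ∀ x y, x ≤ m₀ → y ≤ m₁ → ¬ W.rot.SameCycle (W.nxt^[x] d₀) (W.nxt^[y] d₁))
    (k₁ : ∀ x y, x ≤ m₁ → y ≤ m₂ → ¬ W.rot.SameCycle (W.nxt^[x] d₁) (W.nxt^[y] d₂))
    (k₂ : ∀ x y, x ≤ m₂ → y ≤ m₀ → ¬ W.rot.SameCycle (W.nxt^[x] d₂) (W.nxt^[y] d₀)) :
    W.IsPoly 3 ![d₀, d₁, d₂] ![m₀, m₁, m₂] :=
  isPoly_three (forall_fin_three.mpr ⟨p₀, p₁, p₂⟩) (forall_fin_three.mpr ⟨c₀, c₁, c₂⟩)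
    (forall_fin_three.mpr ⟨h₀, h₁, h₂⟩) (forall_fin_three.mpr ⟨k₀, k₁, k₂⟩)

lemma mem_darts_triple {W : Web D F} {d₀ d₁ d₂ : D} {m₀ m₁ m₂ : ℕ} {x : D} :
    x ∈ W.darts ![d₀, d₁, d₂] ![m₀, m₁, m₂] ↔ (∃ t ≤ m₀, x = W.nxt^[t] d₀) ∨
      (∃ t ≤ m₁, x = W.nxt^[t] d₁) ∨ ∃ t ≤ m₂, x = W.nxt^[t] d₂ := by
  constructor
  · rintro ⟨i, t, ht, h⟩
    revert t
    revert i
    rw [forall_fin_three]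
    exact ⟨fun t ht h => Or.inl ⟨t, ht, h⟩, fun t ht h => Or.inr (Or.inl ⟨t, ht, h⟩),
      fun t ht h => Or.inr (Or.inr ⟨t, ht, h⟩)⟩
  · rintro (⟨t, ht, h⟩ | ⟨t, ht, h⟩ | ⟨t, ht, h⟩)
    exacts [⟨0, t, ht, h⟩, ⟨1, t, ht, h⟩, ⟨2, t, ht, h⟩]

lemma cyc_triple {W : Web D F} {d₀ d₁ d₂ : D} {m₀ m₁ m₂ : ℕ}
    (h : W.Cyc ![d₀, d₁, d₂] ![m₀, m₁, m₂]) : ∃ ε : Prop,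
    (∀ t ≤ m₀, W.out (W.nxt^[t] d₀) ↔ ε) ∧ (∀ t ≤ m₁, W.out (W.nxt^[t] d₁) ↔ ε) ∧
      ∀ t ≤ m₂, W.out (W.nxt^[t] d₂) ↔ ε := by
  rcases h with h | h
  · exact ⟨True, fun t ht => iff_true_intro (h 0 t ht), fun t ht => iff_true_intro (h 1 t ht),
      fun t ht => iff_true_intro (h 2 t ht)⟩
  · exact ⟨False, fun t ht => iff_false_intro (h 0 t ht), fun t ht => iff_false_intro (h 1 t ht),
      fun t ht => iff_false_intro (h 2 t ht)⟩

/-- A strand runs through the inside of the polygon from an inner vertex of side `i` to an inner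
vertex of side `i'`. -/
structure Chord (W : Web D F) (Ω : Set F) {n : ℕ} (a : Fin n → D) (m : Fin n → ℕ) (i : Fin n)
    (j : ℕ) (i' : Fin n) (j' s : ℕ) : Prop where
  pos : 0 < j
  le : j ≤ m i
  pos' : 0 < j'
  le' : j' ≤ m i'
  exit : W.Exit (W.darts a m) Ω (W.rot (W.nxt^[j] (a i))) s
  last : W.rev (W.nxt^[s] (W.rot (W.nxt^[j] (a i)))) = W.rot (W.nxt^[j'] (a i'))

variable [Finite D] {W : Web D F} {Ω : Set F} {n : ℕ} [NeZero n] {a : Fin n → D} {m : Fin n → ℕ}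

lemma Exit.reverse {C : Set D} {x : D} {s : ℕ} (h : W.Exit C Ω x s) (hx : W.On C x) :
    W.Exit C Ω (W.rev (W.nxt^[s] x)) s := by
  have hv : ∀ t ≤ s, W.rot.SameCycle (W.nxt^[t] (W.rev (W.nxt^[s] x))) (W.nxt^[s + 1 - t] x) := by
    intro t ht
    rw [nxt_iterate_rev_of_le _ ht, show s + 1 - t = s - t + 1 by omega]
    exact same_rev_iterate _ _
  have hv' : W.rot.SameCycle (W.nxt^[s + 1] (W.rev (W.nxt^[s] x))) x := by
    refine (same_rev_iterate _ _).symm.trans ?_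
    rw [nxt_iterate_rev, W.rev_rev]
  refine ⟨h.path.rev, fun k hk => ?_, fun k h0 hk hon => ?_, hx.congr hv'.symm, ?_⟩
  · rw [nxt_iterate_rev_of_le _ hk]
    exact (h.ins _ (by omega)).rev
  · exact h.not_on (s + 1 - k) (by omega) (by omega) (hon.congr (hv k hk))
  · intro u v huv hv1 hs
    rcases hv1.lt_or_eq with hv2 | rfl
    · exact h.inj (s + 1 - v) (s + 1 - u) (by omega) (by omega)
        ((hv v (by omega)).symm.trans (hs.symm.trans (hv u (by omega))))
    · exact h.inj 0 (s + 1 - u) (by omega) (by omega)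
        (hv'.symm.trans (hs.symm.trans (hv u (by omega))))

omit [NeZero n] in
lemma Chord.symm {i i' : Fin n} {j j' s : ℕ} (h : W.Chord Ω a m i j i' j' s) :
    W.Chord Ω a m i' j' i j s := by
  refine ⟨h.pos', h.le', h.pos, h.le, ?_, ?_⟩
  · rw [← h.last]
    exact h.exit.reverse ((IsMin.on_side h.le).congr (same_rot _))
  · rw [← h.last, nxt_iterate_rev, W.rev_rev]

namespace IsMin

variable (hM : W.IsMin (W.darts a m) Ω) (hP : W.IsPoly n a m)

include hM hP

/-- A strand inside a polygon with convex corners ends at an inner vertex of a side. -/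
lemma exit_end (hn : n ≤ 3) (hn1 : n ≠ 1) {y : D} {t : ℕ} (h : W.Exit (W.darts a m) Ω y t) :
    ∃ i' j', 0 < j' ∧ j' ≤ m i' ∧ W.rev (W.nxt^[t] y) = W.rot (W.nxt^[j'] (a i')) := by
  obtain ⟨_, ⟨i', j', hj', rfl⟩, hQ⟩ := h.on
  set b := W.nxt^[j'] (a i') with hb
  have hbC : b ∈ W.darts a m := mem_darts hj'
  have hby : W.rot.SameCycle b (W.rev (W.nxt^[t] y)) := hQ.trans (same_rev_iterate _ _).symm
  have hy := (h.ins t le_rfl).rev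
  -- Turning counterclockwise, one stays outside until the outgoing dart `b` is reached. So the
  -- darts strictly inside lie between `b` and `rev p`: none at a convex corner, only `rot b` at an
  -- inner vertex of a side.
  have key : ∀ p ∈ W.darts a m, W.rot.SameCycle (W.rev p) b → ∀ z, W.rot.SameCycle b z →
      W.face z ∉ Ω → W.rot z = b ∨ W.face (W.rot z) ∉ Ω := by
    intro p hp hpb z hbz hz
    by_cases h1 : W.rot z = b
    · exact Or.inl h1
    · by_cases h2 : W.rot z = W.rev p
      · right
        rw [h2]
        exact hM.inner.right p hp
      · right
        rw [hM.inner.off, face_rev_rot]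
        · exact hz
        · exact fun h3 => h1 (hM.cycle.tail_inj _ h3 _ hbC (hbz.apply_right.symm))
        · intro h3
          apply h2
          rw [← W.rev_rev (W.rot z)]
          congr 1
          refine hM.cycle.head_inj h3 hp ?_
          rw [W.rev_rev]
          exact hbz.apply_right.symm.trans hpb.symm
  rcases Nat.eq_zero_or_pos j' with rfl | h0
  · exfalso
    have hcv := hM.convex hP hn hn1 (i' - 1)
    rw [sub_add_cancel] at hcv
    set p := W.nxt^[m (i' - 1)] (a (i' - 1)) with hp
    have hpC : p ∈ W.darts a m := mem_darts le_rfl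
    have hpb : W.rot.SameCycle (W.rev p) b := by rw [← hcv]; exact (same_rot _).symm
    have := sameCycle_induction hby (fun z => (z = b ∨ W.face z ∉ Ω) ∧ W.rot.SameCycle b z)
      ⟨Or.inl rfl, Equiv.Perm.SameCycle.refl _ _⟩ ?_
    · rcases this.1 with h1 | h1
      · rw [h1] at hy
        exact hM.inner.right b hbC hy.2
      · exact h1 hy.1
    · rintro z ⟨rfl | h1, h2⟩
      · refine ⟨Or.inr ?_, same_rot _⟩
        rw [hb, Function.iterate_zero, id, hcv]
        exact hM.inner.right p hpC
      · exact ⟨key p hpC hpb z h2 h1, h2.apply_right⟩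
  · refine ⟨i', j', h0, hj', ?_⟩
    have hT : W.IsT b := hP.isT h0 hj'
    obtain ⟨j', rfl⟩ := Nat.exists_eq_add_of_le' h0
    set p := W.nxt^[j'] (a i') with hp
    have hpC : p ∈ W.darts a m := mem_darts (by omega)
    have hpb' : W.rev p = W.rot (W.rot b) := by rw [hp, rev_eq_opp, ← hb, opp_of_isT hT]
    have hpb : W.rot.SameCycle (W.rev p) b := same_rev_iterate _ _
    have := sameCycle_induction hby
      (fun z => (z = b ∨ z = W.rot b ∨ W.face z ∉ Ω) ∧ W.rot.SameCycle b z)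
      ⟨Or.inl rfl, Equiv.Perm.SameCycle.refl _ _⟩ ?_
    · rcases this.1 with h1 | h1 | h1
      · rw [h1] at hy
        exact absurd hy.2 (hM.inner.right b hbC)
      · exact h1
      · exact absurd hy.1 h1
    · rintro z ⟨rfl | rfl | h1, h2⟩
      · exact ⟨Or.inr (Or.inl rfl), same_rot _⟩
      · refine ⟨Or.inr (Or.inr ?_), (same_rot _).trans (same_rot _)⟩
        rw [← hpb']
        exact hM.inner.right p hpC
      · refine ⟨(key p hpC hpb z h2 h1).imp_right Or.inr, h2.apply_right⟩

lemma exists_chord (hn : n ≤ 3) (hn1 : n ≠ 1) {i : Fin n} {j : ℕ} (h0 : 0 < j) (hj : j ≤ m i) :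
    ∃ i' j' s, i' ≠ i ∧ W.Chord Ω a m i j i' j' s := by
  obtain ⟨s, hs⟩ := hM.exists_exit (hM.ins_straight hP h0 hj)
  obtain ⟨i', j', h1, h2, h3⟩ := hM.exit_end hP hn hn1 hs
  refine ⟨i', j', s, ?_, h0, hj, h1, h2, hs, h3⟩
  rintro rfl
  refine hM.no_chord_same_side hP hj h2 (hP.isT h0 hj) hs ?_
  refine (same_rev_iterate _ _).symm.trans ?_
  rw [h3]
  exact (same_rot _).symm

omit hM in
/-- A chord between two neighbouring sides cuts off a triangle. -/
lemma _root_.A3.Web.IsPoly.isPoly_cut (hn1 : n ≠ 1) {i : Fin n} {j j' s : ℕ} (h : W.Chord Ω a m i j (i + 1) j' s) :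
    W.IsPoly 3 ![W.nxt^[j] (a i), a (i + 1), W.rot (W.nxt^[j'] (a (i + 1)))]
      ![m i - j, j' - 1, s] := by
  have hii : i ≠ i + 1 := by
    intro h
    have h1 : (1 : Fin n) = 0 := left_eq_add.mp h
    have h2 := congrArg Fin.val h1
    have h3 : 1 < n := by have := NeZero.ne n; omega
    rw [Fin.val_one', Fin.val_zero, Nat.mod_eq_of_lt h3] at h2
    omega
  have hj := h.le
  have hj' := h.le'
  have h0 := h.pos
  have h0' := h.pos'
  have hT := hP.isT h0 hj
  have hT' := hP.isT h0' hj'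
  have key : ∀ t, W.nxt^[t] (W.nxt^[j] (a i)) = W.nxt^[t + j] (a i) :=
    fun t => (Function.iterate_add_apply _ _ _ _).symm
  have hx' : ∀ t ≤ s, 0 < t → ∀ i₁ j₁, j₁ ≤ m i₁ →
      ¬ W.rot.SameCycle (W.nxt^[t] (W.rot (W.nxt^[j'] (a (i + 1))))) (W.nxt^[j₁] (a i₁)) :=
    fun t ht h0 i₁ j₁ h1 hs => h.symm.exit.not_on t h0 ht ((on_side h1).congr hs.symm)
  have hx0 : ∀ i₁ j₁, j₁ ≤ m i₁ → (i₁ ≠ i + 1 ∨ j₁ ≠ j') →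
      ¬ W.rot.SameCycle (W.rot (W.nxt^[j'] (a (i + 1)))) (W.nxt^[j₁] (a i₁)) := by
    intro i₁ j₁ h1 h2 hs
    have := hP.inj _ _ _ _ hj' h1 ((same_rot _).trans hs)
    rcases h2 with h2 | h2
    exacts [h2 this.1.symm, h2 this.2.symm]
  have hx : ∀ t ≤ s, ∀ i₁ j₁, j₁ ≤ m i₁ → (i₁ ≠ i + 1 ∨ j₁ ≠ j') →
      ¬ W.rot.SameCycle (W.nxt^[t] (W.rot (W.nxt^[j'] (a (i + 1))))) (W.nxt^[j₁] (a i₁)) := by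
    intro t ht i₁ j₁ h1 h2
    rcases Nat.eq_zero_or_pos t with rfl | h3
    exacts [hx0 i₁ j₁ h1 h2, hx' t ht h3 i₁ j₁ h1]
  refine isPoly_triple ((hP.path i).shift _ _ (by omega)) ((hP.path (i + 1)).mono (by omega))
    h.symm.exit.path ?_ ?_ ?_ ?_ ?_ ?_ ?_ ?_ ?_
  · rw [key, Nat.sub_add_cancel hj]
    exact hP.corner hn1 i
  · rw [rev_eq_opp, Nat.sub_add_cancel h0']
    exact (isT_cross hT').symm.opp_right hT'.rot
  · rw [h.symm.last]
    exact isT_cross hT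
  · intro x y hxy hy hs
    rw [key, key] at hs
    have := (hP.inj _ _ _ _ (by omega) (by omega) hs).2
    omega
  · intro x y hxy hy hs
    have := (hP.inj _ _ _ _ (by omega) (by omega) hs).2
    omega
  · exact fun x y hxy hy => h.symm.exit.inj x y hxy (by omega)
  · intro x y hx hy hs
    rw [key] at hs
    exact hii (hP.inj _ _ _ _ (by omega) (by omega) hs).1
  · exact fun x y hx1 hy hs => hx y hy _ x (by omega) (Or.inr (by omega)) hs.symm
  · intro x y hx1 hy hs
    rw [key] at hs
    exact hx x hx1 i _ (by omega) (Or.inl hii) hs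

omit hP in
lemma cut_touches {i : Fin n} {j j' s : ℕ} (h : W.Chord Ω a m i j (i + 1) j' s) :
    ∀ d ∈ W.darts ![W.nxt^[j] (a i), a (i + 1), W.rot (W.nxt^[j'] (a (i + 1)))]
      ![m i - j, j' - 1, s], W.face d ∈ Ω ∨ W.face (W.rev d) ∈ Ω := by
  have hj := h.le
  have hj' := h.le'
  intro d hd
  rcases mem_darts_triple.mp hd with ⟨t, ht, rfl⟩ | ⟨t, ht, rfl⟩ | ⟨t, ht, rfl⟩
  · rw [← Function.iterate_add_apply]
    exact Or.inl (hM.side (by omega))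
  · exact Or.inl (hM.side (by omega))
  · exact Or.inl (h.symm.exit.ins t ht).1

/-- By minimality the triangle that the chord cuts off is a directed cycle, of direction `ε`. It
traverses the chord from side `i + 1` to side `i`, so the chord read from side `i` has the opposite
direction. -/
lemma chord_signs (hn1 : n ≠ 1) {i : Fin n} {j j' s : ℕ} (h : W.Chord Ω a m i j (i + 1) j' s) :
    ∃ ε : Prop, (∀ k, j ≤ k → k ≤ m i → (W.out (W.nxt^[k] (a i)) ↔ ε)) ∧
      (∀ k < j', W.out (W.nxt^[k] (a (i + 1))) ↔ ε) ∧
      (∀ k ≤ s, W.out (W.nxt^[k] (W.rot (W.nxt^[j'] (a (i + 1))))) ↔ ε) ∧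
      (∀ k ≤ s, W.out (W.nxt^[k] (W.rot (W.nxt^[j] (a i)))) ↔ ¬ ε) := by
  have hpoly := hP.isPoly_cut hn1 h
  have hcyc : W.Cyc ![W.nxt^[j] (a i), a (i + 1), W.rot (W.nxt^[j'] (a (i + 1)))]
      ![m i - j, j' - 1, s] := by
    by_contra hc
    exact hM.min _ (Or.inr ⟨_, _, hpoly, hc, rfl⟩) (hM.cut_touches h)
      ⟨_, mem_darts_zero 2, h.symm.exit.ins 0 (Nat.zero_le _)⟩
  obtain ⟨ε, h1, h2, h3⟩ := cyc_triple hcyc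
  have h0' := h.pos'
  refine ⟨ε, fun k hk hk' => ?_, fun k hk => h2 k (by omega), h3, fun k hk => ?_⟩
  · have := h1 (k - j) (by omega)
    rwa [← Function.iterate_add_apply, Nat.sub_add_cancel hk] at this
  · have h4 : W.nxt^[k] (W.rot (W.nxt^[j] (a i))) =
        W.rev (W.nxt^[s - k] (W.rot (W.nxt^[j'] (a (i + 1))))) := by
      rw [← h.symm.last, nxt_iterate_rev_of_le _ hk]
    rw [h4, W.out_rev, h3 _ (by omega)]
    exact h.symm.exit.path.not_dbl (hP.isT h.pos' h.le').rot.not_dbl (by omega)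

omit hM in
lemma _root_.A3.Web.IsPoly.rev_straight {i : Fin n} {j : ℕ} (hj : j + 1 ≤ m i) :
    W.rev (W.nxt^[j] (a i)) = W.rot (W.rot (W.nxt^[j + 1] (a i))) := by
  rw [rev_eq_opp, opp_of_isT (hP.isT (Nat.succ_pos j) hj)]

/-- The strand of a side keeps its direction where a chord starts. -/
lemma chord_start (hn1 : n ≠ 1) {i : Fin n} {j j' s : ℕ}
    (h : W.Chord Ω a m i (j + 1) (i + 1) j' s) :
    W.out (W.nxt^[j] (a i)) ↔ W.out (W.nxt^[j + 1] (a i)) := by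
  obtain ⟨ε, h1, -, -, h2⟩ := hM.chord_signs hP hn1 h
  have h3 := h1 _ le_rfl h.le
  have h4 := h2 0 (Nat.zero_le _)
  have hT := hP.isT h.pos h.le
  have h5 := W.out_rev (W.nxt^[j] (a i)) (by
    rw [← W.dbl_rev, hP.rev_straight h.le]; exact hT.rot.rot.not_dbl)
  rw [hP.rev_straight h.le] at h5
  -- The side and the chord leave this vertex in opposite directions, so the pattern pairs the chord
  -- with the preceding edge of the side.
  have h6 := hT.pattern
  simp only [Function.iterate_zero, id] at h4
  tauto

lemma chord_end (hn1 : n ≠ 1) {i : Fin n} {j j' s : ℕ}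
    (h : W.Chord Ω a m i j (i + 1) (j' + 1) s) :
    W.out (W.nxt^[j'] (a (i + 1))) ↔ W.out (W.nxt^[j' + 1] (a (i + 1))) := by
  obtain ⟨ε, -, h1, h2, -⟩ := hM.chord_signs hP hn1 h
  have h3 := h1 _ (Nat.lt_succ_self _)
  have h4 := h2 0 (Nat.zero_le _)
  have hT := hP.isT h.pos' h.le'
  have h5 := W.out_rev (W.nxt^[j'] (a (i + 1))) (by
    rw [← W.dbl_rev, hP.rev_straight h.le']; exact hT.rot.rot.not_dbl)
  rw [hP.rev_straight h.le'] at h5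
  -- Here the chord and the preceding edge, both read away from the vertex, have opposite
  -- directions, so the chord is paired with the following edge of the side.
  have h6 := hT.pattern
  simp only [Function.iterate_zero, id] at h4
  tauto

omit hP in
/-- A minimal polygon all whose sides are single edges bounds a face. -/
lemma isPolygon_of_length (hP : W.IsPoly n a m)
    (hcv : ∀ i, W.rot (a (i + 1)) = W.rev (W.nxt^[m i] (a i)))
    (hm : ∀ i, m i = 0) : W.IsPolygon a := by
  refine hM.isPolygon (fun i i' h => (hP.inj i i' 0 0 (Nat.zero_le _) (Nat.zero_le _) ?_).1)
    (fun i => ?_) (hM.side (i := 0) (Nat.zero_le _)) (mem_darts_zero 0) hP.not_bdry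
  · simp only [Function.iterate_zero, id, h]
    exact Equiv.Perm.SameCycle.refl _ _
  · rw [hcv, hm]
    rfl

end IsMin

/-- An inner vertex of the side, or a reflex closing vertex, would send a strand into the inside,
which could only return to the same side. -/
lemma IsMin.face_of_one {a : Fin 1 → D} {m : Fin 1 → ℕ} (hM : W.IsMin (W.darts a m) Ω)
    (hP : W.IsPoly 1 a m) : W.HasReducibleFace := by
  have hno : ∀ i j, j ≤ m i → W.IsT (W.nxt^[j] (a i)) → ¬ W.Ins Ω (W.rot (W.nxt^[j] (a i))) := by
    intro i j hj hT hx
    obtain ⟨s, hs⟩ := hM.exists_exit hx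
    obtain ⟨_, ⟨i', j', hj', rfl⟩, hQ⟩ := hs.on
    obtain rfl : i' = i := Subsingleton.elim _ _
    exact hM.no_chord_same_side hP hj hj' hT hs hQ.symm
  have hm : ∀ i, m i = 0 := by
    intro i
    by_contra h
    have h0 : 0 < m i := Nat.pos_of_ne_zero h
    exact hno i 1 h0 (hP.isT one_pos h0) (hM.ins_straight hP one_pos h0)
  refine Or.inl ⟨a, hM.isPolygon_of_length hP (fun i => ?_) hm⟩
  by_contra hne
  have h1 : W.rot.SameCycle (W.rev (W.nxt^[m i] (a i))) (a (i + 1)) :=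
    (same_rev_iterate _ _).trans (hP.head i)
  have hx := hM.inner.ins_rot hM.cycle (mem_darts le_rfl) (mem_darts_zero (i + 1)) h1 hne
  exact hno (i + 1) 0 (Nat.zero_le _)
    (hM.isT_of_ins_rot (mem_darts_zero _) (mem_darts le_rfl) h1 hx) hx

/-- A chord would cut off directed triangles at both corners. At its end these give three
consecutive darts of alternating directions, which contradicts `IsT.pattern`. -/
lemma IsMin.face_of_two {a : Fin 2 → D} {m : Fin 2 → ℕ} (hM : W.IsMin (W.darts a m) Ω)
    (hP : W.IsPoly 2 a m) : W.HasReducibleFace := by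
  have hm : ∀ i, m i = 0 := by
    intro i
    by_contra h
    have h0 : 0 < m i := Nat.pos_of_ne_zero h
    obtain ⟨i', j', s, hne, hc⟩ := hM.exists_chord hP (by decide) (by decide) one_pos h0
    obtain rfl : i' = i + 1 := (fin_two_cases i i').resolve_left hne
    have hii : i = i + 1 + 1 := by clear * -; revert i; decide
    have hc' := hc.symm
    have hc'' : W.Chord Ω a m (i + 1) j' (i + 1 + 1) 1 s := by rwa [← hii]
    obtain ⟨ε, h1, -, -, h2⟩ := hM.chord_signs hP (by decide) hc
    obtain ⟨ε', -, h3, h4, -⟩ := hM.chord_signs hP (by decide) hc''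
    have h5 := h1 1 le_rfl h0
    have h6 := h2 0 (Nat.zero_le _)
    have h7 := h3 0 one_pos
    have h8 := h4 0 (Nat.zero_le _)
    rw [← hii] at h7 h8
    have hT := hP.isT one_pos h0
    have h9 := W.out_rev (W.nxt^[0] (a i)) (by
      rw [← W.dbl_rev, hP.rev_straight h0]; exact hT.rot.rot.not_dbl)
    rw [hP.rev_straight h0] at h9
    have h10 := hT.pattern
    simp only [Function.iterate_zero, id, zero_add] at *
    tauto
  exact Or.inr (Or.inl ⟨a, hM.isPolygon_of_length hP
    (fun i => hM.convex hP (by decide) (by decide) i) hm⟩)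

end

section

variable {D F : Type*} [Finite D] {W : Web D F} {Ω : Set F}

/-! ### Minimal triangles -/

omit [Finite D] in
lemma Exit.unique {C : Set D} {x : D} {s t : ℕ} (h : W.Exit C Ω x s) (h' : W.Exit C Ω x t) :
    s = t := by
  by_contra hne
  rcases lt_or_gt_of_ne hne with h1 | h1
  · exact h'.not_on (s + 1) (by omega) (by omega) h.on
  · exact h.not_on (t + 1) (by omega) (by omega) h'.on

namespace IsMin

variable {a : Fin 3 → D} {m : Fin 3 → ℕ} (hM : W.IsMin (W.darts a m) Ω) (hP : W.IsPoly 3 a m)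

include hM hP

lemma chord_cases {i : Fin 3} {j : ℕ} (h0 : 0 < j) (hj : j ≤ m i) :
    (∃ j' s, W.Chord Ω a m i j (i + 1) j' s) ∨
      ∃ j' s, W.Chord Ω a m (i + 1 + 1) j' (i + 1 + 1 + 1) j s := by
  obtain ⟨i', j', s, hne, hc⟩ := hM.exists_chord hP le_rfl (by decide) h0 hj
  rcases (fin_three_cases i i').resolve_left hne with rfl | rfl
  · exact Or.inl ⟨j', s, hc⟩
  · refine Or.inr ⟨j', s, ?_⟩
    rw [fin_three_add]
    exact hc.symm

/-- At every inner vertex of a side a chord starts or ends, and the side keeps its direction there.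
This is what turns undirected triangles into directed ones. -/
lemma out_side {i : Fin 3} {j : ℕ} (hj : j ≤ m i) : W.out (W.nxt^[j] (a i)) ↔ W.out (a i) := by
  induction j with
  | zero => rfl
  | succ j ih =>
    rw [← ih (by omega)]
    rcases hM.chord_cases hP (Nat.succ_pos j) hj with ⟨j', s, hc⟩ | ⟨j', s, hc⟩
    · exact (hM.chord_start hP (by decide) hc).symm
    · have := (hM.chord_end hP (by decide) hc).symm
      rwa [fin_three_add] at this

lemma out_of_chord {i : Fin 3} {j j' s : ℕ} (hc : W.Chord Ω a m i j (i + 1) j' s) :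
    W.out (a i) ↔ W.out (a (i + 1)) := by
  obtain ⟨ε, h1, h2, -⟩ := hM.chord_signs hP (by decide) hc
  rw [← hM.out_side hP hc.le, h1 j le_rfl hc.le]
  exact (h2 0 hc.pos').symm

/-- The first chord of a corner consists of one edge. -/
lemma chord_length {i : Fin 3} {j' s : ℕ} (hc : W.Chord Ω a m i 1 (i + 1) j' s)
    (h2 : m (i + 1 + 1) = 0) : s = 0 := by
  by_contra hs
  have hs0 : 0 < s := Nat.pos_of_ne_zero hs
  set x := W.rot (W.nxt^[1] (a i)) with hx
  have hTP : W.IsT (W.nxt^[1] (a i)) := hP.isT one_pos hc.le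
  have hRon : ¬ W.On (W.darts a m) (W.nxt x) := hc.exit.not_on 1 one_pos hs0
  have hRx : W.rot.SameCycle (W.rev x) (W.nxt x) := same_nxt x
  have hTR : W.IsT (W.nxt x) := by
    rcases hc.exit.path.pass one_pos hs0 with h | h
    · exact h
    · exfalso
      refine hc.exit.inj 0 1 one_pos (by omega) ?_
      change W.rot.SameCycle x (W.nxt x)
      rw [nxt_of_isL (IsL.congr h hRx.symm)]
  -- If the chord has more than one edge, another strand crosses it at the end of its first edge;
  -- `y` is a dart of that strand.
  set y := W.rot (W.nxt x) with hy
  have hyC : W.Cross (W.rev x) y := by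
    have := (isT_cross hTR).opp_left hTR
    rwa [nxt, opp_opp] at this
  have hyI : W.Ins Ω y := by
    refine hM.ins_of_not_on (fun h => hRon (h.congr (same_rot _).symm)) ?_
    exact (hM.inner.face_iff hM.cycle hRon (same_rot _)).mp (hc.exit.ins 1 hs0).1
  have hyR : W.rot.SameCycle (W.nxt x) y := same_rot _
  obtain ⟨t, ht⟩ := hM.exists_exit hyI
  obtain ⟨i', k, hk0, hk, hz⟩ := hM.exit_end hP le_rfl (by decide) ht
  -- The crossing strand lies on a chord between sides `i` and `i + 1`, since the third side has no
  -- inner vertices. It starts at vertex `je` of side `i`, and its dart number `u` ends at the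
  -- crossing with the given chord.
  have key : ∃ je js s2 u, W.Chord Ω a m i je (i + 1) js s2 ∧ u < s2 ∧
      W.Cross (W.rev x) (W.rev (W.nxt^[u] (W.rot (W.nxt^[je] (a i))))) := by
    have hzt : W.nxt^[t] (W.rot (W.nxt^[k] (a i'))) = W.rev y := by
      rw [← hz, nxt_iterate_rev]
    have hlt : ∀ s2, W.Exit (W.darts a m) Ω (W.rot (W.nxt^[k] (a i'))) s2 → t < s2 := by
      intro s2 h2
      by_contra hle
      rcases (show s2 < t ∨ s2 = t by omega) with h3 | h3
      · refine ht.not_on (t - s2) (by omega) (by omega) ?_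
        refine h2.on.congr ?_
        rw [← hz]
        have := nxt_iterate_rev_of_le (W := W) y (show s2 ≤ t by omega)
        rw [Function.iterate_succ_apply', this]
        refine (same_nxt _).symm.trans ?_
        rw [W.rev_rev]
      · subst h3
        refine hRon (h2.on.congr ?_)
        rw [Function.iterate_succ_apply', hzt]
        refine (same_nxt _).symm.trans ?_
        rw [W.rev_rev]
        exact hyR.symm
    rcases fin_three_cases i i' with rfl | rfl | rfl
    · rcases hM.chord_cases hP hk0 hk with ⟨js, s2, h3⟩ | ⟨js, s2, h3⟩
      · refine ⟨k, js, s2, t, h3, hlt s2 h3.exit, ?_⟩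
        rw [hzt, W.rev_rev]
        exact hyC
      · have := h3.le; have := h3.pos; omega
    · rcases hM.chord_cases hP hk0 hk with ⟨js, s2, h3⟩ | ⟨js, s2, h3⟩
      · have := h3.le'; have := h3.pos'; omega
      · rw [fin_three_add] at h3
        have h4 := hlt s2 h3.symm.exit
        refine ⟨js, k, s2, s2 - (t + 1), h3, by omega, ?_⟩
        have h5 := nxt_iterate_rev_of_le (W := W) (W.rot (W.nxt^[k] (a (i + 1))))
          (show s2 - (t + 1) ≤ s2 by omega)
        rw [h3.symm.last] at h5
        rw [h5, W.rev_rev, Nat.sub_sub_self (by omega), Function.iterate_succ_apply', hzt, nxt,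
          W.rev_rev]
        exact hyC.opp_right (hTR.congr hRx.symm)
    · omega
  obtain ⟨je, js, s2, u, h3, hu, hcr⟩ := key
  set x2 := W.rot (W.nxt^[je] (a i)) with hx2
  have hRu : W.rot.SameCycle (W.rev x) (W.nxt^[u + 1] x2) :=
    hcr.same.trans (same_rev_iterate _ _)
  have hje : 2 ≤ je := by
    by_contra hlt
    obtain rfl : je = 1 := by have := h3.pos; omega
    rw [← hx] at hx2
    rw [hx2] at hRu hcr
    have h4 : u = 0 := by
      by_contra hu0
      exact hc.exit.inj 1 (u + 1) (by omega) (by have := h3.exit.unique hc.exit; omega)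
        (hRx.symm.trans hRu)
    subst h4
    exact hcr.ne rfl
  have hTe : W.IsT (W.nxt^[je] (a i)) := hP.isT h3.pos h3.le
  have hle := h3.le
  have hit : ∀ t, W.nxt^[t] (W.nxt^[1] (a i)) = W.nxt^[t + 1] (a i) :=
    fun t => (Function.iterate_add_apply _ _ _ _).symm
  -- The triangle between side `i` and the two chords.
  have hpoly : W.IsPoly 3 ![W.nxt^[1] (a i), x2, W.rev x] ![je - 2, u, 0] := by
    refine isPoly_triple ((hP.path i).shift _ _ (by omega)) (h3.exit.path.mono hu.le)
      (fun t ht => absurd ht (by omega)) ?_ ?_ ?_ ?_ ?_ ?_ ?_ ?_ ?_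
    · rw [hit, rev_eq_opp, show je - 2 + 1 + 1 = je by omega]
      exact (isT_cross hTe).symm.opp_right hTe.rot
    · exact hcr
    · simp only [Function.iterate_zero, id, W.rev_rev]
      exact isT_cross hTP
    · intro p q hpq hq hs
      rw [hit, hit] at hs
      have := (hP.inj _ _ _ _ (by omega) (by omega) hs).2
      omega
    · exact fun p q hpq hq => h3.exit.inj p q hpq (by omega)
    · intro p q hpq hq; omega
    · intro p q hp hq hs
      rw [hit] at hs
      rcases Nat.eq_zero_or_pos q with rfl | hq0
      · have := (hP.inj _ _ _ _ (by omega) hle (hs.trans (same_rot _).symm)).2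
        omega
      · exact h3.exit.not_on q hq0 (by omega) ((on_side (by omega)).congr hs)
    · intro p q hp hq hs
      obtain rfl : q = 0 := by omega
      exact h3.exit.inj p (u + 1) (by omega) (by omega) (hs.trans hRu)
    · intro p q hp hq hs
      obtain rfl : p = 0 := by omega
      rw [hit] at hs
      exact hRon ((on_side (show q + 1 ≤ m i by omega)).congr (hs.symm.trans hRx))
  -- By `chord_signs` the second chord leaves side `i` with the direction opposite to that of the
  -- side.
  have hncyc : ¬ W.Cyc ![W.nxt^[1] (a i), x2, W.rev x] ![je - 2, u, 0] := by
    intro hcyc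
    obtain ⟨ε, e1, e2, -⟩ := cyc_triple hcyc
    obtain ⟨ε', f1, -, -, f2⟩ := hM.chord_signs hP (by decide) h3
    have g1 := e1 0 (Nat.zero_le _)
    have g2 := e2 0 (Nat.zero_le _)
    have g3 := f1 je le_rfl hle
    have g4 := f2 0 (Nat.zero_le _)
    simp only [Function.iterate_zero, id] at g1 g2 g4
    rw [hM.out_side hP hc.le] at g1
    rw [hM.out_side hP hle] at g3
    tauto
  refine hM.min _ (Or.inr ⟨_, _, hpoly, hncyc, rfl⟩) (fun d hd => ?_)
    ⟨_, mem_darts_zero 1, h3.exit.ins 0 (Nat.zero_le _)⟩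
  rcases mem_darts_triple.mp hd with ⟨t, ht, rfl⟩ | ⟨t, ht, rfl⟩ | ⟨t, ht, rfl⟩
  · rw [hit]
    exact Or.inl (hM.side (by omega))
  · exact Or.inl (h3.exit.ins t (by omega)).1
  · obtain rfl : t = 0 := by omega
    exact Or.inl (hc.exit.ins 0 (Nat.zero_le _)).2

/-- The first chord of a corner ends at the last vertex of the other side. -/
lemma chord_last {i : Fin 3} {j' : ℕ} (hc : W.Chord Ω a m i 1 (i + 1) j' 0)
    (h2 : m (i + 1 + 1) = 0) : j' = m (i + 1) := by
  by_contra hne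
  have hlt : j' < m (i + 1) := lt_of_le_of_ne hc.le' hne
  rcases hM.chord_cases hP (i := i + 1) (j := m (i + 1)) (by omega) le_rfl with
    ⟨js, s2, h3⟩ | ⟨k, s2, h3⟩
  · have := h3.le'; have := h3.pos'; omega
  rw [fin_three_add] at h3
  -- The chord at the last vertex of side `i + 1` differs from the first chord, so it starts on side
  -- `i` strictly beyond the first vertex.
  have hk1 : k ≠ 1 := by
    rintro rfl
    obtain rfl := h3.exit.unique hc.exit
    have h4 := W.rot.injective (hc.last.symm.trans h3.last)
    have := (hP.inj _ _ _ _ hc.le' le_rfl (by rw [h4])).2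
    omega
  have hk0 := h3.pos
  have hk := h3.le
  have hpoly := hP.isPoly_cut (by decide) hc
  set C₁ := W.darts ![W.nxt^[1] (a i), a (i + 1), W.rot (W.nxt^[j'] (a (i + 1)))]
    ![m i - 1, j' - 1, 0] with hC₁
  have hcyc : W.IsCycle C₁ := hpoly.isCycle
  have htouch := hM.cut_touches hc
  have hit : ∀ t, W.nxt^[t] (W.nxt^[1] (a i)) = W.nxt^[t + 1] (a i) :=
    fun t => (Function.iterate_add_apply _ _ _ _).symm
  have hmem : ∀ t, 0 < t → t ≤ m i → W.nxt^[t] (a i) ∈ C₁ := by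
    intro t h0 ht
    refine mem_darts_triple.mpr (Or.inl ⟨t - 1, by omega, ?_⟩)
    rw [hit, Nat.sub_add_cancel h0]
  -- The cut-off triangle is directed counterclockwise, since it shares edges with the big curve;
  -- otherwise their right sides would lie in `Ω`.
  obtain ⟨Ω₁, hin, hsub⟩ : ∃ Ω₁, W.IsInner C₁ Ω₁ ∧ Ω₁ ⊆ Ω := by
    obtain ⟨Ω₁, h4 | h4⟩ := hcyc.exists_inner
    · exact ⟨Ω₁, h4, hM.inner.subset hM.cycle h4 htouch⟩
    · exfalso
      have hsub := hM.inner.subset hM.cycle h4 (fun d hd => by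
        have := htouch _ hd
        rw [W.rev_rev] at this
        exact this.symm)
      refine hM.inner.right _ (mem_darts (i := i) hc.le) (hsub (h4.left _ ?_))
      change W.rev (W.rev _) ∈ C₁
      rw [W.rev_rev]
      exact hmem 1 one_pos hc.le
  have hon : ∀ y, W.On C₁ y → (∃ t ≤ m i, W.rot.SameCycle (W.nxt^[t] (a i)) y) ∨
      ∃ t ≤ j', W.rot.SameCycle (W.nxt^[t] (a (i + 1))) y := by
    rintro y ⟨c, hcm, hcy⟩
    rcases mem_darts_triple.mp hcm with ⟨t, ht, rfl⟩ | ⟨t, ht, rfl⟩ | ⟨t, ht, rfl⟩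
    · rw [hit] at hcy
      exact Or.inl ⟨t + 1, by have := hc.le; omega, hcy⟩
    · exact Or.inr ⟨t, by omega, hcy⟩
    · obtain rfl : t = 0 := by omega
      exact Or.inr ⟨j', le_rfl, (same_rot _).trans hcy⟩
  -- This chord starts inside the cut-off triangle and cannot leave it: the first chord is a single
  -- edge, without vertices to cross it at, and the sides are reached only at the end.
  have hins : ∀ t ≤ s2, W.Ins Ω₁ (W.nxt^[t] (W.rot (W.nxt^[k] (a i)))) := by
    intro t
    induction t with
    | zero =>
      intro _
      have hT := hP.isT hk0 hk
      refine hin.ins_rot hcyc (hmem (k - 1) (by omega) (by omega)) (hmem k hk0 hk) ?_ ?_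
      · have := same_rev_iterate (W := W) (a i) (k - 1)
        rwa [Nat.sub_add_cancel hk0] at this
      · rw [rev_eq_opp, Nat.sub_add_cancel hk0, opp_of_isT hT]
        exact fun h => (isT_cross hT.rot).ne h
    | succ t ih =>
      intro ht
      have h4 := (ih (by omega)).2
      have h5 : ¬ W.On C₁ (W.nxt^[t + 1] (W.rot (W.nxt^[k] (a i)))) := by
        intro h
        refine h3.exit.not_on (t + 1) (by omega) ht ?_
        rcases hon _ h with ⟨v, hv, h6⟩ | ⟨v, hv, h6⟩
        · exact (on_side hv).congr h6
        · exact (on_side (by omega)).congr h6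
      have h6 := (hin.face_iff hcyc (fun h => h5 (h.congr (same_rev_iterate _ _)))
        (same_rev_iterate _ _)).mp h4
      have h7 := not_on_mem hcyc h5
      exact ⟨h6, (hin.off _ h7.1 h7.2).mp h6⟩
  have h4 := (hins s2 le_rfl).2
  rw [h3.last] at h4
  -- The end of the chord lies beyond the cut-off triangle, so all regions around it would be in
  -- `Ω₁`, even the one on the right of side `i + 1`.
  have h5 : ¬ W.On C₁ (W.rot (W.nxt^[m (i + 1)] (a (i + 1)))) := by
    intro h
    have hii : ∀ i : Fin 3, i ≠ i + 1 := by decide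
    rcases hon _ h with ⟨v, hv, h6⟩ | ⟨v, hv, h6⟩
    · exact hii i (hP.inj _ _ _ _ hv le_rfl (h6.trans (same_rot _).symm)).1
    · have := (hP.inj _ _ _ _ (by omega) le_rfl (h6.trans (same_rot _).symm)).2
      omega
  have h6 := same_rev_iterate (W := W) (a (i + 1)) (m (i + 1) - 1)
  rw [Nat.sub_add_cancel (by omega)] at h6
  have h7 := (hin.face_iff hcyc h5 ((same_rot _).symm.trans h6.symm)).mp h4
  exact hM.inner.right _ (mem_darts (by omega)) (hsub h7)

/-- A minimal triangle that is not a directed cycle. -/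
theorem structure_of_three (hC : ¬ W.Cyc a m) : ∃ i, ∃ ε : Prop,
    (∀ k ≤ m i, W.out (W.nxt^[k] (a i)) ↔ ε) ∧
    (∀ k ≤ m (i + 1), W.out (W.nxt^[k] (a (i + 1))) ↔ ε) ∧
    (W.out (a (i + 1 + 1)) ↔ ¬ ε) ∧ m (i + 1 + 1) = 0 ∧
    ((m i = 0 ∧ m (i + 1) = 0) ∨
      (0 < m i ∧ 0 < m (i + 1) ∧ W.Chord Ω a m i 1 (i + 1) (m (i + 1)) 0)) := by
  have hsign : ∃ i, (W.out (a i) ↔ W.out (a (i + 1))) ∧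
      (W.out (a (i + 1 + 1)) ↔ ¬ W.out (a i)) := by
    have h1 : ¬ ((∀ i, W.out (a i)) ∨ ∀ i, ¬ W.out (a i)) := by
      rintro (h | h)
      · exact hC (Or.inl fun i j hj => (hM.out_side hP hj).mpr (h i))
      · exact hC (Or.inr fun i j hj => fun h' => h i ((hM.out_side hP hj).mp h'))
    rw [forall_fin_three, forall_fin_three] at h1
    by_cases e0 : W.out (a 0) <;> by_cases e1 : W.out (a 1) <;> by_cases e2 : W.out (a 2)
    · tauto
    · exact ⟨0, iff_of_true e0 e1, iff_of_false e2 (not_not.mpr e0)⟩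
    · exact ⟨2, iff_of_true e2 e0, iff_of_false e1 (not_not.mpr e2)⟩
    · exact ⟨1, iff_of_false e1 e2, iff_of_true e0 e1⟩
    · exact ⟨1, iff_of_true e1 e2, iff_of_false e0 (not_not.mpr e1)⟩
    · exact ⟨2, iff_of_false e2 e0, iff_of_true e1 e2⟩
    · exact ⟨0, iff_of_false e0 e1, iff_of_true e2 e0⟩
    · tauto
  obtain ⟨i, hi1, hi2⟩ := hsign
  -- By `out_of_chord` a chord joins sides of equal direction, so chords occur only at the corner
  -- between sides `i` and `i + 1`.
  have hno1 : ∀ j j' s, ¬ W.Chord Ω a m (i + 1) j (i + 1 + 1) j' s := by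
    intro j j' s hc
    have := hM.out_of_chord hP hc
    tauto
  have hno2 : ∀ j j' s, ¬ W.Chord Ω a m (i + 1 + 1) j (i + 1 + 1 + 1) j' s := by
    intro j j' s hc
    have := hM.out_of_chord hP hc
    rw [fin_three_add] at this
    tauto
  have hm2 : m (i + 1 + 1) = 0 := by
    by_contra h
    rcases hM.chord_cases hP (Nat.pos_of_ne_zero h) le_rfl with ⟨_, _, h3⟩ | ⟨_, _, h3⟩
    · exact hno2 _ _ _ h3
    · have h4 : i + 1 + 1 + 1 + 1 = i + 1 := fin_three_add (i + 1)
      rw [fin_three_add (i + 1 + 1), h4] at h3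
      exact hno1 _ _ _ h3
  refine ⟨i, W.out (a i), fun k hk => hM.out_side hP hk,
    fun k hk => (hM.out_side hP hk).trans hi1.symm, hi2, hm2, ?_⟩
  rcases Nat.eq_zero_or_pos (m i) with h0 | h0
  · refine Or.inl ⟨h0, ?_⟩
    by_contra h
    rcases hM.chord_cases hP (Nat.pos_of_ne_zero h) le_rfl with ⟨_, _, h3⟩ | ⟨_, _, h3⟩
    · exact hno1 _ _ _ h3
    · rw [fin_three_add] at h3
      have := h3.le; have := h3.pos; omega
  · right
    rcases hM.chord_cases hP one_pos h0 with ⟨j', s, h3⟩ | ⟨j', s, h3⟩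
    · obtain rfl := hM.chord_length hP h3 hm2
      obtain rfl := hM.chord_last hP h3 hm2
      exact ⟨h0, h3.pos', h3⟩
    · exact absurd h3 (hno2 _ _ _)

end IsMin

end

section

variable {D F : Type*} {W : Web D F}

/-! ### Faces and directed strands -/

namespace IsPolygon

variable {k : ℕ} [NeZero k] {a : Fin k → D} (h : W.IsPolygon a)

include h

lemma rot_succ (i : Fin k) : W.rot (a (i + 1)) = W.rev (a i) := by
  rw [← h.2.1 i, faceWalk, Equiv.Perm.mul_apply, Equiv.Perm.inv_def, Equiv.apply_symm_apply]

lemma not_isL (hk : ∀ i : Fin k, i ≠ i + 1) (i : Fin k) : ¬ W.IsL (a i) := by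
  intro hL
  refine hk i (h.1 (W.rot.injective ?_))
  rw [h.rot_succ, hL.2.1]

variable [Finite D]

lemma not_dbl (hk : ∀ i : Fin k, i ≠ i + 1) (i : Fin k) : ¬ W.dbl (a i) := by
  intro hd
  have hb := h.2.2.2.2 i
  have hp : ¬ W.Pass (a i) := fun hp => hp.elim (fun hT => hT.not_dbl hd) (h.not_isL hk i)
  obtain ⟨e, -, -, -, h1, h2, h3, -, h4⟩ := isTrivalent_of_not_pass hb hp
  rcases h4 (a i) (Equiv.Perm.SameCycle.refl _ _) with h5 | h5 | h5
  · refine h.2.2.2.2 (i + 1) ((bdry_congr (same_rot _)).mpr ?_)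
    rw [h.rot_succ, h5]
    exact h1
  · exact h2 (h5 ▸ hd)
  · exact h3 (h5 ▸ hd)

lemma cross (hk : ∀ i : Fin k, i ≠ i + 1) (i : Fin k) : W.Cross (a (i + 1)) (W.rev (a i)) := by
  have hb := h.2.2.2.2 (i + 1)
  by_cases hT : W.IsT (a (i + 1))
  · rw [← h.rot_succ]
    exact isT_cross hT
  · refine cross_of_not_pass hb (fun hp => hp.elim hT (h.not_isL hk _)) ?_ ?_
      (h.not_dbl hk _) ?_
    · rw [← h.rot_succ]; exact same_rot _
    · intro he
      have hp : ¬ W.Pass (a (i + 1)) := fun hp => hp.elim hT (h.not_isL hk _)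
      obtain ⟨e, h1, h2, h3, -, h4, -, -, h5⟩ := isTrivalent_of_not_pass hb hp
      have hr : W.rot (a (i + 1)) = a (i + 1) := by rw [h.rot_succ, he]
      rcases h5 _ (Equiv.Perm.SameCycle.refl _ _) with h6 | h6 | h6
      · exact h.not_dbl hk (i + 1) (h6 ▸ h3)
      · rw [h6] at hr
        exact h4 ((W.rot.injective hr).symm ▸ h3)
      · rw [h6, h2] at hr
        exact h.not_dbl hk (i + 1) (by rw [h6, ← hr]; exact h3)
    · rw [W.dbl_rev]
      exact h.not_dbl hk _

end IsPolygon

lemma forward_or {d : D} : W.Forward d ∨ W.Forward (W.rev d) := by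
  by_cases h : W.dbl d
  · exact Or.inl (Or.inl h)
  · by_cases h' : W.out d
    · exact Or.inl (Or.inr h')
    · exact Or.inr (Or.inr ((W.out_rev d h).mpr h'))

lemma dirSeg_refl (d : D) : W.DirSeg d d := by
  rcases forward_or (W := W) (d := d) with h | h
  · exact Or.inl ⟨h, Relation.ReflTransGen.refl⟩
  · exact Or.inr ⟨h, Relation.ReflTransGen.refl⟩

variable [Finite D]

/-- An edge with both ends at one vertex gives a reducible configuration. -/
lemma directed_of_same_rev {d : D} (hb : ¬ W.bdry d) (hs : W.rot.SameCycle d (W.rev d)) :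
    W.HasDirectedConfiguration := by
  have hclosed : ∀ e, W.Pass (W.rev e) → W.nxt e = e → W.Forward e →
      W.HasDirectedConfiguration := fun e h1 h2 h3 =>
    Or.inl ⟨e, Relation.TransGen.single ⟨step_iff.mpr ⟨h1, h2.symm⟩, h3⟩⟩
  by_cases hL : W.IsL d
  · rcases forward_or (W := W) (d := d) with h | h
    · exact hclosed d (Or.inr hL.rev) (nxt_of_isL hL.rev) h
    · have : W.IsL (W.rev (W.rev d)) := by rwa [W.rev_rev]
      exact hclosed _ (Or.inr this) (nxt_of_isL this) h
  by_cases hd : W.dbl d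
  · obtain ⟨e, -, -, -, h1, h2, h3, -, h4⟩ := isTrivalent_of_not_pass hb
      (fun hp => hp.elim (fun hT => hT.not_dbl hd) hL)
    exfalso
    rcases h4 d (Equiv.Perm.SameCycle.refl _ _) with h5 | h5 | h5
    · exact hb ((bdry_congr hs).mpr (h5 ▸ h1))
    · exact h2 (h5 ▸ hd)
    · exact h3 (h5 ▸ hd)
  rcases cross_or_opp_of_not_dbl hb hL hs (W.rev_ne d).symm hd (by rwa [W.dbl_rev]) with
    h | ⟨hT, h⟩
  · exact Or.inr (Or.inl ⟨d, d, dirSeg_refl d, h⟩)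
  · have h1 : W.nxt d = d := by rw [nxt, h, opp_opp]
    rcases forward_or (W := W) (d := d) with h2 | h2
    · exact hclosed d (Or.inl (hT.congr hs)) h1 h2
    · refine hclosed (W.rev d) (Or.inl (by rwa [W.rev_rev])) ?_ h2
      rw [nxt, W.rev_rev, ← h]

/-- The sides of a face are single edges, and a single edge is always a directed strand. Edges with
both ends at one vertex are treated separately. -/
lemma directed_of_face (h : W.HasReducibleFace) : W.HasDirectedConfiguration := by
  rcases h with ⟨a, ha⟩ | ⟨a, ha⟩ | ⟨a, ha, hc⟩
  · refine directed_of_same_rev (ha.2.2.2.2 0) ?_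
    have := ha.rot_succ 0
    rw [← this]
    exact same_rot _
  · have hk : ∀ i : Fin 2, i ≠ i + 1 := by decide
    by_cases hs : W.rot.SameCycle (a 0) (W.rev (a 0))
    · exact directed_of_same_rev (ha.2.2.2.2 0) hs
    refine Or.inr (Or.inr (Or.inl ⟨a 0, a 0, W.rev (a 1), W.rev (a 1), dirSeg_refl _,
      dirSeg_refl _, ha.cross hk 1, ?_, hs⟩))
    rw [W.rev_rev]
    exact (ha.cross hk 0).symm
  · have hk : ∀ i : Fin 3, i ≠ i + 1 := by decide
    by_cases hs : ∃ i, W.rot.SameCycle (a i) (W.rev (a i))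
    · obtain ⟨i, hs⟩ := hs
      exact directed_of_same_rev (ha.2.2.2.2 i) hs
    have hs' : ∀ i, ¬ W.rot.SameCycle (a i) (a (i + 1)) := by
      intro i h
      refine hs ⟨i, h.trans ?_⟩
      rw [← ha.rot_succ]
      exact same_rot _
    refine Or.inr (Or.inr (Or.inr ⟨a, a, fun i => dirSeg_refl _, ha.cross hk, ?_, ?_, ?_⟩))
    · intro i j hij
      by_contra hne
      rcases (fin_three_cases i j).resolve_left (Ne.symm hne) with rfl | rfl
      · exact hs' _ hij
      · refine hs' (i + 1 + 1) ?_
        rw [fin_three_add]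
        exact hij.symm
    · exact fun hf => hc (Or.inl fun i => (hf i).1.resolve_left (ha.not_dbl hk i))
    · refine fun hf => hc (Or.inr fun i => ?_)
      rw [← W.out_rev _ (ha.not_dbl hk i)]
      exact (hf i).1.resolve_left (by rw [W.dbl_rev]; exact ha.not_dbl hk i)

/-! ### Configurations and bad curves -/

lemma seg_rev {d e : D} (h : W.Seg d e) : W.Seg (W.rev e) (W.rev d) := by
  obtain ⟨m, hm, rfl⟩ := seg_iff.mp h
  exact seg_iff.mpr ⟨m, hm.rev, nxt_iterate_rev _ _⟩

omit [Finite D] in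
lemma ForwardSeg.seg {d e : D} (h : W.ForwardSeg d e) : W.Seg d e :=
  Relation.ReflTransGen.mono (fun _ _ h => h.1) _ _ h.2

lemma DirSeg.seg {d e : D} (h : W.DirSeg d e) : W.Seg d e := by
  rcases h with h | h
  · exact h.seg
  · have := seg_rev h.seg
    rwa [W.rev_rev, W.rev_rev] at this

lemma undirected_of_directed (h : W.HasDirectedConfiguration) :
    W.HasUndirectedConfiguration := by
  rcases h with ⟨d, h⟩ | ⟨d, e, h1, h2⟩ | ⟨d, e, d', e', h1, h2, h3⟩ | ⟨a, e, h1, h2⟩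
  · exact Or.inl ⟨d, Relation.TransGen.mono (fun _ _ h => h.1) _ _ h⟩
  · exact Or.inr (Or.inl ⟨d, e, h1.seg, h2⟩)
  · exact Or.inr (Or.inr (Or.inl ⟨d, e, d', e', h1.seg, h2.seg, h3⟩))
  · exact Or.inr (Or.inr (Or.inr ⟨a, e, fun i => (h1 i).seg, h2⟩))

lemma IsPoly.not_dbl_zero {n : ℕ} [NeZero n] {a : Fin n → D} {m : Fin n → ℕ}
    (h : W.IsPoly n a m) (hn : n ≠ 1) (i : Fin n) : ¬ W.dbl (a i) :=
  h.not_dbl hn (i := i) (Nat.zero_le _)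

lemma IsPoly.hasTriangle {a : Fin 3 → D} {m : Fin 3 → ℕ} (hP : W.IsPoly 3 a m)
    (hC : ¬ W.Cyc a m) (hs : ∀ i, ∀ k ≤ m i, W.out (W.nxt^[k] (a i)) ↔ W.out (a i)) :
    W.HasTriangle W.DirSeg := by
  have hd : ∀ i, ¬ W.dbl (a i) := hP.not_dbl_zero (by decide)
  refine ⟨a, fun i => W.nxt^[m i] (a i), fun i => ?_, hP.corner (by decide),
    fun i j h => (hP.inj i j 0 0 (Nat.zero_le _) (Nat.zero_le _) h).1, fun hf => ?_, fun hf => ?_⟩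
  · by_cases h : W.out (a i)
    · exact Or.inl (forwardSeg_of_isPath (hP.path i) fun j hj => Or.inr ((hs i j hj).mpr h))
    · exact Or.inr (forwardSeg_rev_of_isPath (hP.path i) (hd i)
        fun j hj h' => h ((hs i j hj).mp h'))
  · exact hC (Or.inl fun i j hj => (hs i j hj).mpr ((hf i).1.resolve_left (hd i)))
  · refine hC (Or.inr fun i j hj h => ?_)
    have h1 := hP.not_dbl (by decide) (i := i) le_rfl
    have h2 := (hf i).1.resolve_left (by rwa [W.dbl_rev])
    rw [W.out_rev _ h1, hs i _ le_rfl] at h2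
    exact h2 ((hs i j hj).mp h)

/-- A minimal bad curve gives a reducible face or a triangle whose sides are directed strands. -/
lemma IsBad.directed {C : Set D} (h : W.IsBad C) : W.HasDirectedConfiguration := by
  obtain ⟨C, Ω, hC, hΩ⟩ := h.exists_inner
  obtain ⟨C, Ω, hC, hM, -⟩ := exists_isMin ⟨C, Ω, hC, hΩ, le_rfl⟩
  rcases hC with (⟨a, m, hP, rfl⟩ | ⟨a, m, hP, rfl⟩) | ⟨a, m, hP, hc, rfl⟩
  · exact directed_of_face (hM.face_of_one hP)
  · exact directed_of_face (hM.face_of_two hP)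
  · exact Or.inr (Or.inr (Or.inr (hP.hasTriangle hc fun i k hk => hM.out_side hP hk)))

lemma directed_iff : W.HasDirectedConfiguration ↔ ∃ C, W.IsBad C :=
  ⟨fun h => exists_isBad (undirected_of_directed h), fun ⟨_, h⟩ => h.directed⟩

lemma undirected_iff : W.HasUndirectedConfiguration ↔ ∃ C, W.IsBad C :=
  ⟨exists_isBad, fun ⟨_, h⟩ => undirected_of_directed h.directed⟩

/-! ### Reversing the sides of a square -/

lemma xor_of_right {p q : Prop} (h : q) : Xor p q ↔ ¬ p := by
  rw [xor_def]; tauto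

lemma xor_of_not_right {p q : Prop} (h : ¬ q) : Xor p q ↔ p := by
  rw [xor_def]; tauto

/-- At each vertex `S` consists of nothing or of two neighbouring darts of equal direction.
Reversing both keeps them equal, and at a tetravalent vertex the other two darts are equal to each
other as well. -/
lemma vertex_flip (W : Web D F) {S : Set D} (hdbl : ∀ d ∈ S, ¬ W.dbl d)
    (hS : ∀ d ∈ S, ∃ z, W.rot.SameCycle z d ∧ ¬ W.IsL z ∧ (W.out z ↔ W.out (W.rot z)) ∧
      ∀ e, W.rot.SameCycle z e → (e ∈ S ↔ e = z ∨ e = W.rot z)) {d : D} (hd : ¬ W.bdry d) :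
    IsLoopVertex W.rot W.rev d ∨ IsTetravalent W.rot W.dbl (fun d => Xor (W.out d) (d ∈ S)) d ∨
      IsTrivalent W.rot W.rev W.dbl (fun d => Xor (W.out d) (d ∈ S)) W.bdry d := by
  by_cases hex : ∃ e ∈ S, W.rot.SameCycle e d
  · obtain ⟨e₀, he₀, hed⟩ := hex
    obtain ⟨z, hz, hL, hout, hm⟩ := hS e₀ he₀
    have hzd := hz.trans hed
    have hzS := (hm z (Equiv.Perm.SameCycle.refl _ _)).mpr (Or.inl rfl)
    have hzS1 := (hm _ (same_rot z)).mpr (Or.inr rfl)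
    by_cases hT : W.IsT z
    · have h2 : W.rot (W.rot z) ∉ S := by
        rw [hm _ ((same_rot _).trans (same_rot _)), not_or]
        exact ⟨hT.2.2, fun h => (isT_cross hT.rot).ne h.symm⟩
      have h3 : W.rot (W.rot (W.rot z)) ∉ S := by
        rw [hm _ ((same_rot _).trans ((same_rot _).trans (same_rot _))), not_or]
        refine ⟨fun h => ?_, hT.rot.2.2⟩
        have := (isT_cross hT.rot.rot.rot).ne
        rw [hT.2.1] at this
        exact this h
      refine Or.inr (Or.inl ⟨z, hzd, hT.2.1, hT.2.2, fun c hc => (hT.congr hc).not_dbl, ?_, ?_⟩)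
      · simp only [xor_of_right hzS, xor_of_right hzS1, hout]
      · simp only [xor_of_not_right h2, xor_of_not_right h3]
        have := hT.pattern
        tauto
    · have hb : ¬ W.bdry z := fun h => hd ((bdry_congr hzd).mp h)
      obtain ⟨e, h3, h4, h5, h6, h7, h8, -, h10⟩ := isTrivalent_of_not_pass hb
        (fun hp => hp.elim hT hL)
      obtain rfl : z = W.rot e := by
        rcases h10 _ (Equiv.Perm.SameCycle.refl _ _) with h | h | h
        · exact absurd (h ▸ h5) (hdbl z hzS)
        · exact h
        · have := hdbl _ hzS1
          rw [h, h4] at this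
          exact absurd h5 this
      refine Or.inr (Or.inr ⟨e, h3.trans hzd, h4, h5, h6, h7, h8, ?_⟩)
      simp only [xor_of_right hzS, xor_of_right hzS1, hout]
  · have h2 : ∀ e, W.rot.SameCycle e d → (Xor (W.out e) (e ∈ S) ↔ W.out e) :=
      fun e he => xor_of_not_right fun h => hex ⟨e, h, he⟩
    rcases W.vertex d hd with h | ⟨e, h3, h4, h5, h6, h7, h8⟩ | ⟨e, h3, h4, h5, h6, h7, h8, h9⟩
    · exact Or.inl h
    · have e1 := (same_rot e).symm.trans h3
      have e2 := (same_rot _).symm.trans e1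
      have e3 := (same_rot _).symm.trans e2
      exact Or.inr (Or.inl ⟨e, h3, h4, h5, h6, (h2 _ h3).trans (h7.trans (h2 _ e1).symm),
        (h2 _ e2).trans (h8.trans (h2 _ e3).symm)⟩)
    · have e1 := (same_rot e).symm.trans h3
      have e2 := (same_rot _).symm.trans e1
      exact Or.inr (Or.inr ⟨e, h3, h4, h5, h6, h7, h8,
        (h2 _ e1).trans (h9.trans (h2 _ e2).symm)⟩)

/-- The web in which the edges of `S` are reversed. -/
def flip (W : Web D F) (S : Set D) (hrev : ∀ d, W.rev d ∈ S ↔ d ∈ S) (hdbl : ∀ d ∈ S, ¬ W.dbl d)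
    (hS : ∀ d ∈ S, ∃ z, W.rot.SameCycle z d ∧ ¬ W.IsL z ∧ (W.out z ↔ W.out (W.rot z)) ∧
      ∀ e, W.rot.SameCycle z e → (e ∈ S ↔ e = z ∨ e = W.rot z)) : Web D F :=
  { W with
    out := fun d => Xor (W.out d) (d ∈ S)
    out_rev := by
      intro d hd
      have h := W.out_rev d hd
      by_cases h1 : d ∈ S
      · rw [xor_of_right h1, xor_of_right ((hrev d).mpr h1), h]
      · rw [xor_of_not_right h1, xor_of_not_right (mt (hrev d).mp h1), h]
    out_dbl := by
      intro d hd
      rw [xor_of_not_right fun h => hdbl d h hd]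
      exact W.out_dbl d hd
    vertex := fun _ => W.vertex_flip hdbl hS }

/-- The sides of a square with four different vertices can be reversed. -/
lemma exists_squareMove {A : Fin 4 → D} (hA : W.IsPolygon A)
    (halt : ∀ i, W.out (A (i + 1)) ↔ ¬ W.out (A i))
    (hv : ∀ i j, W.rot.SameCycle (A i) (A j) → i = j) :
    ∃ W' : Web D F, W.SquareMove W' ∧ W'.rot = W.rot ∧ W'.rev = W.rev ∧ W'.bdry = W.bdry ∧
      W'.face = W.face ∧ W'.outer = W.outer ∧
      (∀ i d, W.rot.SameCycle (A i) d → d ≠ A i → d ≠ W.rot (A i) → (W'.out d ↔ W.out d)) ∧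
      ∀ i, W'.out (W.rot (A i)) ↔ ¬ W.out (W.rot (A i)) := by
  have hk : ∀ i : Fin 4, i ≠ i + 1 := by decide
  set S : Set D := {d | ∃ i, d = A i ∨ d = W.rev (A i)} with hS
  have hmem : ∀ i d, W.rot.SameCycle (A i) d → (d ∈ S ↔ d = A i ∨ d = W.rot (A i)) := by
    intro i d hd
    constructor
    · rintro ⟨j, rfl | rfl⟩
      · rw [hv i j hd]; exact Or.inl rfl
      · rw [← hA.rot_succ] at hd ⊢
        rw [hv i (j + 1) (hd.trans (same_rot _).symm)]; exact Or.inr rfl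
    · rintro (rfl | rfl)
      · exact ⟨i, Or.inl rfl⟩
      · refine ⟨i - 1, Or.inr ?_⟩
        rw [← hA.rot_succ, sub_add_cancel]
  have hdbl : ∀ d ∈ S, ¬ W.dbl d := by
    rintro d ⟨j, rfl | rfl⟩
    · exact hA.not_dbl hk j
    · rw [W.dbl_rev]; exact hA.not_dbl hk j
  have hrev : ∀ d, W.rev d ∈ S ↔ d ∈ S := by
    intro d
    refine exists_congr fun j => or_comm.trans (or_congr W.rev.injective.eq_iff ?_)
    constructor
    · rintro h; rw [← h, W.rev_rev]
    · rintro rfl; rw [W.rev_rev]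
  -- Since the sides alternate, the two sides at a vertex of the square both leave it or both enter
  -- it.
  have hout : ∀ i, W.out (A i) ↔ W.out (W.rot (A i)) := by
    intro i
    have h1 := hA.rot_succ (i - 1)
    have h2 := halt (i - 1)
    rw [sub_add_cancel] at h1 h2
    rw [h1, h2, W.out_rev _ (hA.not_dbl hk _)]
  have hS' : ∀ d ∈ S, ∃ z, W.rot.SameCycle z d ∧ ¬ W.IsL z ∧ (W.out z ↔ W.out (W.rot z)) ∧
      ∀ e, W.rot.SameCycle z e → (e ∈ S ↔ e = z ∨ e = W.rot z) := by
    rintro d ⟨j, rfl | rfl⟩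
    · exact ⟨A j, Equiv.Perm.SameCycle.refl _ _, hA.not_isL hk j, hout j, hmem j⟩
    · refine ⟨A (j + 1), ?_, hA.not_isL hk _, hout _, hmem _⟩
      rw [← hA.rot_succ]
      exact same_rot _
  refine ⟨W.flip S hrev hdbl hS', ⟨A, hA, halt, rfl, rfl, rfl, rfl, rfl, rfl, fun _ => Iff.rfl⟩,
    rfl, rfl, rfl, rfl, rfl, fun i d hd h1 h2 => xor_of_not_right ?_,
    fun i => xor_of_right ((hmem i _ (same_rot _)).mpr (Or.inr rfl))⟩
  rw [hmem i d hd, not_or]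
  exact ⟨h1, h2⟩

/-! ### Strands of webs with the same underlying map -/

section Congr

variable {W' : Web D F} (h1 : W'.rot = W.rot) (h2 : W'.rev = W.rev) (h3 : W'.bdry = W.bdry)

include h1 h2 h3

omit [Finite D]

lemma pass_eq : W'.Pass = W.Pass := by
  funext d
  simp only [Pass, IsT, IsL, IsLoopVertex, h1, h2, h3]

lemma nxt_eq : W'.nxt = W.nxt := by
  have hT : W'.IsT = W.IsT := by funext d; simp only [IsT, h1, h3]
  have hL : W'.IsL = W.IsL := by funext d; simp only [IsL, IsLoopVertex, h1, h2, h3]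
  funext d
  by_cases c : W.IsT (W.rev d)
  · have c' : W'.IsT (W'.rev d) := by rwa [hT, h2]
    rw [nxt, nxt, opp_of_isT c, opp_of_isT c', h1, h2]
  by_cases l : W.IsL (W.rev d)
  · have l' : W'.IsL (W'.rev d) := by rwa [hL, h2]
    rw [nxt, nxt, opp_of_isL l, opp_of_isL l', h2]
  · have p : ¬ W.Pass (W.rev d) := fun h => h.elim c l
    have p' : ¬ W'.Pass (W'.rev d) := by rwa [pass_eq h1 h2 h3, h2]
    rw [nxt, nxt, opp_of_not_pass p, opp_of_not_pass p', h2]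

lemma isPath_eq : W'.IsPath = W.IsPath := by
  funext d m
  simp only [IsPath, pass_eq h1 h2 h3, nxt_eq h1 h2 h3, h2]

lemma darts_eq {n : ℕ} (a : Fin n → D) (m : Fin n → ℕ) : W'.darts a m = W.darts a m := by
  simp only [darts, nxt_eq h1 h2 h3]

omit h2 in
lemma cross_eq (h4 : W'.dbl = W.dbl) : W'.Cross = W.Cross := by
  funext d e
  simp only [Cross, h1, h3, h4]

lemma isPoly_congr (h4 : W'.dbl = W.dbl) {n : ℕ} [NeZero n] {a : Fin n → D} {m : Fin n → ℕ} :
    W'.IsPoly n a m ↔ W.IsPoly n a m := by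
  constructor
  · rintro ⟨p1, p2, p3, p4, p5⟩
    rw [isPath_eq h1 h2 h3] at p1
    rw [nxt_eq h1 h2 h3] at p2 p3 p4
    rw [h1] at p2 p3
    rw [cross_eq h1 h3 h4, h2] at p4
    rw [h3] at p5
    exact ⟨p1, p2, p3, p4, p5⟩
  · rintro ⟨p1, p2, p3, p4, p5⟩
    rw [← isPath_eq h1 h2 h3] at p1
    rw [← nxt_eq h1 h2 h3] at p2 p3 p4
    rw [← h1] at p2 p3
    rw [← cross_eq h1 h3 h4, ← h2] at p4
    rw [← h3] at p5
    exact ⟨p1, p2, p3, p4, p5⟩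

end Congr

/-! ### Reduction -/

/-- The first chord of a corner of a minimal triangle cuts off a square, and the rest of the
triangle is bad after the sides of the square are reversed. -/
lemma IsMin.exists_squareMove {Ω : Set F} {a : Fin 3 → D} {m : Fin 3 → ℕ}
    (hM : W.IsMin (W.darts a m) Ω) (hP : W.IsPoly 3 a m) {i : Fin 3} {ε : Prop}
    (hs0 : ∀ k ≤ m i, W.out (W.nxt^[k] (a i)) ↔ ε)
    (hs1 : ∀ k ≤ m (i + 1), W.out (W.nxt^[k] (a (i + 1))) ↔ ε)
    (hs2 : W.out (a (i + 1 + 1)) ↔ ¬ ε) (hm2 : m (i + 1 + 1) = 0) (hm0 : 0 < m i)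
    (hch : W.Chord Ω a m i 1 (i + 1) (m (i + 1)) 0) :
    ∃ W' : Web D F, W.SquareMove W' ∧ W'.rot = W.rot ∧ W'.rev = W.rev ∧ W'.bdry = W.bdry ∧
      W'.face = W.face ∧ W'.outer = W.outer ∧ (W'.out (W.nxt^[1] (a i)) ↔ ε) ∧
      (W'.out (W.rot (W.nxt^[m (i + 1)] (a (i + 1)))) ↔ ¬ ε) := by
  set P := W.nxt^[1] (a i) with hPdef
  set Q := W.nxt^[m (i + 1)] (a (i + 1)) with hQdef
  have hT : W.IsT P := hP.isT one_pos hm0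
  have hxQ : W.rev (W.rot P) = W.rot Q := hch.last
  have hcv := hM.convex hP le_rfl (by decide)
  have hcv2 := hcv (i + 1 + 1)
  rw [fin_three_add, hm2] at hcv2
  obtain ⟨ε', e1, -, e3, e4⟩ := hM.chord_signs hP (by decide) hch
  have e1' := e1 1 le_rfl hm0
  have hε : ε' ↔ ε := e1'.symm.trans (hs0 1 hm0)
  have hxε : W.out (W.rot P) ↔ ¬ ε := (e4 0 le_rfl).trans (not_congr hε)
  -- The square consists of the first edge of side `i`, the chord, the last edge of side `i + 1` and
  -- the third side.
  set A : Fin 4 → D := ![a i, W.rot P, Q, a (i + 1 + 1)] with hA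
  have hv : ∀ k l, W.rot.SameCycle (A k) (A l) → k = l := by
    -- Vertex `k` of the square is vertex `J k` of side `I k` of the triangle, so injectivity is
    -- inherited from the triangle.
    let I : Fin 4 → Fin 3 := ![i, i, i + 1, i + 1 + 1]
    let J : Fin 4 → ℕ := ![0, 1, m (i + 1), 0]
    have hIJ : ∀ k, J k ≤ m (I k) ∧ W.rot.SameCycle (W.nxt^[J k] (a (I k))) (A k) := by
      intro k
      fin_cases k
      · exact ⟨Nat.zero_le _, Equiv.Perm.SameCycle.refl _ _⟩
      · exact ⟨hm0, same_rot _⟩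
      · exact ⟨le_rfl, Equiv.Perm.SameCycle.refl _ _⟩
      · exact ⟨Nat.zero_le _, Equiv.Perm.SameCycle.refl _ _⟩
    intro k l hkl
    obtain ⟨h3, h4⟩ := hP.inj _ _ _ _ (hIJ k).1 (hIJ l).1
      ((hIJ k).2.trans (hkl.trans (hIJ l).2.symm))
    have hi1 : ∀ i : Fin 3, i ≠ i + 1 ∧ i ≠ i + 1 + 1 ∧ i + 1 ≠ i + 1 + 1 := by decide
    obtain ⟨q1, q2, q3⟩ := hi1 i
    revert h3 h4
    fin_cases k <;> fin_cases l <;> intro h3 h4 <;>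
    first
      | rfl
      | exact absurd h3 q1
      | exact absurd h3 q2
      | exact absurd h3 q3
      | exact absurd h3.symm q1
      | exact absurd h3.symm q2
      | exact absurd h3.symm q3
      | exact absurd h4 zero_ne_one
      | exact absurd h4 one_ne_zero
  have hpoly : W.IsPolygon A := by
    refine hM.isPolygon (fun k l hkl => hv k l (hkl ▸ Equiv.Perm.SameCycle.refl _ _)) ?_
      (hM.side (i := i) (Nat.zero_le _)) (mem_darts_zero i) ?_
    · intro k
      fin_cases k
      · exact (hP.rev_straight hm0).symm
      · exact hxQ.symm
      · exact hcv (i + 1)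
      · exact hcv2
    · intro k
      fin_cases k
      · exact hP.not_bdry i
      · exact hT.rot.1
      · exact hP.not_bdry_of_mem (mem_darts le_rfl)
      · exact hP.not_bdry _
  have halt : ∀ k, W.out (A (k + 1)) ↔ ¬ W.out (A k) := by
    have h0 := hs0 0 (Nat.zero_le _)
    have h1 := hs1 (m (i + 1)) le_rfl
    simp only [Function.iterate_zero, id] at h0
    intro k
    fin_cases k
    · change W.out (W.rot P) ↔ ¬ W.out (a i); tauto
    · change W.out Q ↔ ¬ W.out (W.rot P); tauto
    · change W.out (a (i + 1 + 1)) ↔ ¬ W.out Q; tauto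
    · change W.out (a i) ↔ ¬ W.out (a (i + 1 + 1)); tauto
  obtain ⟨W', hmove, g1, g2, g3, g4, g5, g6, g7⟩ := Web.exists_squareMove hpoly halt hv
  refine ⟨W', hmove, g1, g2, g3, g4, g5, ?_, ?_⟩
  · exact (g6 1 P (same_rot _).symm (isT_cross hT).ne hT.2.2.symm).trans (hs0 1 hm0)
  · refine (g7 2).trans (not_congr ((iff_of_eq (congrArg W.out hxQ.symm)).trans ?_))
    rw [W.out_rev _ hT.rot.not_dbl, hxε, not_not]

/-- Induction on the number of regions inside a bad curve, over all webs with the same darts and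
regions, since the square move changes the web. -/
lemma reducible_of_isInner (N : ℕ) : ∀ W : Web D F,
    (∃ C Ω, W.IsBad C ∧ W.IsInner C Ω ∧ Ω.ncard ≤ N) → W.Reducible := by
  induction N using Nat.strong_induction_on with
  | _ N ih =>
  intro W h
  obtain ⟨C, Ω, hC, hM, hN⟩ := exists_isMin h
  have hface : W.HasReducibleFace → W.Reducible := fun h => ⟨W, Relation.ReflTransGen.refl, h⟩
  rcases hC with (⟨a, m, hP, rfl⟩ | ⟨a, m, hP, rfl⟩) | ⟨a, m, hP, hc, rfl⟩
  · exact hface (hM.face_of_one hP)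
  · exact hface (hM.face_of_two hP)
  obtain ⟨i, ε, hs0, hs1, hs2, hm2, ⟨hm0, hm1⟩ | ⟨hm0, hm1, hch⟩⟩ := hM.structure_of_three hP hc
  · refine hface (Or.inr (Or.inr ⟨a, hM.isPolygon_of_length hP
      (hM.convex hP le_rfl (by decide)) fun j => ?_, ?_⟩))
    · rcases fin_three_cases i j with rfl | rfl | rfl
      exacts [hm0, hm1, hm2]
    · have h0 := hs0 0 (Nat.zero_le _)
      have h1 := hs1 0 (Nat.zero_le _)
      simp only [Function.iterate_zero, id] at h0 h1
      rintro (h | h)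
      · have h3 := h i; have h4 := h (i + 1 + 1); tauto
      · have h3 := h i; have h4 := h (i + 1 + 1); tauto
  obtain ⟨W', hmove, g1, g2, g3, g4, g5, g6, g7⟩ := hM.exists_squareMove hP hs0 hs1 hs2 hm2 hm0 hch
  have g8 : W'.dbl = W.dbl := by
    obtain ⟨_, _, _, _, _, h, _⟩ := hmove
    exact h
  have hcut := hP.isPoly_cut (by decide) hch
  set C' := W.darts ![W.nxt^[1] (a i), a (i + 1), W.rot (W.nxt^[m (i + 1)] (a (i + 1)))]
    ![m i - 1, m (i + 1) - 1, 0] with hC'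
  -- After the move side `i` still has direction `ε` while the chord, which closed a directed
  -- triangle before, has direction `¬ ε`.
  have hbad : W'.IsBad C' := by
    refine Or.inr ⟨_, _, (isPoly_congr g1 g2 g3 g8).mpr hcut, fun hcyc => ?_,
      (darts_eq g1 g2 g3 _ _).symm⟩
    obtain ⟨δ, d1, -, d3⟩ := cyc_triple hcyc
    have d1' := d1 0 (Nat.zero_le _)
    have d3' := d3 0 (Nat.zero_le _)
    simp only [Function.iterate_zero, id] at d1' d3'
    rw [g6] at d1'
    rw [g7] at d3'
    tauto
  have htouch := hM.cut_touches hch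
  have hins : ∃ d ∈ C', W.Ins Ω d := ⟨_, mem_darts_zero 2, hch.symm.exit.ins 0 le_rfl⟩
  have hfin := W.finite_regions
  have hinner : ∀ {C'' : Set D} {Ω' : Set F}, W.IsInner C'' Ω' → W'.IsInner C'' Ω' := by
    rintro C'' Ω' ⟨p1, p2, p3, p4⟩
    exact ⟨by rwa [g5], by rwa [g4], by rwa [g4, g2], by rwa [g4, g2]⟩
  have hred : W'.Reducible := by
    obtain ⟨Ω', h | h⟩ := hcut.isCycle.exists_inner
    · have hss := hM.inner.ssubset hM.cycle h htouch hins
      exact ih _ ((Set.ncard_lt_ncard hss).trans_le hN) W' ⟨C', Ω', hbad, hinner h, le_rfl⟩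
    · have hss := hM.inner.ssubset hM.cycle h (fun d hd => by
        have := htouch _ hd
        rw [W.rev_rev] at this
        exact this.symm) (by
        obtain ⟨d, hd, h8⟩ := hins
        refine ⟨W.rev d, ?_, h8.rev⟩
        change W.rev (W.rev d) ∈ C'
        rwa [W.rev_rev])
      refine ih _ ((Set.ncard_lt_ncard hss).trans_le hN) W' ⟨_, Ω', hbad.reverse, ?_, le_rfl⟩
      rw [g2]
      exact hinner h
  obtain ⟨W'', h1, h2⟩ := hred
  exact ⟨W'', Relation.ReflTransGen.head (Or.inl hmove) h1, h2⟩

lemma reducible_of_bad (h : ∃ C, W.IsBad C) : W.Reducible := by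
  obtain ⟨C, hC⟩ := h
  obtain ⟨C, Ω, h1, h2⟩ := hC.exists_inner
  exact reducible_of_isInner _ W ⟨C, Ω, h1, h2, le_rfl⟩

end

section

variable {D F : Type*} {W W' : Web D F}

/-! ### Reducibility implies a reducible configuration: squares -/

lemma SquareMove.symm (h : W.SquareMove W') : W'.SquareMove W := by
  obtain ⟨A, hA, halt, h1, h2, h3, h4, h5, h6, h7⟩ := h
  have hmem : ∀ i, ∃ j, A i = A j ∨ A i = W.rev (A j) := fun i => ⟨i, Or.inl rfl⟩
  refine ⟨A, ?_, fun i => ?_, h1.symm, h2.symm, h3.symm, h4.symm, h5.symm, h6.symm, fun d => ?_⟩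
  · simpa only [IsPolygon, h1, h2, h4, h5, h6] using hA
  · rw [h7, h7, xor_of_right (hmem _), xor_of_right (hmem _), halt]
  · rw [h7, h2]
    by_cases hd : ∃ i, d = A i ∨ d = W.rev (A i)
    · rw [xor_of_right hd, xor_of_right hd, not_not]
    · rw [xor_of_not_right hd, xor_of_not_right hd]

variable [Finite D]

lemma isT_of_not_dbl {z : D} (hb : ¬ W.bdry z) (hL : ¬ W.IsL z) (h0 : ¬ W.dbl z)
    (h1 : ¬ W.dbl (W.rot z)) (h2 : ¬ W.dbl (W.rot (W.rot z))) : W.IsT z := by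
  by_contra hT
  obtain ⟨e, -, h3, h4, -, -, -, -, h5⟩ := isTrivalent_of_not_pass hb (fun h => h.elim hT hL)
  rcases h5 z (Equiv.Perm.SameCycle.refl _ _) with rfl | rfl | rfl
  · exact h0 h4
  · rw [h3] at h2
    exact h2 h4
  · rw [h3] at h1
    exact h1 h4

lemma IsPolygon.vertex_ne (hno : ∀ C, ¬ W.IsSmall C) {k : ℕ} [NeZero k] {a : Fin k → D}
    (h : W.IsPolygon a) (i : Fin k) : ¬ W.rot.SameCycle (a i) (a (i + 1)) := by
  intro hs
  have hp : W.IsPath (a i) 0 := fun t ht => absurd ht (by omega)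
  refine hp.inj_of_no_small hno one_pos le_rfl (h.2.2.2.2 i) ?_
  refine (hs.trans ?_).trans (same_rev_iterate (a i) 0)
  have := same_rot (W := W) (a (i + 1))
  rwa [h.rot_succ] at this

/-- If neighbouring vertices coincided, an edge would return to its vertex; if opposite vertices
did, the strands of two neighbouring sides would meet twice. -/
lemma IsPolygon.square_vertices (hno : ∀ C, ¬ W.IsSmall C) {A : Fin 4 → D} (h : W.IsPolygon A)
    (i j : Fin 4) (hs : W.rot.SameCycle (A i) (A j)) : i = j := by
  have hk : ∀ i : Fin 4, i ≠ i + 1 := by decide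
  have h2 : ∀ i, ¬ W.rot.SameCycle (A i) (A (i + 1 + 1)) := by
    intro i hs
    have hp : ∀ d, W.IsPath d 0 := fun d t ht => absurd ht (by omega)
    have hr : ∀ i, W.rot.SameCycle (A (i + 1)) (W.rev (A i)) := by
      intro i
      rw [← h.rot_succ]
      exact same_rot _
    refine (h.cross hk i).no_second_crossing hno (hp _) (hp _) one_pos le_rfl one_pos le_rfl ?_ ?_
    · intro hb
      refine h.2.2.2.2 (i + 1 + 1) ((bdry_congr ((hr _).trans ?_)).mpr hb)
      exact same_nxt _
    · have h3 := same_nxt (W := W) (A (i + 1))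
      have h4 := same_nxt (W := W) (W.rev (A i))
      rw [W.rev_rev] at h4
      exact h3.symm.trans ((hr _).symm.trans (hs.symm.trans h4))
  have hij : j = i ∨ j = i + 1 ∨ j = i + 1 + 1 ∨ i = j + 1 := by
    clear hs h2
    revert i j
    decide
  rcases hij with rfl | rfl | rfl | rfl
  · rfl
  · exact absurd hs (h.vertex_ne hno i)
  · exact absurd hs (h2 i)
  · exact absurd hs.symm (h.vertex_ne hno j)

lemma bad_of_squareMove (h : W.SquareMove W') (hbad : ∃ C, W.IsBad C) : ∃ C, W'.IsBad C := by
  by_contra hno'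
  obtain ⟨A, hA, halt, g1, g2, g3, g4, -, -, g7⟩ := h
  have hk : ∀ i : Fin 4, i ≠ i + 1 := by decide
  -- Polygons do not depend on directions, so those with at most two sides are the same for both
  -- webs. Only triangles have to be compared.
  have hno : ∀ C, ¬ W.IsSmall C := by
    rintro C (⟨a, m, h1, h2⟩ | ⟨a, m, h1, h2⟩)
    · exact hno' ⟨_, Or.inl (Or.inl ⟨a, m, (isPoly_congr g1 g2 g4 g3).mpr h1, rfl⟩)⟩
    · exact hno' ⟨_, Or.inl (Or.inr ⟨a, m, (isPoly_congr g1 g2 g4 g3).mpr h1, rfl⟩)⟩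
  have htri : ∀ (a : Fin 3 → D) (m : Fin 3 → ℕ), (∀ i, W.IsPath (a i) (m i)) →
      (∀ i, W.Cross (a (i + 1)) (W.rev (W.nxt^[m i] (a i)))) →
      ∃ δ : Prop, ∀ i, ∀ j ≤ m i, W'.out (W.nxt^[j] (a i)) ↔ δ := by
    intro a m h1 h2
    have hP := isPoly_three_of_no_small hno h1 h2
    have hc : W'.Cyc a m := by
      by_contra hc
      exact hno' ⟨_, Or.inr ⟨a, m, (isPoly_congr g1 g2 g4 g3).mpr hP, hc, rfl⟩⟩
    rw [Cyc, nxt_eq g1 g2 g4] at hc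
    rcases hc with hc | hc
    · exact ⟨True, fun i j hj => iff_true_intro (hc i j hj)⟩
    · exact ⟨False, fun i j hj => iff_false_intro (hc i j hj)⟩
  set S : Set D := {d | ∃ i, d = A i ∨ d = W.rev (A i)} with hS
  have hSA : ∀ i, A i ∈ S := fun i => ⟨i, Or.inl rfl⟩
  have hin : ∀ d ∈ S, (W'.out d ↔ ¬ W.out d) := fun d hd => (g7 d).trans (xor_of_right hd)
  have hout : ∀ d ∉ S, (W'.out d ↔ W.out d) := fun d hd => (g7 d).trans (xor_of_not_right hd)
  have hAd := hA.not_dbl hk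
  have hmem : ∀ i d, W.rot.SameCycle (A i) d → d ∈ S → d = A i ∨ d = W.rot (A i) := by
    rintro i d hd ⟨j, rfl | rfl⟩
    · rw [hA.square_vertices hno i j hd]; exact Or.inl rfl
    · rw [← hA.rot_succ] at hd ⊢
      rw [hA.square_vertices hno i (j + 1) (hd.trans (same_rot _).symm)]; exact Or.inr rfl
  obtain ⟨C, hC⟩ := hbad
  obtain ⟨C, Ω, hC, hΩ⟩ := hC.exists_inner
  obtain ⟨C, Ω, hC, hM, -⟩ := exists_isMin ⟨C, Ω, hC, hΩ, le_rfl⟩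
  rcases hC with hC | ⟨a, m, hP, hc, rfl⟩
  · exact hno _ hC
  obtain ⟨i, ε, hs0, hs1, hs2, hm2, -⟩ := hM.structure_of_three hP hc
  have hcv := hM.convex hP le_rfl (by decide)
  obtain ⟨δ, hδ⟩ := htri a m hP.path (hP.corner (by decide))
  have hδ2 := hδ (i + 1 + 1) 0 (Nat.zero_le _)
  have hd0 : ¬ W.dbl (a i) := hP.not_dbl_zero (by decide) i
  have hd1 : ¬ W.dbl (W.rev (W.nxt^[m (i + 1)] (a (i + 1)))) := by
    rw [W.dbl_rev]
    exact hP.not_dbl (by decide) le_rfl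
  simp only [Function.iterate_zero, id] at hδ2
  -- The move makes the minimal bad triangle a directed cycle, so it reverses either its third side
  -- alone or all edges of the other two sides.
  by_cases hS2 : a (i + 1 + 1) ∈ S
  · have hδε : δ ↔ ε :=
      hδ2.symm.trans ((hin _ hS2).trans ((not_congr hs2).trans not_not))
    have hn0 : ∀ k ≤ m i, W.nxt^[k] (a i) ∉ S := by
      intro k hk hkS
      exact iff_not_self (hδε.symm.trans ((hδ i k hk).symm.trans ((hin _ hkS).trans
        (not_congr (hs0 k hk)))))
    have hV0 := hcv (i + 1 + 1)
    rw [fin_three_add, hm2] at hV0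
    simp only [Function.iterate_zero, id] at hV0
    -- If the square lay on the same side of this edge as the inside of the triangle, convexity
    -- would make `a i` the next side of the square, but `a i` is not reversed. So the square lies
    -- across the edge.
    obtain ⟨j, hj | hj⟩ := hS2
    · refine hn0 0 (Nat.zero_le _) ⟨j + 1, Or.inl (W.rot.injective ?_)⟩
      rw [hA.rot_succ, ← hj]
      exact hV0
    have hj4 : ∀ j : Fin 4, j + 1 + 1 + 1 + 1 = j := by decide
    rw [hj, W.rev_rev] at hV0
    have hr3 := hA.rot_succ (j + 1 + 1 + 1)
    rw [hj4] at hr3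
    have hr1 := hA.rot_succ j
    rw [← hj] at hr1
    have hr2 := hcv (i + 1)
    have hT0 : W.IsT (a i) := by
      refine isT_of_not_dbl (hP.not_bdry i) (fun hL => ?_) hd0 ?_ ?_
      · have := hL.rot
        rw [hV0] at this
        exact hA.not_isL hk _ this
      · rw [hV0]; exact hAd j
      · rw [hV0, hr3, W.dbl_rev]; exact hAd _
    have hT2 : W.IsT (A (j + 1)) := by
      refine isT_of_not_dbl (hA.2.2.2.2 _) (hA.not_isL hk _) (hAd _) ?_ ?_
      · rw [hr1]; exact hP.not_dbl_zero (by decide) _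
      · rw [hr1, hr2]; exact hd1
    have ho0 : W.opp (a i) = W.rev (A (j + 1 + 1 + 1)) := by
      rw [opp_of_isT hT0, hV0, hr3]
    have ho2 : W.opp (A (j + 1)) = W.rev (W.nxt^[m (i + 1)] (a (i + 1))) := by
      rw [opp_of_isT hT2, hr1, hr2]
    have hn1 : W.nxt (A (j + 1 + 1 + 1)) = a i := by
      rw [nxt, ← ho0, opp_opp]
    have hn2 : W.nxt^[m (i + 1) + 1] (a (i + 1)) = A (j + 1) := by
      rw [Function.iterate_succ_apply', nxt, ← ho2, opp_opp]
    have hn1' : ∀ t, W.nxt^[t + 1] (A (j + 1 + 1 + 1)) = W.nxt^[t] (a i) := fun t => by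
      rw [Function.iterate_succ_apply, hn1]
    have hone : ∀ d, W.Pass (W.rev d) → W.IsPath d 1 := by
      intro d hd t ht
      obtain rfl : t = 0 := by omega
      exact hd
    -- Sides `i` and `i + 1` are prolonged along the two neighbouring sides of the square; the
    -- opposite side of the square closes a larger triangle. After the move this triangle is not a
    -- directed cycle.
    have hpath : ∀ l, W.IsPath (![A (j + 1 + 1 + 1), a (i + 1), A (j + 1 + 1)] l)
        (![m i + 1, m (i + 1) + 1, 0] l) := by
      refine forall_fin_three.mpr ⟨?_, ?_, ?_⟩
      · change W.IsPath (A (j + 1 + 1 + 1)) (m i + 1)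
        rw [add_comm (m i)]
        refine (hone _ ?_).append ?_
        · rw [← ho0]; exact Pass.opp (Or.inl hT0)
        · change W.IsPath (W.nxt (A (j + 1 + 1 + 1))) (m i)
          rw [hn1]
          exact hP.path i
      · refine (hP.path (i + 1)).append (hone _ ?_)
        rw [← ho2]
        exact Pass.opp (Or.inl hT2)
      · exact fun t ht => absurd ht (Nat.not_lt_zero t)
    have hcorner : ∀ l, W.Cross (![A (j + 1 + 1 + 1), a (i + 1), A (j + 1 + 1)] (l + 1))
        (W.rev (W.nxt^[![m i + 1, m (i + 1) + 1, 0] l]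
          (![A (j + 1 + 1 + 1), a (i + 1), A (j + 1 + 1)] l))) := by
      refine forall_fin_three.mpr ⟨?_, ?_, ?_⟩
      · change W.Cross (a (i + 1)) (W.rev (W.nxt^[m i + 1] (A (j + 1 + 1 + 1))))
        rw [hn1']
        exact hP.corner (by decide) i
      · change W.Cross (A (j + 1 + 1)) (W.rev (W.nxt^[m (i + 1) + 1] (a (i + 1))))
        rw [hn2]
        exact hA.cross hk _
      · change W.Cross (A (j + 1 + 1 + 1)) (W.rev (A (j + 1 + 1)))
        exact hA.cross hk _
    obtain ⟨δ', hδ'⟩ := htri _ _ hpath hcorner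
    have e1 := hδ' 0 1 (by simp)
    have e2 := hδ' 2 0 (by simp)
    change W'.out (W.nxt (A (j + 1 + 1 + 1))) ↔ _ at e1
    change W'.out (A (j + 1 + 1)) ↔ _ at e2
    rw [hn1] at e1
    have e3 := hout _ (hn0 0 (Nat.zero_le _))
    have e4 := hin _ (hSA (j + 1 + 1))
    have e5 := hs0 0 (Nat.zero_le _)
    have e6 := halt j
    have e7 := halt (j + 1)
    have e8 := W.out_rev _ (hAd j)
    rw [← hj] at e8
    have f1 : W.out (A j) ↔ ε := not_iff_not.mp (e8.symm.trans hs2)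
    have f2 : W.out (A (j + 1 + 1)) ↔ ε := e7.trans ((not_congr e6).trans (not_not.trans f1))
    have f3 : δ' ↔ ¬ ε := e2.symm.trans (e4.trans (not_congr f2))
    exact iff_not_self ((e1.symm.trans (e3.trans e5)).symm.trans f3)
  -- Now every edge of sides `i` and `i + 1` belongs to the square. At a vertex of the square only
  -- two neighbouring darts do, so side `i + 1` is a single edge and the square turns with the
  -- triangle into the third side, which then is reversed too.
  · have hδε : δ ↔ ¬ ε := hδ2.symm.trans ((hout _ hS2).trans hs2)
    have hn0 : ∀ k ≤ m i, W.nxt^[k] (a i) ∈ S := by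
      intro k hk
      by_contra hkS
      exact iff_not_self (((hδ i k hk).symm.trans ((hout _ hkS).trans (hs0 k hk))).symm.trans hδε)
    have hn1 : ∀ k ≤ m (i + 1), W.nxt^[k] (a (i + 1)) ∈ S := by
      intro k hk
      by_contra hkS
      exact iff_not_self (((hδ _ k hk).symm.trans ((hout _ hkS).trans (hs1 k hk))).symm.trans hδε)
    have hrevS : ∀ d ∈ S, W.rev d ∈ S := by
      rintro d ⟨j, rfl | rfl⟩
      · exact ⟨j, Or.inr rfl⟩
      · exact ⟨j, Or.inl (W.rev_rev _)⟩
    obtain ⟨k, hk1 | hk1⟩ := hn1 0 (Nat.zero_le _)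
    · simp only [Function.iterate_zero, id] at hk1
      have hm1 : m (i + 1) = 0 := by
        by_contra hm1
        have e1 := hn1 1 (Nat.pos_of_ne_zero hm1)
        change W.nxt (a (i + 1)) ∈ S at e1
        rw [hk1] at e1
        have e2 := hA.cross hk k
        rcases hmem (k + 1) _ (e2.same.trans (same_nxt _)) e1 with e3 | e3
        · exact e2.symm.opp_ne e3
        · rw [hA.rot_succ] at e3
          refine nxt_ne_rev ?_ e3
          rw [← hk1]
          exact hP.path (i + 1) 0 (Nat.pos_of_ne_zero hm1)
      refine hS2 ⟨k + 1, Or.inl (W.rot.injective ?_)⟩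
      rw [hA.rot_succ, hcv, hm1, ← hk1]
      rfl
    · simp only [Function.iterate_zero, id] at hk1
      have e1 := hrevS _ (hn0 _ le_rfl)
      rw [← hcv, hk1, ← hA.rot_succ] at e1
      have e2 := hA.cross hk k
      rw [← hA.rot_succ] at e2
      rcases hmem (k + 1) _ ((same_rot _).trans (same_rot _)) e1 with e3 | e3
      · exact e2.2.2.2.2 e3
      · exact e2.ne (W.rot.injective e3).symm

end

section

variable {D F : Type*} {W W' : Web D F}

/-! ### Darts on one strand -/

/-- The darts belong to the same strand. -/
def Linked (W : Web D F) : D → D → Prop :=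
  Relation.ReflTransGen fun d e => e = W.rev d ∨ (W.Pass d ∧ e = W.opp d)

lemma linked_rev (d : D) : W.Linked d (W.rev d) := Relation.ReflTransGen.single (Or.inl rfl)

lemma Linked.trans {d e f : D} (h : W.Linked d e) (h' : W.Linked e f) : W.Linked d f :=
  Relation.ReflTransGen.trans h h'

lemma linked_opp (d : D) : W.Linked d (W.opp d) := by
  by_cases h : W.Pass d
  · exact Relation.ReflTransGen.single (Or.inr ⟨h, rfl⟩)
  · rw [opp_of_not_pass h]
    exact Relation.ReflTransGen.refl

lemma Linked.symm {d e : D} (h : W.Linked d e) : W.Linked e d := by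
  induction h with
  | refl => exact Relation.ReflTransGen.refl
  | tail _ h ih =>
    refine Linked.trans ?_ ih
    rename_i b c _
    rcases h with rfl | ⟨-, rfl⟩
    · have := linked_rev (W := W) (W.rev b)
      rwa [W.rev_rev] at this
    · have := linked_opp (W := W) (W.opp b)
      rwa [opp_opp] at this

variable [Finite D]

omit [Finite D] in
lemma linked_nxt (d : D) : W.Linked d (W.nxt d) := (linked_rev d).trans (linked_opp _)

lemma Seg.linked {d e : D} (h : W.Seg d e) : W.Linked d e := by
  induction h with
  | refl => exact Relation.ReflTransGen.refl
  | tail _ h ih =>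
    obtain ⟨-, rfl⟩ := step_iff.mp h
    exact ih.trans (linked_nxt _)

/-- Each generating step reverses the last dart, prolongs the path or shortens it; `key` treats the
step that retraces the end of the path. -/
lemma linked_cases {d e : D} (h : W.Linked d e) :
    W.Seg d e ∨ W.Seg d (W.rev e) ∨ W.Seg (W.rev d) e ∨ W.Seg (W.rev d) (W.rev e) := by
  have hstep : ∀ e, W.Pass e → W.Step (W.rev e) (W.opp e) := fun e he => by
    rw [step_iff, nxt, W.rev_rev]
    exact ⟨he, rfl⟩
  have key : ∀ u e, W.Pass e → W.Seg u e →
      W.Seg u (W.rev (W.opp e)) ∨ W.Seg (W.rev u) (W.opp e) := by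
    intro u e he h
    rcases Relation.ReflTransGen.cases_tail h with rfl | ⟨c, h1, h2⟩
    · exact Or.inr (Relation.ReflTransGen.single (hstep _ he))
    · obtain ⟨-, rfl⟩ := step_iff.mp h2
      rw [nxt, opp_opp, W.rev_rev]
      exact Or.inl h1
  induction h with
  | refl => exact Or.inl Relation.ReflTransGen.refl
  | tail _ h ih =>
    rename_i b c _
    rcases h with rfl | ⟨hp, rfl⟩
    · rw [W.rev_rev]; tauto
    · rcases ih with h | h | h | h
      · rcases key _ _ hp h with h1 | h1 <;> tauto
      · exact Or.inl (h.tail (hstep _ hp))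
      · have := key _ _ hp h
        rw [W.rev_rev] at this
        tauto
      · exact Or.inr (Or.inr (Or.inl (h.tail (hstep _ hp))))

lemma IsT.eq_or_opp {z e e' : D} (hT : W.IsT z) (h : W.Cross z e) (h' : W.Cross z e') :
    e' = e ∨ e' = W.opp e := by
  have key : ∀ e, W.Cross z e → e = W.rot z ∨ e = W.rot (W.rot (W.rot z)) := by
    intro e he
    rcases hT.cases he.same with h1 | h1 | h1 | h1
    · exact absurd h1.symm he.ne
    · exact Or.inl h1
    · exact absurd ((opp_of_isT hT).trans h1.symm) he.opp_ne
    · exact Or.inr h1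
  have h1 := opp_of_isT hT.rot
  have h2 := opp_opp (W := W) (W.rot z)
  rw [h1] at h2
  rcases key e h with rfl | rfl <;> rcases key e' h' with rfl | rfl
  · exact Or.inl rfl
  · exact Or.inr h1.symm
  · exact Or.inr h2.symm
  · exact Or.inl rfl

lemma eq_or_opp_of_same {e e' : D} (hT : W.IsT e) (hs : W.rot.SameCycle e e')
    (hc : ¬ W.Cross e e') : e' = e ∨ e' = W.opp e := by
  by_cases hne : e = e'
  · exact Or.inl hne.symm
  · exact Or.inr ((cross_or_opp hT hs hne).resolve_left hc)

/-! ### Strands in a web without polygons of at most two sides -/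

section NoSmall

variable (hno : ∀ C, ¬ W.IsSmall C)

include hno

/-- A strand that crossed itself would contain a monogon. -/
lemma Cross.not_linked {d e : D} (h : W.Cross d e) : ¬ W.Linked d e := by
  have key : ∀ {d e}, W.Cross d e → ¬ W.Seg d e := by
    intro d e h hs
    obtain ⟨m, hm, rfl⟩ := seg_iff.mp hs
    rcases Nat.eq_zero_or_pos m with rfl | h0
    · exact h.ne rfl
    · exact hm.inj_of_no_small hno (i := 0) h0 (by omega) h.2.1 h.same
  intro hl
  rcases linked_cases hl with hs | hs | hs | hs
  · exact key h hs
  · obtain ⟨m, hm, he⟩ := seg_iff.mp hs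
    refine hm.inj_of_no_small hno (i := 0) (Nat.succ_pos m) le_rfl h.2.1 (h.same.trans ?_)
    have := same_rev_iterate (W := W) d m
    rwa [he, W.rev_rev] at this
  · obtain ⟨m, hm, he⟩ := seg_iff.mp hs
    rcases m with _ | _ | m
    · have he' : W.rev d = e := he
      have hp : W.IsPath d 0 := fun t ht => absurd ht (by omega)
      refine hp.inj_of_no_small hno (i := 0) one_pos le_rfl h.2.1 (h.same.trans ?_)
      rw [← he']
      exact same_nxt d
    · have he' : W.nxt (W.rev d) = e := he
      rw [nxt, W.rev_rev] at he'
      exact h.opp_ne he'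
    · have h1 : W.rot.SameCycle d (W.nxt^[1] (W.rev d)) := by
        have := same_nxt (W := W) (W.rev d)
        rwa [W.rev_rev] at this
      refine hm.inj_of_no_small hno (i := 1) (j := m + 2) (by omega) (by omega) ?_ ?_
      · exact fun hb => h.2.1 ((bdry_congr h1).mpr hb)
      · rw [he]
        exact h1.symm.trans h.same
  · have := seg_rev hs
    rw [W.rev_rev, W.rev_rev] at this
    exact key h.symm this

-- Since `Linked` forgets the direction of travel, the path towards `d'` may have to start with the
-- dart opposite to `d`.
omit hno in
lemma exists_path_of_linked {d d' : D} (h : W.Linked d d') (hs : ¬ W.rot.SameCycle d d') :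
    ∃ z k, (z = d ∨ (W.Pass d ∧ z = W.opp d)) ∧ W.IsPath z k ∧
      W.rot.SameCycle (W.nxt^[k + 1] z) d' := by
  have key : ∀ e, W.Seg d e → (W.rot.SameCycle e d' ∨ W.rot.SameCycle (W.rev e) d') →
      ∃ k, W.IsPath d k ∧ W.rot.SameCycle (W.nxt^[k + 1] d) d' := by
    intro e he h
    obtain ⟨m, hm, rfl⟩ := seg_iff.mp he
    rcases h with h | h
    · rcases Nat.eq_zero_or_pos m with rfl | h0
      · exact absurd h hs
      · exact ⟨m - 1, hm.mono (by omega), by rwa [Nat.sub_add_cancel h0]⟩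
    · exact ⟨m, hm, (same_rev_iterate _ _).symm.trans h⟩
  have key' : ∀ e, W.Seg (W.rev d) e → (W.rot.SameCycle e d' ∨ W.rot.SameCycle (W.rev e) d') →
      ∃ z k, (z = d ∨ (W.Pass d ∧ z = W.opp d)) ∧ W.IsPath z k ∧
        W.rot.SameCycle (W.nxt^[k + 1] z) d' := by
    intro e he h
    have hn : W.nxt (W.rev d) = W.opp d := by rw [nxt, W.rev_rev]
    obtain ⟨m, hm, rfl⟩ := seg_iff.mp he
    rcases m with _ | m
    · rcases h with h | h
      · exact ⟨d, 0, Or.inl rfl, fun t ht => absurd ht (by omega), (same_nxt d).symm.trans h⟩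
      · rw [Function.iterate_zero, id, W.rev_rev] at h
        exact absurd h hs
    · have hp := hm 0 (Nat.succ_pos m)
      rw [Function.iterate_zero, id, W.rev_rev] at hp
      have hm' : W.IsPath (W.opp d) m := by
        have := hm.shift 1 m (by omega)
        change W.IsPath (W.nxt (W.rev d)) m at this
        rwa [hn] at this
      rw [Function.iterate_succ_apply, hn] at h
      rcases h with h | h
      · rcases Nat.eq_zero_or_pos m with rfl | h0
        · exact absurd ((same_opp d).trans h) hs
        · exact ⟨_, m - 1, Or.inr ⟨hp, rfl⟩, hm'.mono (by omega), by rwa [Nat.sub_add_cancel h0]⟩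
      · exact ⟨_, m, Or.inr ⟨hp, rfl⟩, hm', (same_rev_iterate _ _).symm.trans h⟩
  have hr : W.rot.SameCycle (W.rev (W.rev d')) d' := by rw [W.rev_rev]
  rcases linked_cases h with h | h | h | h
  · obtain ⟨k, hk⟩ := key _ h (Or.inl (Equiv.Perm.SameCycle.refl _ _))
    exact ⟨d, k, Or.inl rfl, hk⟩
  · obtain ⟨k, hk⟩ := key _ h (Or.inr hr)
    exact ⟨d, k, Or.inl rfl, hk⟩
  · exact key' _ h (Or.inl (Equiv.Perm.SameCycle.refl _ _))
  · exact key' _ h (Or.inr hr)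

/-- Two strands have at most one crossing. The darts at the first crossing are replaced by opposite
ones where necessary, so that both strands run towards the second. -/
lemma Cross.same_of_linked {d e d' e' : D} (h : W.Cross d e) (h' : W.Cross d' e')
    (hd : W.Linked d d') (he : W.Linked e e') : W.rot.SameCycle d d' := by
  by_contra hs
  obtain ⟨z, k, hz, hk, hk'⟩ := exists_path_of_linked hd hs
  obtain ⟨w, l, hw, hl, hl'⟩ := exists_path_of_linked he
    (fun h1 => hs (h.same.trans (h1.trans h'.same.symm)))
  have hT : ∀ {d e}, W.Cross d e → W.Pass d → W.IsT d := fun h hp =>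
    h.isT_or.resolve_right (not_not.mpr hp)
  have hc : W.Cross z w := by
    have h1 : W.Cross z e := by
      rcases hz with rfl | ⟨hp, rfl⟩
      exacts [h, h.opp_left (hT h hp)]
    rcases hw with rfl | ⟨hp, rfl⟩
    exacts [h1, (h1.symm.opp_left (hT h.symm hp)).symm]
  refine hc.no_second_crossing hno hk hl (Nat.succ_pos k) le_rfl (Nat.succ_pos l) le_rfl ?_
    (hk'.trans (h'.same.trans hl'.symm))
  exact fun hb => h'.2.1 ((bdry_congr hk').mp hb)

end NoSmall

/-! ### Triangles with a side in common with a directed triangle -/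

/-- Such a strand would be symmetric about its middle, which would be a dart equal to its reverse or
a vertex where the strand turns back. -/
lemma seg_ne_rev {d : D} : ¬ W.Seg d (W.rev d) := by
  intro h
  obtain ⟨m, hm, he⟩ := seg_iff.mp h
  have key : ∀ t ≤ m, W.nxt^[t] d = W.rev (W.nxt^[m - t] d) := by
    intro t ht
    rw [← nxt_iterate_rev_of_le _ ht, he, W.rev_rev]
  rcases Nat.even_or_odd' m with ⟨t, rfl | rfl⟩
  · have := key t (by omega)
    rw [show 2 * t - t = t by omega] at this
    exact W.rev_ne _ this.symm
  · have := key (t + 1) (by omega)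
    rw [show 2 * t + 1 - (t + 1) = t by omega, Function.iterate_succ_apply'] at this
    exact nxt_ne_rev (hm t (by omega)) this

/-- A path along the strand of `b` that joins the two ends of `b` is `b` itself: otherwise, together
with `b`, it would close up or return along its own first edge. -/
lemma path_eq_edge (h0 : ∀ d, ¬ Relation.TransGen W.Step d d) {b d : D} {m : ℕ} (hb : W.IsT b)
    (hb' : W.IsT (W.rev b)) (hm : W.IsPath d m) (hd : d = b ∨ d = W.opp b)
    (he : W.rev (W.nxt^[m] d) = W.rev b ∨ W.rev (W.nxt^[m] d) = W.opp (W.rev b)) :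
    m = 0 ∧ d = b := by
  have hs : W.Seg d (W.nxt^[m] d) := seg_iff.mpr ⟨m, hm, rfl⟩
  have s1 : W.Step (W.rev b) (W.opp b) := by
    rw [step_iff, nxt, W.rev_rev]
    exact ⟨Or.inl hb, rfl⟩
  have s2 : ∀ e, W.rev e = W.opp (W.rev b) → W.Step e (W.rev b) := by
    intro e he
    rw [step_iff, nxt, he, opp_opp]
    exact ⟨Pass.opp (Or.inl hb'), rfl⟩
  rcases hd with rfl | rfl <;> rcases he with he | he
  · refine ⟨?_, rfl⟩
    by_contra hm0
    refine h0 d ?_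
    rw [W.rev.injective he] at hs
    obtain ⟨m, rfl⟩ := Nat.exists_eq_add_of_le' (Nat.pos_of_ne_zero hm0)
    have h1 : W.Seg (W.nxt d) d := by
      refine seg_iff.mpr ⟨m, hm.shift 1 m (by omega), ?_⟩
      rw [← Function.iterate_succ_apply]
      exact W.rev.injective he
    exact Relation.TransGen.head' (step_iff.mpr ⟨hm 0 (by omega), rfl⟩) h1
  · exact absurd (hs.tail (s2 _ he)) seg_ne_rev
  · rw [W.rev.injective he] at hs
    have : W.Seg (W.rev b) (W.rev (W.rev b)) := by
      rw [W.rev_rev]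
      exact Relation.ReflTransGen.head s1 hs
    exact absurd this seg_ne_rev
  · exact absurd (Relation.TransGen.head' s1 (hs.tail (s2 _ he))) (h0 _)

/-- A common side puts the other two sides of the triangle on the strands of the other two edges.
These cross only once, so the third corners agree, and `path_eq_edge` identifies the sides. The
properties of strands are hypotheses because the lemma is applied to the flipped web. -/
lemma triangle_eq_of_edge (h0 : ∀ d, ¬ Relation.TransGen W.Step d d)
    (h1 : ∀ d e, W.Cross d e → ¬ W.Linked d e)
    (h2 : ∀ d e d' e', W.Cross d e → W.Cross d' e' → W.Linked d d' → W.Linked e e' →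
      W.rot.SameCycle d d')
    {a : Fin 3 → D} (hT : ∀ i, W.IsT (a i)) (hT' : ∀ i, W.IsT (W.rev (a i)))
    (hX : ∀ i, W.Cross (a i) (W.rev (a (i + 1)))) {A : Fin 3 → D} {m : Fin 3 → ℕ}
    (hm : ∀ i, W.IsPath (A i) (m i))
    (hc : ∀ i, W.Cross (A (i + 1)) (W.rev (W.nxt^[m i] (A i)))) {i k : Fin 3} (hik : A i = a k)
    (hmi : m i = 0) (l : Fin 3) : m l = 0 ∧ ∃ j, A l = a j := by
  have c0 := hc i
  have c2 := hc (i + 1 + 1)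
  have x2 := hX (k + 1 + 1)
  rw [hmi, Function.iterate_zero, id, hik] at c0
  rw [fin_three_add, hik] at c2
  rw [fin_three_add] at x2
  have e1 := (hT' k).eq_or_opp x2.symm c0.symm
  have e2 := (hT k).eq_or_opp (hX k) c2
  have l1 : W.Linked (a (k + 1 + 1)) (A (i + 1)) := by
    rcases e1 with e1 | e1 <;> rw [e1]
    exacts [Relation.ReflTransGen.refl, linked_opp _]
  have l2 : W.Linked (a (k + 1)) (W.rev (W.nxt^[m (i + 1 + 1)] (A (i + 1 + 1)))) := by
    rcases e2 with e2 | e2 <;> rw [e2]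
    exacts [linked_rev _, (linked_rev _).trans (linked_opp _)]
  have l3 : W.Linked (W.rev (a (k + 1 + 1))) (W.rev (W.nxt^[m (i + 1)] (A (i + 1)))) :=
    (linked_rev _).symm.trans (l1.trans ((Seg.linked (seg_iff.mpr ⟨_, hm _, rfl⟩)).trans
      (linked_rev _)))
  have l4 : W.Linked (a (k + 1)) (A (i + 1 + 1)) :=
    l2.trans ((linked_rev _).symm.trans (Seg.linked (seg_iff.mpr ⟨_, hm _, rfl⟩)).symm)
  have hs := h2 _ _ _ _ (hX (k + 1)) (hc (i + 1)) l4 l3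
  have e3 := eq_or_opp_of_same (hT _) hs (fun h => h1 _ _ h l4)
  have e4 := eq_or_opp_of_same (hT' (k + 1 + 1))
    ((hX (k + 1)).same.symm.trans (hs.trans (hc (i + 1)).same)) (fun h => h1 _ _ h l3)
  have q1 := path_eq_edge h0 (hT _) (hT' _) (hm _) e1 e4
  have q2 := path_eq_edge h0 (hT _) (hT' _) (hm _) e3 e2
  rcases fin_three_cases i l with rfl | rfl | rfl
  · exact ⟨hmi, k, hik⟩
  · exact ⟨q1.1, _, q1.2⟩
  · exact ⟨q2.1, _, q2.2⟩

end

section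

variable {D F : Type*} {W W' : Web D F}

/-! ### Reducibility implies a reducible configuration: triangles -/

/-- The web `W'` arises from `W` by flipping the directed triangle `a` with three different
tetravalent vertices. -/
structure TriFlip (W W' : Web D F) (a : Fin 3 → D) : Prop where
  polygon : W.IsPolygon a
  cyclic : W.IsCyclic a
  isT : ∀ i, W.IsT (a i)
  ne : ∀ i j, W.rot.SameCycle (a i) (a j) → i = j
  rev_eq : W'.rev = W.rev
  dbl_eq : W'.dbl = W.dbl
  out_eq : W'.out = W.out
  bdry_eq : W'.bdry = W.bdry
  rot_rev : ∀ i, W'.rot (W.rev (a (i + 1))) = a i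
  rot_side : ∀ i, W'.rot (a i) = W.nxt (a (i + 1))
  rot_nxt : ∀ i, W'.rot (W.nxt (a (i + 1))) = W.opp (a i)
  rot_opp : ∀ i, W'.rot (W.opp (a i)) = W.rev (a (i + 1))
  rot_off : ∀ d, (∀ i, ¬ W.rot.SameCycle (a i) d) → W'.rot d = W.rot d

/-- The darts of the edges of a polygon. -/
def edges (W : Web D F) {k : ℕ} (a : Fin k → D) : Set D := {d | ∃ i, d = a i ∨ d = W.rev (a i)}

open Classical in
/-- Move a dart along its strand from a vertex of the flipped triangle to the vertex at which the
same strands cross in the given triangle. -/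
noncomputable def slide (W : Web D F) (S : Set D) (d : D) : D :=
  if d ∈ S then W.nxt d else if W.opp d ∈ S then W.rev (W.opp d) else d

variable [Finite D]

lemma triFlip_of_triangleMove (hno : ∀ C, ¬ W.IsSmall C) (h : W.TriangleMove W') :
    ∃ a, W.TriFlip W' a := by
  obtain ⟨a, x, y, hA, hc, hx, hy, h1, h2, h3, h4, -, h5, h6, -⟩ := h
  have hk : ∀ i : Fin 3, i ≠ i + 1 := by decide
  have hv : ∀ i j, W.rot.SameCycle (a i) (a j) → i = j := by
    intro i j hs
    rcases fin_three_cases i j with rfl | rfl | rfl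
    · rfl
    · exact absurd hs (hA.vertex_ne hno i)
    · have := hA.vertex_ne hno (i + 1 + 1)
      rw [fin_three_add] at this
      exact absurd hs.symm this
  have h5' : ∀ i, W'.rot (W.rev (a (i + 1))) = a i ∧ W'.rot (a i) = y (i + 1 + 1) ∧
      W'.rot (y (i + 1 + 1)) = x i ∧ W'.rot (x i) = W.rev (a (i + 1)) := by
    intro i
    have := h5 (i + 1)
    rwa [add_sub_cancel_right] at this
  -- At a trivalent vertex three turns lead back to `a i`, and the relator would require `W'.rot (a
  -- i)` to be a dart at two different vertices.
  have hT : ∀ i, W.IsT (a i) := by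
    intro i
    by_contra hT
    have hp : ¬ W.Pass (a i) := fun hp => hp.elim hT (hA.not_isL hk i)
    obtain ⟨e, -, h7, -, -, -, -, -, h8⟩ := isTrivalent_of_not_pass (hA.2.2.2.2 i) hp
    have hyi : y i = a i := by
      rw [hy]
      rcases h8 _ (Equiv.Perm.SameCycle.refl _ _) with h | h | h <;> rw [h] <;> simp only [h7]
    have h9 := (h5' (i + 1)).2.2.1
    rw [fin_three_add, hyi, (h5' i).2.1] at h9
    have h10 : W.rot.SameCycle (a (i + 1 + 1)) (y (i + 1 + 1)) := by
      rw [hy]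
      exact (same_rot _).trans ((same_rot _).trans (same_rot _))
    have h11 : W.rot.SameCycle (a (i + 1)) (x (i + 1)) := by
      rw [hx]
      exact (same_rot _).trans (same_rot _)
    rw [h9] at h10
    exact hk _ (hv _ _ (h11.trans h10.symm))
  have hxo : ∀ i, x i = W.opp (a i) := fun i => by rw [hx, opp_of_isT (hT i)]
  have hyn : ∀ i, y (i + 1) = W.nxt (a i) := fun i => by
    have hT' := (hT (i + 1)).rot
    rw [hA.rot_succ] at hT'
    rw [hy, nxt, opp_of_isT hT', ← hA.rot_succ]
  refine ⟨a, hA, hc, hT, hv, h1, h2, h3, h4, fun i => (h5' i).1, fun i => ?_, fun i => ?_,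
    fun i => ?_, h6⟩
  · rw [← hyn]; exact (h5' i).2.1
  · rw [← hyn, ← hxo]; exact (h5' i).2.2.1
  · rw [← hxo]; exact (h5' i).2.2.2

/-! ### Sliding crossings along strands across a triangle flip -/

namespace TriFlip

variable {a : Fin 3 → D} (H : W.TriFlip W' a)

include H

omit [Finite D] in
lemma same_rev (i : Fin 3) : W.rot.SameCycle (a (i + 1)) (W.rev (a i)) := by
  rw [← H.polygon.rot_succ]
  exact same_rot _

lemma isT_rev (i : Fin 3) : W.IsT (W.rev (a i)) := (H.isT _).congr (H.same_rev i)

omit H [Finite D] in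
lemma _root_.A3.Web.rev_mem_edges {d : D} (hd : d ∈ W.edges a) : W.rev d ∈ W.edges a := by
  obtain ⟨i, rfl | rfl⟩ := hd
  · exact ⟨i, Or.inr rfl⟩
  · exact ⟨i, Or.inl (W.rev_rev _)⟩

omit H [Finite D] in
lemma _root_.A3.Web.rev_mem_edges_iff {d : D} : W.rev d ∈ W.edges a ↔ d ∈ W.edges a :=
  ⟨fun h => by have := rev_mem_edges h; rwa [W.rev_rev] at this, rev_mem_edges⟩

lemma isT_of_mem {d : D} (hd : d ∈ W.edges a) : W.IsT d := by
  obtain ⟨i, rfl | rfl⟩ := hd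
  exacts [H.isT i, H.isT_rev i]

lemma opp_notMem {d : D} (hd : d ∈ W.edges a) : W.opp d ∉ W.edges a := by
  have key : ∀ i, W.opp (a i) ∉ W.edges a := by
    rintro i ⟨j, h | h⟩
    · have := H.ne i j (h ▸ same_opp (a i))
      subst this
      exact (Pass.opp_ne (Or.inl (H.isT i))) h
    · have h1 := H.ne i (j + 1) ((h ▸ same_opp (a i) : W.rot.SameCycle _ _).trans
        (H.same_rev j).symm)
      subst h1
      rw [← H.polygon.rot_succ] at h
      exact (isT_cross (H.isT _)).opp_ne h
  obtain ⟨i, rfl | rfl⟩ := hd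
  · exact key i
  · rintro ⟨j, h | h⟩
    · refine key j ⟨i, Or.inr ?_⟩
      rw [← h, opp_opp]
    · have h1 := H.ne (i + 1) (j + 1) ((H.same_rev i).trans
        ((h ▸ same_opp (W.rev (a i)) : W.rot.SameCycle _ _).trans (H.same_rev j).symm))
      obtain rfl := add_right_cancel h1
      exact (Pass.opp_ne (Or.inl (H.isT_rev i))) h

omit H [Finite D] in
lemma _root_.A3.Web.slide_of_mem {S : Set D} {d : D} (hd : d ∈ S) : W.slide S d = W.nxt d :=
  if_pos hd

lemma slide_of_opp_mem {d : D} (hd : W.opp d ∈ W.edges a) :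
    W.slide (W.edges a) d = W.rev (W.opp d) := by
  have := H.opp_notMem hd
  rw [opp_opp] at this
  rw [slide, if_neg this, if_pos hd]

omit H [Finite D] in
lemma _root_.A3.Web.slide_of_notMem {S : Set D} {d : D} (h1 : d ∉ S) (h2 : W.opp d ∉ S) :
    W.slide S d = d := by
  rw [slide, if_neg h1, if_neg h2]

lemma slide_slide (d : D) : W.slide (W.edges a) (W.slide (W.edges a) d) = d := by
  by_cases h1 : d ∈ W.edges a
  · rw [slide_of_mem h1, H.slide_of_opp_mem, nxt, opp_opp, W.rev_rev]
    rw [nxt, opp_opp]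
    exact rev_mem_edges h1
  by_cases h2 : W.opp d ∈ W.edges a
  · rw [H.slide_of_opp_mem h2, slide_of_mem (rev_mem_edges h2), nxt, W.rev_rev, opp_opp]
  · rw [slide_of_notMem h1 h2, slide_of_notMem h1 h2]

lemma slide_injective : Function.Injective (W.slide (W.edges a)) :=
  Function.LeftInverse.injective H.slide_slide

lemma mem_or_opp_mem {d : D} {i : Fin 3} (h : W.rot.SameCycle (a (i + 1)) d) :
    d = a (i + 1) ∨ d = W.rev (a i) ∨ d = W.opp (a (i + 1)) ∨ d = W.nxt (a i) := by
  have h1 := opp_of_isT (H.isT (i + 1))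
  have h2 := opp_of_isT (H.isT (i + 1)).rot
  rw [H.polygon.rot_succ] at h2
  rcases (H.isT (i + 1)).cases h with h3 | h3 | h3 | h3
  · exact Or.inl h3
  · exact Or.inr (Or.inl (by rw [h3, H.polygon.rot_succ]))
  · exact Or.inr (Or.inr (Or.inl (by rw [h3, h1])))
  · exact Or.inr (Or.inr (Or.inr (by rw [h3, nxt, h2, H.polygon.rot_succ])))

omit [Finite D] H in
lemma side_mem (i : Fin 3) : a i ∈ W.edges a := ⟨i, Or.inl rfl⟩

omit [Finite D] H in
lemma slide_side (i : Fin 3) : W.slide (W.edges a) (a i) = W.nxt (a i) :=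
  slide_of_mem (side_mem i)

omit [Finite D] H in
lemma slide_rev (i : Fin 3) : W.slide (W.edges a) (W.rev (a i)) = W.opp (a i) := by
  rw [slide_of_mem (rev_mem_edges (side_mem i)), nxt, W.rev_rev]

lemma slide_opp (i : Fin 3) : W.slide (W.edges a) (W.opp (a i)) = W.rev (a i) := by
  rw [H.slide_of_opp_mem, opp_opp]
  rw [opp_opp]
  exact side_mem i

lemma slide_nxt (i : Fin 3) : W.slide (W.edges a) (W.nxt (a i)) = a i := by
  rw [H.slide_of_opp_mem, nxt, opp_opp, W.rev_rev]
  rw [nxt, opp_opp]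
  exact rev_mem_edges (side_mem i)

omit [Finite D] in
lemma slide_of_off {d : D} (h : ∀ i, ¬ W.rot.SameCycle (a i) d) : W.slide (W.edges a) d = d := by
  have key : ∀ e ∈ W.edges a, ∃ i, W.rot.SameCycle (a i) e := by
    rintro e ⟨i, rfl | rfl⟩
    exacts [⟨i, Equiv.Perm.SameCycle.refl _ _⟩, ⟨i + 1, H.same_rev i⟩]
  refine slide_of_notMem (fun hd => ?_) fun hd => ?_
  · obtain ⟨i, hi⟩ := key _ hd
    exact h i hi
  · obtain ⟨i, hi⟩ := key _ hd
    exact h i (hi.trans (same_opp d).symm)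

/-- `slide` conjugates the new rotation to the old one. Hence crossings of `W'` become crossings of
`W` between the same strands. -/
lemma slide_rot (d : D) : W.slide (W.edges a) (W'.rot d) = W.rot (W.slide (W.edges a) d) := by
  by_cases hex : ∃ i, W.rot.SameCycle (a i) d
  · obtain ⟨i, hi⟩ := hex
    have hi' : W.rot.SameCycle (a (i + 1 + 1 + 1)) d := by rwa [fin_three_add]
    have r1 : ∀ i, W.rot (W.opp (a (i + 1))) = W.nxt (a i) := fun i => by
      have h2 := opp_of_isT (H.isT (i + 1)).rot
      rw [H.polygon.rot_succ] at h2
      rw [opp_of_isT (H.isT _), H.polygon.rot_succ, nxt, h2]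
    have r2 : ∀ i, W.rot (W.nxt (a i)) = a (i + 1) := fun i => by
      rw [← r1, opp_of_isT (H.isT _), (H.isT _).2.1]
    have r3 : ∀ i, W.rot (W.rev (a i)) = W.opp (a (i + 1)) := fun i => by
      rw [opp_of_isT (H.isT _), H.polygon.rot_succ]
    rcases H.mem_or_opp_mem hi' with rfl | rfl | rfl | rfl
    · rw [H.rot_side, H.slide_nxt, slide_side, r2]
    · rw [H.rot_rev, slide_side, slide_rev, r1]
    · rw [H.rot_opp, slide_rev, H.slide_opp, r3]
    · rw [H.rot_nxt, H.slide_opp, H.slide_nxt, H.polygon.rot_succ]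
  · push Not at hex
    have hex' : ∀ i, ¬ W.rot.SameCycle (a i) (W.rot d) := fun i h =>
      hex i (h.trans (same_rot d).symm)
    rw [H.rot_off d hex, H.slide_of_off hex, H.slide_of_off hex']

lemma isT_slide {d : D} (h : d ∈ W.edges a ∨ W.opp d ∈ W.edges a) :
    W.IsT d ∧ W.IsT (W.slide (W.edges a) d) := by
  rcases h with h | h
  · rw [slide_of_mem h]
    exact ⟨H.isT_of_mem h, (H.isT_of_mem (rev_mem_edges h)).congr (same_nxt d)⟩
  · rw [H.slide_of_opp_mem h]
    exact ⟨(H.isT_of_mem h).congr (same_opp d).symm, H.isT_of_mem (rev_mem_edges h)⟩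

lemma isT_slide_iff (d : D) : W.IsT (W.slide (W.edges a) d) ↔ W.IsT d := by
  by_cases h : d ∈ W.edges a ∨ W.opp d ∈ W.edges a
  · exact iff_of_true (H.isT_slide h).2 (H.isT_slide h).1
  · rw [not_or] at h
    rw [slide_of_notMem h.1 h.2]

lemma bdry_slide (d : D) : W.bdry (W.slide (W.edges a) d) ↔ W.bdry d := by
  by_cases h : d ∈ W.edges a ∨ W.opp d ∈ W.edges a
  · exact iff_of_false (H.isT_slide h).2.1 (H.isT_slide h).1.1
  · rw [not_or] at h
    rw [slide_of_notMem h.1 h.2]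

lemma dbl_slide (d : D) : W.dbl (W.slide (W.edges a) d) ↔ W.dbl d := by
  by_cases h : d ∈ W.edges a ∨ W.opp d ∈ W.edges a
  · exact iff_of_false (H.isT_slide h).2.not_dbl (H.isT_slide h).1.not_dbl
  · rw [not_or] at h
    rw [slide_of_notMem h.1 h.2]

lemma linked_slide (d : D) : W.Linked d (W.slide (W.edges a) d) := by
  by_cases h1 : d ∈ W.edges a
  · rw [slide_of_mem h1]
    exact linked_nxt d
  by_cases h2 : W.opp d ∈ W.edges a
  · rw [H.slide_of_opp_mem h2]
    exact (linked_opp d).trans (linked_rev _)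
  · rw [slide_of_notMem h1 h2]
    exact Relation.ReflTransGen.refl

lemma isT_eq : W'.IsT = W.IsT := by
  funext d
  rw [eq_iff_iff, ← H.isT_slide_iff d, IsT, IsT, H.bdry_eq, H.bdry_slide, ← H.slide_rot,
    ← H.slide_rot, ← H.slide_rot, ← H.slide_rot, ne_eq, ne_eq, H.slide_injective.eq_iff,
    H.slide_injective.eq_iff]

lemma isL_eq : W'.IsL = W.IsL := by
  funext d
  rw [eq_iff_iff]
  by_cases hT : W.IsT d
  · refine iff_of_false (fun h => h.ne_T ?_) fun h => h.ne_T hT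
    rwa [H.isT_eq]
  have hoff : ∀ i, ¬ W.rot.SameCycle (a i) d := fun i h => hT ((H.isT i).congr h)
  have hr := H.rot_off d hoff
  rw [IsL, IsL, IsLoopVertex, IsLoopVertex, H.bdry_eq, H.rev_eq, hr]
  refine and_congr_right fun _ => and_congr_right fun h => ?_
  rw [H.rot_off]
  intro i hi
  rw [← h] at hi
  exact hoff i (hi.trans (same_rot d).symm)

lemma pass_eq : W'.Pass = W.Pass := by
  funext d
  rw [Pass, Pass, H.isT_eq, H.isL_eq]

lemma opp_slide (d : D) :
    W.slide (W.edges a) (W.opp (W.slide (W.edges a) d)) = W.opp d := by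
  by_cases h1 : d ∈ W.edges a
  · rw [slide_of_mem h1, nxt, opp_opp, slide_of_mem (rev_mem_edges h1), nxt, W.rev_rev]
  by_cases h2 : W.opp d ∈ W.edges a
  · rw [H.slide_of_opp_mem h2, H.slide_of_opp_mem, opp_opp, W.rev_rev]
    rw [opp_opp]
    exact rev_mem_edges h2
  · rw [slide_of_notMem h1 h2, slide_of_notMem h2]
    rwa [opp_opp]

/-- Although vertices move, opposite darts stay opposite, so both webs have the same strands as
sequences of darts. -/
lemma opp_eq : W'.opp = W.opp := by
  funext d
  by_cases hT : W.IsT d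
  · have hT' : W'.IsT d := by rwa [H.isT_eq]
    rw [opp_of_isT hT', ← H.opp_slide, opp_of_isT ((H.isT_slide_iff d).mpr hT), ← H.slide_rot,
      ← H.slide_rot, H.slide_slide]
  by_cases hL : W.IsL d
  · have hL' : W'.IsL d := by rwa [H.isL_eq]
    rw [opp_of_isL hL, opp_of_isL hL', H.rev_eq]
  · have hp : ¬ W.Pass d := fun h => h.elim hT hL
    have hp' : ¬ W'.Pass d := by rwa [H.pass_eq]
    rw [opp_of_not_pass hp, opp_of_not_pass hp']

lemma nxt_eq : W'.nxt = W.nxt := by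
  funext d
  rw [nxt, nxt, H.opp_eq, H.rev_eq]

lemma linked_eq : W'.Linked = W.Linked := by
  unfold Linked
  rw [H.rev_eq, H.pass_eq, H.opp_eq]

lemma step_eq : W'.Step = W.Step := by
  funext d e
  rw [eq_iff_iff, step_iff, step_iff, H.pass_eq, H.rev_eq, H.nxt_eq]

lemma isPath_eq : W'.IsPath = W.IsPath := by
  funext d m
  unfold IsPath
  rw [H.pass_eq, H.rev_eq, H.nxt_eq]

lemma cross_slide {d e : D} (h : W'.Cross d e) :
    W.Cross (W.slide (W.edges a) d) (W.slide (W.edges a) e) := by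
  obtain ⟨h1, h2, h3, h4, h5⟩ := h
  rw [H.bdry_eq] at h2
  rw [H.dbl_eq] at h3 h4
  refine ⟨?_, ?_, ?_, ?_, ?_⟩
  · rw [← H.slide_rot, ← H.slide_rot, H.slide_injective.eq_iff, H.slide_injective.eq_iff]
    exact h1
  · rwa [H.bdry_slide]
  · rwa [H.dbl_slide]
  · rwa [H.dbl_slide]
  · rwa [← H.slide_rot, ← H.slide_rot, ne_eq, H.slide_injective.eq_iff]

lemma same_of_slide {d e : D}
    (h : W.rot.SameCycle (W.slide (W.edges a) d) (W.slide (W.edges a) e)) :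
    W'.rot.SameCycle d e := by
  obtain ⟨w, h1, h2⟩ := sameCycle_induction h
    (fun z => ∃ w, W'.rot.SameCycle d w ∧ z = W.slide (W.edges a) w)
    ⟨d, Equiv.Perm.SameCycle.refl _ _, rfl⟩ (by
      rintro _ ⟨w, h1, rfl⟩
      exact ⟨W'.rot w, h1.trans (same_rot w), (H.slide_rot w).symm⟩)
  rwa [H.slide_injective h2]

lemma not_linked (hno : ∀ C, ¬ W.IsSmall C) {d e : D} (h : W'.Cross d e) : ¬ W'.Linked d e := by
  rw [H.linked_eq]
  intro hl
  exact (H.cross_slide h).not_linked hno ((H.linked_slide d).symm.trans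
    (hl.trans (H.linked_slide e)))

lemma same_of_linked (hno : ∀ C, ¬ W.IsSmall C) {d e d' e' : D} (h : W'.Cross d e)
    (h' : W'.Cross d' e') (hd : W'.Linked d d') (he : W'.Linked e e') :
    W'.rot.SameCycle d d' := by
  rw [H.linked_eq] at hd he
  exact H.same_of_slide ((H.cross_slide h).same_of_linked hno (H.cross_slide h')
    ((H.linked_slide d).symm.trans (hd.trans (H.linked_slide d')))
    ((H.linked_slide e).symm.trans (he.trans (H.linked_slide e'))))

omit [Finite D] in
lemma exists_sign : ∃ σ : Prop, ∀ i, W.out (a i) ↔ σ := by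
  rcases H.cyclic with h | h
  · exact ⟨True, fun i => iff_true_intro (h i)⟩
  · exact ⟨False, fun i => iff_false_intro (h i)⟩

/-- At a vertex of a directed triangle the two sides, read away from the vertex, have opposite
directions. The pattern of a tetravalent vertex then makes both strands go straight on in their
direction. -/
lemma out_nxt {d : D} (hd : d ∈ W.edges a) : W.out (W.nxt d) ↔ W.out d := by
  obtain ⟨σ, hσ⟩ := H.exists_sign
  have key : ∀ i, (W.out (W.nxt (a i)) ↔ W.out (a i)) ∧
      (W.out (W.nxt (W.rev (a (i + 1)))) ↔ W.out (W.rev (a (i + 1)))) := by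
    intro i
    have h1 := (H.isT (i + 1)).pattern
    have h2 := opp_of_isT (H.isT (i + 1)).rot
    rw [H.polygon.rot_succ] at h1 h2
    have h3 : W.rot (W.rev (a i)) = W.opp (a (i + 1)) := by
      rw [opp_of_isT (H.isT _), H.polygon.rot_succ]
    have h4 : W.rot (W.rot (W.rev (a i))) = W.nxt (a i) := by rw [nxt, h2]
    rw [h4, h3] at h1
    have h5 := W.out_rev _ (H.isT i).not_dbl
    have h6 := W.out_rev _ (H.isT (i + 1)).not_dbl
    have h7 := hσ i
    have h8 := hσ (i + 1)
    have h9 : W.nxt (W.rev (a (i + 1))) = W.opp (a (i + 1)) := by rw [nxt, W.rev_rev]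
    rw [h9]
    tauto
  obtain ⟨i, rfl | rfl⟩ := hd
  · exact (key i).1
  · have := (key (i + 1 + 1)).2
    rwa [fin_three_add] at this

/-- Sliding the start drops the first edge, adds one in front or does nothing. A dropped edge has
the direction of its successor by `out_nxt`, so no direction is lost. The excluded path is a single
edge of the triangle, which would vanish. -/
lemma slide_path {d : D} {m : ℕ} (hm : W.IsPath d m) (hd : ¬ (m = 0 ∧ d ∈ W.edges a)) :
    ∃ k, W.IsPath (W.slide (W.edges a) d) k ∧
      W.nxt^[k] (W.slide (W.edges a) d) = W.nxt^[m] d ∧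
      (k = 0 → W.slide (W.edges a) d ∉ W.edges a) ∧
      ∀ j ≤ m, ∃ t ≤ k, W.out (W.nxt^[j] d) ↔ W.out (W.nxt^[t] (W.slide (W.edges a) d)) := by
  by_cases h1 : d ∈ W.edges a
  · obtain ⟨k, rfl⟩ := Nat.exists_eq_add_of_le' (Nat.pos_of_ne_zero fun h => hd ⟨h, h1⟩)
    rw [slide_of_mem h1]
    refine ⟨k, hm.shift 1 k (by omega), rfl, fun _ => H.opp_notMem (rev_mem_edges h1),
      fun j hj => ?_⟩
    rcases j with _ | j
    · exact ⟨0, Nat.zero_le _, (H.out_nxt h1).symm⟩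
    · exact ⟨j, by omega, Iff.rfl⟩
  by_cases h2 : W.opp d ∈ W.edges a
  · have h3 : W.nxt (W.rev (W.opp d)) = d := by rw [nxt, W.rev_rev, opp_opp]
    rw [H.slide_of_opp_mem h2]
    have h4 : ∀ j, W.nxt^[j + 1] (W.rev (W.opp d)) = W.nxt^[j] d := fun j => by
      rw [Function.iterate_succ_apply, h3]
    refine ⟨m + 1, ?_, h4 m, fun h => absurd h (Nat.succ_ne_zero m),
      fun j hj => ⟨j + 1, by omega, by rw [h4]⟩⟩
    intro t ht
    rcases t with _ | t
    · rw [Function.iterate_zero, id, W.rev_rev]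
      exact Or.inl (H.isT_of_mem h2)
    · rw [h4]
      exact hm t (by omega)
  · rw [slide_of_notMem h1 h2]
    exact ⟨m, hm, rfl, fun _ => h1, fun j hj => ⟨j, hj, Iff.rfl⟩⟩

lemma slide_side_path {d : D} {m : ℕ} (hm : W.IsPath d m) (hd : ¬ (m = 0 ∧ d ∈ W.edges a))
    (hdbl : ¬ W.dbl d) : ∃ k, W.IsPath (W.slide (W.edges a) d) k ∧
      W.rev (W.nxt^[k] (W.slide (W.edges a) d)) = W.slide (W.edges a) (W.rev (W.nxt^[m] d)) ∧
      ∀ j ≤ m, ∃ t ≤ k, W.out (W.nxt^[j] d) ↔ W.out (W.nxt^[t] (W.slide (W.edges a) d)) := by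
  obtain ⟨k, h1, h2, h3, h4⟩ := H.slide_path hm hd
  have hdbl' : ¬ W.dbl (W.slide (W.edges a) d) := by rwa [H.dbl_slide]
  have h1' := h1.rev
  rw [h2] at h1'
  -- The other end is slid by applying the same lemma to the reversed path, which is not a single
  -- triangle edge because the first slide left none.
  obtain ⟨l, h5, h6, -, h7⟩ := H.slide_path h1' (by
    rintro ⟨rfl, h⟩
    refine h3 rfl ?_
    rw [rev_mem_edges_iff, ← h2] at h
    exact h)
  set z := W.slide (W.edges a) (W.rev (W.nxt^[m] d)) with hz
  have h8 : W.nxt^[l] z = W.rev (W.slide (W.edges a) d) := by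
    rw [h6, ← h2, nxt_iterate_rev]
  have h9 : ∀ t ≤ l, W.nxt^[t] (W.slide (W.edges a) d) = W.rev (W.nxt^[l - t] z) := by
    intro t ht
    rw [← nxt_iterate_rev_of_le _ ht, h8, W.rev_rev]
  have h10 : W.IsPath (W.slide (W.edges a) d) l := by
    have := h5.rev
    rwa [h8, W.rev_rev] at this
  refine ⟨l, h10, ?_, fun j hj => ?_⟩
  · rw [h9 l le_rfl, W.rev_rev, Nat.sub_self]
    rfl
  · obtain ⟨t, ht, e1⟩ := h4 j hj
    obtain ⟨s, hs, e2⟩ := h7 (k - t) (by omega)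
    have e3 := nxt_iterate_rev_of_le (W := W) (W.slide (W.edges a) d) (show k - t ≤ k by omega)
    rw [h2, Nat.sub_sub_self ht] at e3
    rw [e3, W.out_rev _ (h1.not_dbl hdbl' ht)] at e2
    have e4 := h9 (l - s) (by omega)
    rw [Nat.sub_sub_self hs] at e4
    have e5 := congrArg W.rev e4
    rw [W.rev_rev] at e5
    rw [← e5, W.out_rev _ (h10.not_dbl hdbl' (by omega)), not_iff_not] at e2
    exact ⟨l - s, by omega, e1.trans e2⟩

/-- If a side is a single edge of the flipped face, in either orientation, the triangle is that
face. Otherwise sliding its corners gives a triangle of `W`, which is directed by assumption and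
shows all directions of the original sides. -/
lemma cyc_of_corners (hno : ∀ C, ¬ W.IsBad C) {A : Fin 3 → D} {m : Fin 3 → ℕ}
    (hm : ∀ i, W.IsPath (A i) (m i))
    (hc : ∀ i, W'.Cross (A (i + 1)) (W.rev (W.nxt^[m i] (A i)))) : W.Cyc A m := by
  have hno' : ∀ C, ¬ W.IsSmall C := fun C h => hno C (Or.inl h)
  have h0 : ∀ d, ¬ Relation.TransGen W'.Step d d := by
    intro d hd
    rw [H.step_eq] at hd
    obtain ⟨C, hC⟩ := undirected_iff.mp (Or.inl ⟨d, hd⟩ : W.HasUndirectedConfiguration)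
    exact hno C hC
  have hm' : ∀ i, W'.IsPath (A i) (m i) := fun i => by rw [H.isPath_eq]; exact hm i
  have hc' : ∀ i, W'.Cross (A (i + 1)) (W'.rev (W'.nxt^[m i] (A i))) := fun i => by
    rw [H.nxt_eq, H.rev_eq]; exact hc i
  have hT : ∀ i, W'.IsT (a i) := fun i => by rw [H.isT_eq]; exact H.isT i
  have hTr : ∀ i, W'.IsT (W.rev (a i)) := fun i => by rw [H.isT_eq]; exact H.isT_rev i
  have hX : ∀ i, W'.Cross (a i) (W.rev (a (i + 1))) := fun i => by
    have := isT_cross (hTr (i + 1))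
    rw [H.rot_rev] at this
    exact this.symm
  obtain ⟨σ, hσ⟩ := H.exists_sign
  by_cases hex : ∃ i, m i = 0 ∧ A i ∈ W.edges a
  · obtain ⟨i, hmi, k, hk | hk⟩ := hex
    · have h1 := triangle_eq_of_edge h0 (fun d e => H.not_linked hno')
        (fun d e d' e' => H.same_of_linked hno') hT (by rwa [H.rev_eq]) (by rwa [H.rev_eq])
        hm' hc' hk hmi
      have h2 : ∀ l, ∀ j ≤ m l, W.out (W.nxt^[j] (A l)) ↔ σ := by
        intro l j hj
        obtain ⟨h3, t, h4⟩ := h1 l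
        obtain rfl : j = 0 := by omega
        rw [h4]
        exact hσ t
      by_cases hs : σ
      · exact Or.inl fun l j hj => (h2 l j hj).mpr hs
      · exact Or.inr fun l j hj h => hs ((h2 l j hj).mp h)
    · have h1 := triangle_eq_of_edge (a := fun i => W.rev (a (-i))) h0
        (fun d e => H.not_linked hno') (fun d e d' e' => H.same_of_linked hno')
        (fun i => hTr _) (fun i => by rw [H.rev_eq, W.rev_rev]; exact hT _) (fun i => by
          rw [H.rev_eq, W.rev_rev]
          have := (hX (-(i + 1))).symm
          rwa [show (∀ i : Fin 3, -(i + 1) + 1 = -i) by decide] at this) hm' hc'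
        (k := -k) (by rw [neg_neg]; exact hk) hmi
      have h2 : ∀ l, ∀ j ≤ m l, W.out (W.nxt^[j] (A l)) ↔ ¬ σ := by
        intro l j hj
        obtain ⟨h3, t, h4⟩ := h1 l
        obtain rfl : j = 0 := by omega
        rw [h4, Function.iterate_zero, id, W.out_rev _ (H.isT _).not_dbl, hσ]
      by_cases hs : σ
      · exact Or.inr fun l j hj h => (h2 l j hj).mp h hs
      · exact Or.inl fun l j hj => (h2 l j hj).mpr hs
  · have hdbl : ∀ i, ¬ W.dbl (A i) := fun i => by
      have := (hc (i - 1)).2.2.1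
      rwa [sub_add_cancel, H.dbl_eq] at this
    choose k h1 h2 h3 using fun i =>
      H.slide_side_path (hm i) (fun h => hex ⟨i, h⟩) (hdbl i)
    have hP := isPoly_three_of_no_small hno' h1 (fun i => by
      rw [h2]
      exact H.cross_slide (hc i))
    have hcyc : W.Cyc (fun i => W.slide (W.edges a) (A i)) k := by
      by_contra hcyc
      exact hno _ (Or.inr ⟨_, _, hP, hcyc, rfl⟩)
    rcases hcyc with h | h
    · refine Or.inl fun i j hj => ?_
      obtain ⟨t, ht, e⟩ := h3 i j hj
      exact e.mpr (h i t ht)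
    · refine Or.inr fun i j hj ho => ?_
      obtain ⟨t, ht, e⟩ := h3 i j hj
      exact h i t ht (e.mp ho)

end TriFlip

/-- If `W` has no bad curve, its strands neither close up nor meet themselves or one another twice,
and the same holds in `W'`; the triangles are left to `cyc_of_corners`. -/
lemma bad_of_triangleMove (h : W.TriangleMove W') (hbad : ∃ C, W'.IsBad C) :
    ∃ C, W.IsBad C := by
  by_contra hno
  push Not at hno
  have hno' : ∀ C, ¬ W.IsSmall C := fun C h => hno C (Or.inl h)
  obtain ⟨a, H⟩ := triFlip_of_triangleMove hno' h
  rcases undirected_iff.mpr hbad with ⟨d, hd⟩ | ⟨d, e, h1, h2⟩ | ⟨d, e, d', e', h1, h2, h3, h4, h5⟩ |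
    ⟨A, E, h1, h2, -, h4, h5⟩
  · rw [H.step_eq] at hd
    obtain ⟨C, hC⟩ := undirected_iff.mp (Or.inl ⟨d, hd⟩ : W.HasUndirectedConfiguration)
    exact hno C hC
  · exact H.not_linked hno' h2 (h1.linked.trans (linked_rev e))
  · exact h5 (H.same_of_linked hno' h3 h4 (h1.linked.trans (linked_rev e))
      (h2.linked.trans (linked_rev e')))
  · choose m hm hE using fun i => seg_iff.mp (h1 i)
    have hd : ∀ i, ¬ W'.dbl (A i) := fun i => by
      have := (h2 (i - 1)).2.2.1
      rwa [sub_add_cancel] at this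
    have hcyc := H.cyc_of_corners hno (A := A) (m := m)
      (fun i => by rw [← H.isPath_eq]; exact hm i)
      (fun i => by rw [← H.nxt_eq, ← H.rev_eq, hE]; exact h2 i)
    rw [Cyc, ← H.nxt_eq, ← H.out_eq] at hcyc
    rcases hcyc with hcyc | hcyc
    · refine h4 fun i => ?_
      rw [← hE]
      exact forwardSeg_of_isPath (hm i) fun j hj => Or.inr (hcyc i j hj)
    · refine h5 fun i => ?_
      rw [← hE]
      exact forwardSeg_rev_of_isPath (hm i) (hd i) fun j hj => hcyc i j hj

/-- The moves are undone one by one, starting from the web with a reducible face. -/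
lemma bad_of_reducible (h : W.Reducible) : ∃ C, W.IsBad C := by
  obtain ⟨W', h1, h2⟩ := h
  induction h1 using Relation.ReflTransGen.head_induction_on with
  | refl => exact directed_iff.mp (directed_of_face h2)
  | head h _ ih =>
    rcases h with h | h
    exacts [bad_of_squareMove h.symm ih, bad_of_triangleMove h ih]

end

end Web

end A3

theorem mainTheorem9 {D F : Type*} [Finite D] (W : A3.Web D F) :
    (W.Reducible ↔ W.HasDirectedConfiguration) ∧
      (W.Reducible ↔ W.HasUndirectedConfiguration) := by
  have h : W.Reducible ↔ ∃ C, W.IsBad C :=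
    ⟨A3.Web.bad_of_reducible, A3.Web.reducible_of_bad⟩
  exact ⟨h.trans A3.Web.directed_iff.symm, h.trans A3.Web.undirected_iff.symm⟩
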